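/- Let $\mathbf a=(a_k)_{k\ge 0}$ be real with $\inf_k a_k>0$ and $\sup_k a_k<\infty$, and set $p_x(z)=\prod_{k=0}^{x-1}(1-z/a_k)$. For $f$ holomorphic in $\{\Re z>-\epsilon\}$ for some $\epsilon>0$, let $$\mathsf T_f(x,y)=-\frac{1}{2\pi i}\frac1{a_y}\oint_{\mathsf C_{\mathbf a}}\frac{p_x(w)}{p_{y+1}(w)}f(w)\,dw,\qquad x,y\in\mathbb Z_+,$$ where $\mathsf C_{\mathbf a}\subset\{\Re z>-\epsilon\}$ is a positively oriented contour encircling all $a_k$. Let $N\ge1$, $\mathbb W_N=\{\mathbf x\in\mathbb Z_+^N: x_1<\dots<x_N\}$, and for $\mathbf x,\mathbf y\in\mathbb Z_+^N$ write $\mathbf x\prec\mathbf y$ if $x_1\le y_1<x_2\le y_2<\dots<x_N\le y_N$. For $\bullet\in\{\mathrm{pb},\mathrm B,\mathrm g\}$ (pure-birth with time set $[0,\infty)$; Bernoulli and geometric with time set $\mathbb Z_+$) put $$h^{\mathrm{pb}}_\gamma(x)=p_x(-\gamma),\quad h^{\mathrm B}_\gamma(x)=p_x(1-\gamma^{-1}),\quad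 h^{\mathrm g}_\gamma(x)=p_x(\gamma^{-1}-1),$$ $$c^{\mathrm{pb}}_{t,\gamma}=e^{t\gamma},\quad c^{\mathrm B}_{t,\gamma}=\gamma^{-t},\quad c^{\mathrm g}_{t,\gamma}=\gamma^t,$$ let $\mathsf T^\bullet_t=\mathsf T_{f}$ with $f(z)=e^{-tz}$, $(1-z)^t$, $(1+z)^{-t}$ respectively, and $$\mathcal P^{\boldsymbol\gamma,\bullet,N}_t(\mathbf x,\mathbf y)=\prod_{j=1}^N\frac1{c^\bullet_{t,\gamma_j}}\cdot\frac{\det(h^\bullet_{\gamma_i}(y_j))_{i,j=1}^N}{\det(h^\bullet_{\gamma_i}(x_j))_{i,j=1}^N}\cdot\det(\mathsf T^\bullet_t(x_i,y_j))_{i,j=1}^N .$$ Let $\mathsf X(t)=(\mathsf x_1(t),\dots,\mathsf x_N(t))$ have independent coordinates, $\mathsf X(0)=\mathbf x\in\mathbb W_N$, where $\mathsf x_i$ is a time-homogeneous Markov chain on $\mathbb Z_+$: for pb, the (càdlàg) pure-birth chain with jump rate $a_k+\gamma_i$ at $k$; for B, the chain which from $k$ moves to $k+1$ with probability $\gamma_i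 a_k+1-\gamma_i$ and stays with probability $\gamma_i-\gamma_ia_k$; for g, the chain which from $k$ moves to $y\ge k$ with probability $\frac{1}{\gamma_i(1+a_y)}\prod_{m=k}^{y-1}\frac{\gamma_i(1+a_m)-1}{\gamma_i(1+a_m)}$. Assume, for all $i$ (and $i\le N-1$ in the conditions involving $\gamma_{i+1}$): - pb: $\gamma_i\ge0$ and $\gamma_{i+1}-\gamma_i>\sup_k a_k-\inf_k a_k$; - B: $\sup_k a_k\le 1$, $0<\gamma_i\le1$ and $\dfrac{\gamma_{i+1}}{\gamma_i}<\dfrac{1-\sup_k a_k}{1-\inf_k a_k}$; - g: $\gamma_i\ge1$ and $\dfrac{\gamma_{i+1}}{\gamma_i}>\dfrac{1+\sup_k a_k}{1+\inf_k a_k}$. Let the collision time $\tau$ be $\inf\{t>0:\mathsf X(t-)\nprec\mathsf X(t)\}$ for pb (with $\mathsf X(t-)$ the left limit) and for g (with $\mathsf X(t-)=\mathsf X(t-1)$), and $\inf\{t>0:\mathsf X(t)\notin\mathbb W_N\}$ for B. Then in each of the three cases $$\mathbb P(\tau=\infty)=\frac{\det(h^\bullet_{\gamma_i}(x_j))_{i,j=1}^N}{\prod_{i=1}^N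 h^\bullet_{\gamma_i}(x_i)}>0,$$ and, conditioned on $\{\tau=\infty\}$, the process $\mathsf X$ is a time-homogeneous Markov process in $\mathbb W_N$ with transition probabilities $\mathcal P_t^{\boldsymbol\gamma,\bullet,N}$. -/

import Mathlib

open MeasureTheory ProbabilityTheory Filter Topology
open scoped NNReal ENNReal

noncomputable section

namespace CondWalks

/-- The characteristic polynomials `p_x(z) = ∏_{k < x} (1 - z / a_k)`. -/
def charPoly (a : ℕ → ℝ) (x : ℕ) (z : ℂ) : ℂ :=
  ∏ k ∈ Finset.range x, (1 - z / (a k : ℂ))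

/-- The inhomogeneous Toeplitz-like kernel
`T_f(x, y) = - (1 / (2 π i)) (1 / a_y) ∮ p_x(w) / p_{y+1}(w) f(w) dw`. The contour is the positively
oriented circle with centre `sup a` and radius `sup a - (inf a) / 2`; it encircles
`[inf a, sup a]` and lies, with its interior, in the half plane `Re w > 0`. -/
def toeplitz (a : ℕ → ℝ) (f : ℂ → ℂ) (x y : ℕ) : ℂ :=
  -(1 / (2 * (Real.pi : ℂ) * Complex.I)) * (1 / (a y : ℂ)) *
    ∮ w in C(((⨆ k, a k : ℝ) : ℂ), (⨆ k, a k) - (⨅ k, a k) / 2),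
      charPoly a x w / charPoly a (y + 1) w * f w

/-- The (open) discrete Weyl chamber `x_1 < x_2 < ⋯ < x_N`. -/
def Weyl (N : ℕ) : Set (Fin N → ℕ) := {x | StrictMono x}

/-- Interlacing of two `N`-point configurations: `x_1 ≤ y_1 < x_2 ≤ y_2 < ⋯ < x_N ≤ y_N`. -/
def Interlace {N : ℕ} (x y : Fin N → ℕ) : Prop :=
  (∀ i, x i ≤ y i) ∧ ∀ i j : Fin N, (i : ℕ) + 1 = (j : ℕ) → y i < x j

/-- The determinant `det (h_i(x_j))`. -/
def detH {N : ℕ} (h : Fin N → ℕ → ℂ) (x : Fin N → ℕ) : ℂ :=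
  Matrix.det (Matrix.of fun i j : Fin N => h i (x j))

/-- `∏_j c_j⁻¹ * det (h_i(y_j)) / det (h_i(x_j)) * det (T(x_i, y_j))`. -/
def transformedKernel {N : ℕ} (c : Fin N → ℂ) (h : Fin N → ℕ → ℂ) (T : ℕ → ℕ → ℂ)
    (x y : Fin N → ℕ) : ℂ :=
  (∏ j, 1 / c j) * (detH h y / detH h x) *
    Matrix.det (Matrix.of fun i j : Fin N => T (x i) (y j))

/-! ### The functions `h_γ` and the kernels of the conditioned walks -/

/-- `h_γ` for pure-birth chains. -/
def hPB (a : ℕ → ℝ) (γ : ℝ) (x : ℕ) : ℂ := charPoly a x (-(γ : ℂ))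

/-- `h_γ` for Bernoulli walks. -/
def hB (a : ℕ → ℝ) (γ : ℝ) (x : ℕ) : ℂ := charPoly a x (1 - (γ : ℂ)⁻¹)

/-- `h_γ` for geometric walks. -/
def hG (a : ℕ → ℝ) (γ : ℝ) (x : ℕ) : ℂ := charPoly a x ((γ : ℂ)⁻¹ - 1)

/-- The kernel `𝒫_t` for pure-birth chains. -/
def kernelPB (a : ℕ → ℝ) {N : ℕ} (γ : Fin N → ℝ) (t : ℝ≥0) : (Fin N → ℕ) → (Fin N → ℕ) → ℂ :=
  transformedKernel (fun j => Complex.exp ((t : ℝ) * (γ j : ℂ))) (fun i => hPB a (γ i))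
    (toeplitz a fun z => Complex.exp (-((t : ℝ) * z)))

/-- The kernel `𝒫_t` for Bernoulli walks. -/
def kernelB (a : ℕ → ℝ) {N : ℕ} (γ : Fin N → ℝ) (t : ℕ) : (Fin N → ℕ) → (Fin N → ℕ) → ℂ :=
  transformedKernel (fun j => ((γ j : ℂ) ^ t)⁻¹) (fun i => hB a (γ i))
    (toeplitz a fun z => (1 - z) ^ t)

/-- The kernel `𝒫_t` for geometric walks. -/
def kernelG (a : ℕ → ℝ) {N : ℕ} (γ : Fin N → ℝ) (t : ℕ) : (Fin N → ℕ) → (Fin N → ℕ) → ℂ :=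
  transformedKernel (fun j => (γ j : ℂ) ^ t) (fun i => hG a (γ i))
    (toeplitz a fun z => ((1 + z) ^ t)⁻¹)

/-! ### Transition probabilities of the individual walks -/

/-- Generator of the pure-birth chain that jumps from `x` to `x + 1` at rate `r x`. -/
def birthGenerator (r : ℕ → ℝ) (g : ℕ → ℝ) (x : ℕ) : ℝ := r x * (g (x + 1) - g x)

/-- Transition function of the pure-birth chain with (bounded) jump rates `r`: the `(x, y)` entry
`∑_n t^n / n! (Q^n 1_{y})(x)` of `exp (t Q)`, where `Q` is the generator, a bounded operator on
bounded functions. -/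
def birthTransition (r : ℕ → ℝ) (t : ℝ≥0) (x y : ℕ) : ℝ :=
  ∑' n : ℕ, (t : ℝ) ^ n / (n.factorial : ℝ) * (birthGenerator r)^[n] (Pi.single y 1) x

/-- The `t`-step transition probabilities of the Markov chain on `ℕ` with one-step transition
probabilities `K`. -/
def stepPow (K : ℕ → ℕ → ℝ) : ℕ → ℕ → ℕ → ℝ
  | 0, x, y => if x = y then 1 else 0
  | t + 1, x, y => ∑' z, K x z * stepPow K t z y

/-- Pure-birth chain with rate `a_k + γ` at location `k`. -/
def walkPB (a : ℕ → ℝ) (γ : ℝ) (t : ℝ≥0) (x y : ℕ) : ℝ :=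
  birthTransition (fun k => a k + γ) t x y

/-- One step of the inhomogeneous Bernoulli walk. -/
def stepB (a : ℕ → ℝ) (γ : ℝ) (x y : ℕ) : ℝ :=
  if y = x + 1 then γ * a x + 1 - γ else if y = x then γ - γ * a x else 0

/-- One step of the inhomogeneous geometric walk. -/
def stepG (a : ℕ → ℝ) (γ : ℝ) (x y : ℕ) : ℝ :=
  if x ≤ y then
    1 / (γ * (1 + a y)) * ∏ k ∈ Finset.Ico x y, (γ * (1 + a k) - 1) / (γ * (1 + a k))
  else 0

/-- Transition probabilities of the Bernoulli walk. -/
def walkB (a : ℕ → ℝ) (γ : ℝ) : ℕ → ℕ → ℕ → ℝ := stepPow (stepB a γ)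

/-- Transition probabilities of the geometric walk. -/
def walkG (a : ℕ → ℝ) (γ : ℝ) : ℕ → ℕ → ℕ → ℝ := stepPow (stepG a γ)

/-! ### Processes -/

/-- Under `μ`, the process `X`, with time set `T`, is a time-homogeneous Markov process with values
in the set `E` (of a countable discrete space `S`) and with transition probabilities `K`:
`P(X_{t_{n+1}} = s_{n+1}, X_{t_n} = s_n, …, X_{t_0} = s_0)
  = P(X_{t_n} = s_n, …, X_{t_0} = s_0) K_{t_{n+1} - t_n}(s_n, s_{n+1})`
for all times `t_0 ≤ t_1 ≤ ⋯ ≤ t_{n+1}` and all states `s_i` in `E`. The kernel is complex-valued so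
that kernels given by complex contour integrals can be used as they are. -/
structure IsMarkov {Ω T S : Type*} [MeasurableSpace Ω] [Preorder T] [Sub T] (μ : Measure Ω)
    (E : Set S) (K : T → S → S → ℂ) (X : T → Ω → S) : Prop where
  mem : ∀ t, ∀ᵐ ω ∂μ, X t ω ∈ E
  markov : ∀ (n : ℕ) (t : ℕ → T), Monotone t → ∀ s : ℕ → S, (∀ i, s i ∈ E) →
    (μ.real {ω | ∀ i ≤ n + 1, X (t i) ω = s i} : ℂ) =
      (μ.real {ω | ∀ i ≤ n, X (t i) ω = s i} : ℂ) * K (t (n + 1) - t n) (s n) (s (n + 1))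

/-- `N` independent Markov processes on `ℕ` with time set `T`, the `i`-th one with transition
probabilities `K i` and started from `x i`. -/
structure IndepWalks {Ω T : Type*} [MeasurableSpace Ω] [Preorder T] [Sub T] [Zero T]
    (μ : Measure Ω) {N : ℕ} (K : Fin N → T → ℕ → ℕ → ℝ) (x : Fin N → ℕ)
    (X : T → Ω → Fin N → ℕ) : Prop where
  measurable : ∀ t i, Measurable fun ω => X t ω i
  indep : iIndepFun (fun (i : Fin N) (ω : Ω) (t : T) => X t ω i) μ
  initial : ∀ᵐ ω ∂μ, X 0 ω = x
  markov : ∀ i, IsMarkov μ Set.univ (fun t u v => (K i t u v : ℂ)) fun t ω => X t ω i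

/-- Right-continuous paths with left limits. -/
def IsCadlag {N : ℕ} (p : ℝ≥0 → Fin N → ℕ) : Prop :=
  ∀ t, ContinuousWithinAt p (Set.Ici t) t ∧ ∃ l, Tendsto p (𝓝[<] t) (𝓝 l)

/-- First collision time `inf {t > 0 : X(t-) ⊀ X(t)}` of a path in continuous time. -/
def collisionTimePB {N : ℕ} (p : ℝ≥0 → Fin N → ℕ) : ℝ≥0∞ :=
  sInf ((fun t : ℝ≥0 => (t : ℝ≥0∞)) '' {t | 0 < t ∧ ¬ Interlace (Function.leftLim p t) (p t)})

/-- First collision time `inf {t > 0 : X(t) ∉ 𝕎_N}` of a path of Bernoulli walks. -/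
def collisionTimeB {N : ℕ} (p : ℕ → Fin N → ℕ) : ℕ∞ :=
  sInf ((fun t : ℕ => (t : ℕ∞)) '' {t | 0 < t ∧ p t ∉ Weyl N})

/-- First collision time `inf {t > 0 : X(t-1) ⊀ X(t)}` of a path of geometric walks. -/
def collisionTimeG {N : ℕ} (p : ℕ → Fin N → ℕ) : ℕ∞ :=
  sInf ((fun t : ℕ => (t : ℕ∞)) '' {t | 0 < t ∧ ¬ Interlace (p (t - 1)) (p t)})

/-- The process `X`, started from `x` and conditioned on the event `A` (which has positive
probability `det (h_i(x_j)) / ∏_i h_i(x_i)`), is a Markov process in the Weyl chamber with transition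
probabilities `P`. -/
structure ConditionedOn {Ω T : Type*} [MeasurableSpace Ω] [Preorder T] [Sub T] (μ : Measure Ω)
    {N : ℕ} (X : T → Ω → Fin N → ℕ) (x : Fin N → ℕ) (A : Set Ω) (h : Fin N → ℕ → ℂ)
    (P : T → (Fin N → ℕ) → (Fin N → ℕ) → ℂ) : Prop where
  nullMeasurable : NullMeasurableSet A μ
  pos : 0 < μ A
  prob : (μ.real A : ℂ) = detH h x / ∏ i, h i (x i)
  markov : IsMarkov (ProbabilityTheory.cond μ A) (Weyl N) P X

end CondWalks

end

open MeasureTheory ProbabilityTheory Filter Topology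
open scoped NNReal ENNReal

namespace CondWalks

/-! ### Cauchy–Binet formula and compound matrices -/

/-! All the walks are Doob transforms of one base walk. Let `T_t` be the contour kernel, which is
the walk with `γ = 0` (pure birth) or `γ = 1` (Bernoulli, geometric). Put `θ_i = γ_i`, `1/γ_i - 1`
or `1 - 1/γ_i` respectively. Then `h_i(x) = p_x(-θ_i)` is a positive eigenfunction of `T_t`, with
some eigenvalue `c_i^t`, and the `i`-th walk has kernel `h_i(y) T_t(x,y) / (h_i(x) c_i^t)`. Killing
the independent walks at their first collision gives the Karlin–McGregor kernel `κ_t(x,y) = ∏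
h_i(y_i)/(h_i(x_i) c_i^t) · det T_t(x_i,y_j)`.

Let `u(x) = det h_i(x_j) / ∏ h_i(x_i)`. By Cauchy–Binet, `∑_y κ_t(x,y) u(y) = u(x)`. The heart of
the matter is that the survival probability `∑_y κ_t(x,y)` tends to `u(x)`
(`BaseWalk.tendsto_survival`). Then `P(τ = ∞) = u(x)`, and the Markov property gives the conditioned
process the kernel `κ_t(x,y) u(y) / u(x)`, which is `𝒫_t`.

The error is `∑_y κ_t(x,y) (1 - u(y))`. Up to sign, `1 - u(y)` is a signed sum over `σ ≠ 1` of `∏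
h_{σ i}(y_i)/h_i(y_i)`. By the rearrangement inequality each such product is at most 1 on ordered
`y`, hence at most its square root. Since `κ_t` is at most the product of the one-walk kernels, the
error is at most a sum over `σ ≠ 1` of expectations that factorise over `i`. Each factor is, up to
normalisation, the Hellinger affinity at time `t` of the walks `i` and `σ i`. The holding
probabilities of two different walks differ by an amount bounded below uniformly in the position, so
one-step affinities are at most some `ρ < 1` and the error decays geometrically.

Positivity of `u` (`det_harm_pos`) is an induction on `N` through interlacing sums. In discrete time
`κ` is a determinant because the one-step determinants collapse to a single product on
collision-free steps and compound matrices are multiplicative. In continuous time a step of length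
`d/m` commits an error `O(m⁻²)`, so `m` steps converge to the determinant, while for càdlàg paths
collision-freeness on the grid converges to collision-freeness. As the walks never move down, the
semigroup identities are checked on finite truncations. -/

/-- Strictly increasing `n`-tuples in `κ`. -/
abbrev Cfg (n : ℕ) (κ : Type*) [Preorder κ] : Type _ := {f : Fin n → κ // StrictMono f}

noncomputable instance {n : ℕ} {κ : Type*} [Preorder κ] [Finite κ] : Fintype (Cfg n κ) :=
  Fintype.ofFinite _

noncomputable instance {n : ℕ} {κ : Type*} [Preorder κ] : DecidableEq (Cfg n κ) :=
  Classical.decEq _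

section CauchyBinet

variable {R : Type*} [CommRing R] {n : ℕ}

/-- Each row of `A * B` is a combination of the rows of `B`; multilinearity of the determinant
expands it over the choices of one index per row. -/
theorem det_mul_eq_sum_fun {κ : Type*} [Fintype κ] (A : Matrix (Fin n) κ R)
    (B : Matrix κ (Fin n) R) :
    (A * B).det = ∑ f : Fin n → κ, (∏ i, A i (f i)) * (B.submatrix f id).det := by
  have h : (A * B).det =
      (Matrix.detRowAlternating (n := Fin n) (R := R)).toMultilinearMap
        (fun i => ∑ k, A i k • B k) := by
    change _ = Matrix.det _
    congr 1
    ext i j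
    simp [Matrix.mul_apply, Finset.sum_apply]
  rw [h, MultilinearMap.map_sum]
  refine Finset.sum_congr rfl fun f _ => ?_
  rw [MultilinearMap.map_smul_univ]
  rfl

variable {κ : Type*} [LinearOrder κ]

/-- Non-injective choices of rows give a determinant with two equal rows. An injective choice is
uniquely an increasing tuple composed with a permutation, and the signed sum over permutations is a
minor of `A`. -/
theorem det_mul_cauchyBinet [Fintype κ] (A : Matrix (Fin n) κ R) (B : Matrix κ (Fin n) R) :
    (A * B).det = ∑ e : Cfg n κ, (A.submatrix id e.1).det * (B.submatrix e.1 id).det := by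
  rw [det_mul_eq_sum_fun]
  symm
  have h1 : ∀ e : Cfg n κ, (A.submatrix id e.1).det * (B.submatrix e.1 id).det =
      ∑ σ : Equiv.Perm (Fin n),
        (∏ i, A i (e.1 (σ i))) * (B.submatrix (e.1 ∘ σ) id).det := by
    intro e
    rw [← Matrix.det_transpose (A.submatrix id e.1), Matrix.det_apply, Finset.sum_mul]
    refine Finset.sum_congr rfl fun σ _ => ?_
    have : (B.submatrix (e.1 ∘ σ) id) = (B.submatrix e.1 id).submatrix σ id := rfl
    rw [this, Matrix.det_permute]
    simp only [Matrix.transpose_apply, Matrix.submatrix_apply, id, Units.smul_def, zsmul_eq_mul]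
    ring
  rw [Finset.sum_congr rfl fun e _ => h1 e, ← Finset.sum_product']
  refine Finset.sum_of_injOn (fun p => p.1.1 ∘ p.2) ?_ (fun _ _ => by simp) ?_ (fun _ _ => rfl)
  · rintro ⟨e, σ⟩ - ⟨e', σ'⟩ - h
    simp only at h
    have hr : Set.range e.1 = Set.range e'.1 := by
      rw [← σ.surjective.range_comp e.1, ← σ'.surjective.range_comp e'.1, h]
    have he : e = e' := Subtype.ext ((StrictMono.range_inj e.2 e'.2).1 hr)
    subst he
    have : σ = σ' := by
      ext1 i
      exact e.2.injective (congrFun h i)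
    rw [this]
  · intro f _ hf
    by_cases hinj : Function.Injective f
    · exfalso
      apply hf
      have hm : StrictMono (f ∘ Tuple.sort f) :=
        (Tuple.monotone_sort f).strictMono_of_injective (hinj.comp (Tuple.sort f).injective)
      refine ⟨(⟨f ∘ Tuple.sort f, hm⟩, (Tuple.sort f)⁻¹), by simp, ?_⟩
      ext i
      simp
    · obtain ⟨i, j, hij, hne⟩ : ∃ i j, f i = f j ∧ i ≠ j := by
        simpa [Function.Injective] using hinj
      rw [Matrix.det_zero_of_row_eq hne, mul_zero]
      ext k
      simp [hij]

/-- The `n`-th compound matrix. -/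
def compound (n : ℕ) (A : Matrix κ κ R) : Matrix (Cfg n κ) (Cfg n κ) R :=
  Matrix.of fun e e' => (A.submatrix e.1 e'.1).det

/-- Multiplicativity makes the Karlin–McGregor determinants a semigroup: minors of a power are
entries of a power of the matrix of minors. -/
theorem compound_mul [Fintype κ] (A B : Matrix κ κ R) :
    compound n (A * B) = compound n A * compound n B := by
  ext e e'
  rw [Matrix.mul_apply]
  exact det_mul_cauchyBinet (A.submatrix e.1 id) (B.submatrix id e'.1)

theorem compound_one : compound n (1 : Matrix κ κ R) = 1 := by
  ext e e'
  by_cases h : e = e'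
  · subst h
    simp only [compound, Matrix.of_apply, Matrix.one_apply_eq]
    rw [Matrix.submatrix_one _ e.2.injective, Matrix.det_one]
  · rw [Matrix.one_apply_ne h]
    have : ∃ i, e.1 i ∉ Set.range e'.1 := by
      by_contra! hc
      apply h
      have hs : Set.range e.1 ⊆ Set.range e'.1 := by
        rintro _ ⟨i, rfl⟩
        exact hc i
      have hcard : (Set.range e'.1).ncard ≤ (Set.range e.1).ncard := by
        rw [← Set.image_univ, ← Set.image_univ, Set.ncard_image_of_injective _ e.2.injective,
          Set.ncard_image_of_injective _ e'.2.injective]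
      exact Subtype.ext ((StrictMono.range_inj e.2 e'.2).1
        (Set.eq_of_subset_of_ncard_le hs hcard))
    obtain ⟨i, hi⟩ := this
    refine Matrix.det_eq_zero_of_row_eq_zero i fun j => ?_
    rw [Matrix.submatrix_apply, Matrix.one_apply_ne]
    exact fun hc => hi ⟨j, hc.symm⟩

theorem compound_pow [Fintype κ] (A : Matrix κ κ R) (m : ℕ) :
    compound n (A ^ m) = compound n A ^ m := by
  induction m with
  | zero => rw [pow_zero, pow_zero, compound_one]
  | succ m ih => rw [pow_succ, compound_mul, ih, pow_succ]

end CauchyBinet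

/-- Powers of a Doob transform. -/
theorem doob_pow {ι : Type*} [Fintype ι] [DecidableEq ι] (M : Matrix ι ι ℝ) (g : ι → ℝ)
    (hg : ∀ e, g e ≠ 0) (c : ℝ) (m : ℕ) (e e' : ι) :
    ((Matrix.of fun e e' => g e' / (g e * c) * M e e' : Matrix ι ι ℝ) ^ m) e e' =
      g e' / (g e * c ^ m) * (M ^ m) e e' := by
  induction m generalizing e e' with
  | zero =>
    by_cases h : e = e'
    · subst h
      simp [hg e]
    · simp [Matrix.one_apply_ne h]
  | succ m ih =>
    rw [pow_succ _ m, pow_succ M m, Matrix.mul_apply, Matrix.mul_apply, Finset.mul_sum]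
    refine Finset.sum_congr rfl fun w _ => ?_
    rw [ih, Matrix.of_apply, pow_succ]
    have := hg w
    have := hg e
    by_cases hc : c = 0
    · simp [hc]
    field_simp

theorem matrix_pow_nonneg {ι : Type*} [Fintype ι] [DecidableEq ι] {M : Matrix ι ι ℝ}
    (hM : ∀ e e', 0 ≤ M e e') (m : ℕ) (e e' : ι) : 0 ≤ (M ^ m) e e' := by
  induction m generalizing e e' with
  | zero => rw [pow_zero, Matrix.one_apply]; split_ifs <;> norm_num
  | succ m ih =>
    rw [pow_succ, Matrix.mul_apply]
    exact Finset.sum_nonneg fun w _ => mul_nonneg (ih _ _) (hM _ _)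

theorem matrix_pow_row_sum_le {ι : Type*} [Fintype ι] [DecidableEq ι] {M : Matrix ι ι ℝ} {ρ : ℝ}
    (hρ : 0 ≤ ρ) (hM : ∀ e e', 0 ≤ M e e') (hs : ∀ e, ∑ e', M e e' ≤ ρ) (m : ℕ) (e : ι) :
    ∑ e', (M ^ m) e e' ≤ ρ ^ m := by
  induction m generalizing e with
  | zero => simp [Matrix.one_apply]
  | succ m ih =>
    simp_rw [pow_succ' M, Matrix.mul_apply]
    rw [Finset.sum_comm]
    calc ∑ w, ∑ e', M e w * (M ^ m) w e' = ∑ w, M e w * ∑ e', (M ^ m) w e' := by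
          simp_rw [Finset.mul_sum]
      _ ≤ ∑ w, M e w * ρ ^ m := by
          gcongr with w
          · exact hM _ _
          · exact ih w
      _ = (∑ w, M e w) * ρ ^ m := by rw [Finset.sum_mul]
      _ ≤ ρ ^ (m + 1) := by
          rw [pow_succ']
          gcongr
          exact hs e

end CondWalks

namespace CondWalks

/-! ### The harmonic functions `∏_{k < x} (1 + θ / a_k)` -/

/-- `∏_{k < x} (1 + θ / a_k)`, the value of `p_x` at `-θ`. -/
noncomputable def harm (a : ℕ → ℝ) (θ : ℝ) (x : ℕ) : ℝ := ∏ k ∈ Finset.range x, (1 + θ / a k)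

theorem charPoly_neg_ofReal (a : ℕ → ℝ) (θ : ℝ) (x : ℕ) :
    charPoly a x (-(θ : ℂ)) = (harm a θ x : ℂ) := by
  simp [charPoly, harm, neg_div]

theorem harm_succ (a : ℕ → ℝ) (θ : ℝ) (x : ℕ) :
    harm a θ (x + 1) = harm a θ x * (1 + θ / a x) := Finset.prod_range_succ _ _

theorem harm_pos {a : ℕ → ℝ} (ha : ∀ k, 0 < a k) {θ : ℝ} (hθ : 0 ≤ θ) (x : ℕ) :
    0 < harm a θ x :=
  Finset.prod_pos fun k _ => by have := ha k; positivity

/-- From `1 + η/a = (1 + θ/a)(1 + (η - θ)/(a + θ))`. Quotients of two functions of the family belong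
to the family with shifted parameters, so that an induction on `N` can close. -/
theorem harm_add {a : ℕ → ℝ} (ha : ∀ k, 0 < a k) {θ : ℝ} (hθ : 0 ≤ θ) (η : ℝ) (x : ℕ) :
    harm a η x = harm a θ x * harm (fun k => a k + θ) (η - θ) x := by
  rw [harm, harm, harm, ← Finset.prod_mul_distrib]
  refine Finset.prod_congr rfl fun k _ => ?_
  have h1 := ha k
  have h2 : a k + θ ≠ 0 := by positivity
  field_simp
  ring

theorem harm_sub_harm (a : ℕ → ℝ) (θ : ℝ) {x y : ℕ} (h : x ≤ y) :
    harm a θ y - harm a θ x = ∑ k ∈ Finset.Ico x y, θ * ((a k)⁻¹ * harm a θ k) := by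
  rw [← Finset.sum_Ico_sub (harm a θ) h]
  refine Finset.sum_congr rfl fun k _ => ?_
  rw [harm_succ]
  ring

/-- Dividing each column by its first entry makes the first row constant 1. Subtracting neighbouring
columns clears that row except for its first entry, and turns the other entries into telescoping
sums, which multilinearity expands over `r` with `y_j ≤ r_j < y_{j+1}`. -/
theorem det_harm_succ (a : ℕ → ℝ) (ha : ∀ k, 0 < a k) {N : ℕ} (θ : Fin (N + 1) → ℝ)
    (h0 : 0 ≤ θ 0) (y : Fin (N + 1) → ℕ) (hy : StrictMono y) :
    (Matrix.of fun i j => harm a (θ i) (y j)).det =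
      (∏ j, harm a (θ 0) (y j)) * ∑ r ∈ Fintype.piFinset fun j : Fin N =>
        Finset.Ico (y j.castSucc) (y j.succ),
        (∏ i : Fin N, (θ i.succ - θ 0)) * ((∏ j : Fin N, (a (r j) + θ 0)⁻¹) *
          (Matrix.of fun i j : Fin N =>
            harm (fun k => a k + θ 0) (θ i.succ - θ 0) (r j)).det) := by
  set a' : ℕ → ℝ := fun k => a k + θ 0 with ha'
  set G : Matrix (Fin (N + 1)) (Fin (N + 1)) ℝ :=
    Matrix.of fun i j => harm a' (θ i - θ 0) (y j) with hG
  have h1 : (Matrix.of fun i j => harm a (θ i) (y j)) =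
      Matrix.of fun i j => harm a (θ 0) (y j) * G i j := by
    ext i j
    exact harm_add ha h0 _ _
  rw [h1, Matrix.det_mul_row]
  congr 1
  set B : Matrix (Fin (N + 1)) (Fin (N + 1)) ℝ :=
    Matrix.of fun i j => Fin.cases (G i 0) (fun j => G i j.succ - G i j.castSucc) j with hB
  have h2 : G.det = B.det := by
    refine Matrix.det_eq_of_forall_col_eq_smul_add_pred (fun _ => 1) (fun i => ?_) fun i j => ?_
    · simp [hB]
    · simp [hB]
  have h3 : B.det = (B.submatrix Fin.succ Fin.succ).det := by
    rw [Matrix.det_succ_row_zero, Fin.sum_univ_succ]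
    simp [hB, hG, harm]
  have h4 : (B.submatrix Fin.succ Fin.succ).transpose =
      Matrix.of fun j : Fin N => ∑ k ∈ Finset.Ico (y j.castSucc) (y j.succ),
        (a' k)⁻¹ • fun i : Fin N => (θ i.succ - θ 0) * harm a' (θ i.succ - θ 0) k := by
    ext j i
    have := harm_sub_harm a' (θ i.succ - θ 0) (hy (Fin.castSucc_lt_succ (i := j))).le
    simp only [hB, hG, Matrix.transpose_apply, Matrix.submatrix_apply, Matrix.of_apply,
      Fin.cases_succ, Finset.sum_apply, Pi.smul_apply, smul_eq_mul]
    rw [this]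
    refine Finset.sum_congr rfl fun k _ => ?_
    ring
  rw [h2, h3, ← Matrix.det_transpose, h4]
  refine (MultilinearMap.map_sum_finset
    (Matrix.detRowAlternating (n := Fin N) (R := ℝ)).toMultilinearMap
    (fun _ k => (a' k)⁻¹ • fun i : Fin N => (θ i.succ - θ 0) * harm a' (θ i.succ - θ 0) k)
    fun j => Finset.Ico (y j.castSucc) (y j.succ)).trans ?_
  refine Finset.sum_congr rfl fun r _ => ?_
  rw [MultilinearMap.map_smul_univ, smul_eq_mul, mul_left_comm]
  congr 1
  rw [← Matrix.det_mul_column, ← Matrix.det_transpose]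
  rfl

/-- Every term of `det_harm_succ` is positive: the interlacing `r` is again strictly increasing, and
`a + θ_0`, `θ_{i+1} - θ_0` again satisfy the hypotheses. The induction therefore has to run over all
`a`. -/
theorem det_harm_pos {N : ℕ} : ∀ (a : ℕ → ℝ) (_ : ∀ k, 0 < a k) (θ : Fin N → ℝ)
    (_ : ∀ i, 0 ≤ θ i) (_ : StrictMono θ) (y : Fin N → ℕ) (_ : StrictMono y),
    0 < (Matrix.of fun i j => harm a (θ i) (y j)).det := by
  induction N with
  | zero => intros; simp
  | succ N ih =>
    intro a ha θ h0 hθ y hy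
    rw [det_harm_succ a ha θ (h0 0) y hy]
    refine mul_pos (Finset.prod_pos fun j _ => harm_pos ha (h0 0) _) (Finset.sum_pos ?_ ?_)
    · intro r hr
      rw [Fintype.mem_piFinset] at hr
      have hlt : ∀ i : Fin N, 0 < θ i.succ - θ 0 := fun i => sub_pos.2 (hθ (Fin.succ_pos i))
      have hpos : ∀ k, 0 < a k + θ 0 := fun k => add_pos_of_pos_of_nonneg (ha k) (h0 0)
      refine mul_pos (Finset.prod_pos fun i _ => hlt i)
        (mul_pos (Finset.prod_pos fun j _ => inv_pos.2 (hpos _)) ?_)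
      refine ih _ hpos (fun i => θ i.succ - θ 0) (fun i => (hlt i).le) ?_ r ?_
      · intro i j hij
        exact sub_lt_sub_right (hθ (Fin.succ_lt_succ_iff.2 hij)) _
      · intro i j hij
        have h1 := Finset.mem_Ico.1 (hr i)
        have h2 := Finset.mem_Ico.1 (hr j)
        exact h1.2.trans_le ((hy.monotone (Fin.succ_le_castSucc_iff.2 hij)).trans h2.1)
    · refine ⟨fun j => y j.castSucc, ?_⟩
      rw [Fintype.mem_piFinset]
      exact fun j => Finset.mem_Ico.2 ⟨le_rfl, hy Fin.castSucc_lt_succ⟩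

/-- A common range of summation with an indicator lets the rearrangement inequality be used for each
`k` separately. -/
theorem log_harm {a : ℕ → ℝ} (ha : ∀ k, 0 < a k) {θ : ℝ} (hθ : 0 ≤ θ) {x K : ℕ} (h : x ≤ K) :
    Real.log (harm a θ x) =
      ∑ k ∈ Finset.range K, Real.log (1 + θ / a k) * if k < x then 1 else 0 := by
  rw [harm, Real.log_prod (fun k _ => by have := ha k; positivity)]
  simp only [mul_ite, mul_one, mul_zero]
  rw [← Finset.sum_filter]
  refine Finset.sum_congr ?_ fun _ _ => rfl
  ext k
  simp only [Finset.mem_range, Finset.mem_filter]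
  omega

/-- Rearrangement inequality: the identity maximises `∏ᵢ h_{σ i}(yᵢ)`. -/
theorem prod_harm_perm_le {a : ℕ → ℝ} (ha : ∀ k, 0 < a k) {N : ℕ} {θ : Fin N → ℝ}
    (h0 : ∀ i, 0 ≤ θ i) (hθ : StrictMono θ) {y : Fin N → ℕ} (hy : StrictMono y)
    (σ : Equiv.Perm (Fin N)) :
    ∏ i, harm a (θ (σ i)) (y i) ≤ ∏ i, harm a (θ i) (y i) := by
  rw [← Real.log_le_log_iff (Finset.prod_pos fun i _ => harm_pos ha (h0 _) _)
    (Finset.prod_pos fun i _ => harm_pos ha (h0 _) _),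
    Real.log_prod (fun i _ => (harm_pos ha (h0 _) _).ne'),
    Real.log_prod (fun i _ => (harm_pos ha (h0 _) _).ne')]
  obtain ⟨K, hK⟩ : ∃ K, ∀ i, y i ≤ K := ⟨∑ i, y i, fun i =>
    Finset.single_le_sum (f := y) (fun _ _ => Nat.zero_le _) (Finset.mem_univ i)⟩
  rw [Finset.sum_congr rfl fun i _ => log_harm ha (h0 (σ i)) (hK i),
    Finset.sum_congr rfl fun i _ => log_harm ha (h0 i) (hK i),
    Finset.sum_comm, Finset.sum_comm (s := Finset.univ) (t := Finset.range K)]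
  refine Finset.sum_le_sum fun k _ => ?_
  have hk := ha k
  -- For fixed `k` both the logarithm and the indicator of `k < y i` increase with `i`.
  have hmono : Monovary (fun i => Real.log (1 + θ i / a k))
      (fun i => if k < y i then (1 : ℝ) else 0) := by
    refine Monotone.monovary (fun i j hij => ?_) fun i j hij => ?_
    · have := h0 i
      exact Real.log_le_log (by positivity) (by gcongr; exact hθ.monotone hij)
    · have := hy.monotone hij
      split_ifs <;> first | exact le_rfl | exact zero_le_one | omega
  simpa [smul_eq_mul] using hmono.sum_comp_perm_smul_le_sum_smul (σ := σ)

end CondWalks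

namespace CondWalks

/-! ### Doob transforms and the limit of the survival probabilities -/

/-- Doob transform of the kernel `A` by an eigenfunction `h` with eigenvalue `c`. -/
noncomputable def doob (h : ℕ → ℝ) (c : ℝ) (A : ℕ → ℕ → ℝ) (x y : ℕ) : ℝ :=
  h y / (h x * c) * A x y

/-- Karlin–McGregor kernel of the Doob transformed walks killed at their first collision. -/
noncomputable def killed {N : ℕ} (h : Fin N → ℕ → ℝ) (c : Fin N → ℝ) (A : ℕ → ℕ → ℝ)
    (s y : Fin N → ℕ) : ℝ :=
  (∏ i, h i (y i) / (h i (s i) * c i)) * (Matrix.of fun i j => A (s i) (y j)).det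

/-- `det (h_i(y_j)) / ∏ h_i(y_i)`. -/
noncomputable def survival {N : ℕ} (h : Fin N → ℕ → ℝ) (y : Fin N → ℕ) : ℝ :=
  (Matrix.of fun i j => h i (y j)).det / ∏ i, h i (y i)

/-- The upper left `K × K` block of a kernel on `ℕ`. -/
def trunc (K : ℕ) (A : ℕ → ℕ → ℝ) : Matrix (Fin K) (Fin K) ℝ := Matrix.of fun i j => A i j

/-- The configuration in `ℕ` underlying an element of `Cfg N (Fin K)`. -/
def Cfg.toNat {N K : ℕ} (e : Cfg N (Fin K)) : Fin N → ℕ := fun i => (e.1 i : ℕ)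

theorem Cfg.toNat_strictMono {N K : ℕ} (e : Cfg N (Fin K)) : StrictMono e.toNat :=
  fun _ _ hij => e.2 hij

theorem trunc_doob_pow {T : ℕ → ℕ → ℕ → ℝ} (hpow : ∀ K k, trunc K (T k) = trunc K (T 1) ^ k)
    {h : ℕ → ℝ} (hh : ∀ x, h x ≠ 0) (c : ℝ) (K k : ℕ) :
    trunc K (doob h (c ^ k) (T k)) = trunc K (doob h c (T 1)) ^ k := by
  ext x y
  have := doob_pow (trunc K (T 1)) (fun x : Fin K => h x) (fun x => hh x) c k x y
  rw [← hpow] at this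
  exact this.symm

/-- Two subprobability vectors which differ at one point have affinity bounded away from `1`. -/
theorem sum_sqrt_mul_le {p q : ℕ → ℝ} (hp : ∀ y, 0 ≤ p y) (hq : ∀ y, 0 ≤ q y)
    (hp1 : ∀ K, ∑ y ∈ Finset.range K, p y ≤ 1) (hq1 : ∀ K, ∑ y ∈ Finset.range K, q y ≤ 1)
    {ε : ℝ} (hε : 0 ≤ ε) (x : ℕ) (hx : ε ≤ |p x - q x|) (K : ℕ) :
    ∑ y ∈ Finset.range K, √(p y * q y) ≤ 1 - ε ^ 2 / 8 := by
  set s := Finset.range (max K (x + 1)) with hs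
  have hxs : x ∈ s := by simp [hs]
  have h1 : ∑ y ∈ Finset.range K, √(p y * q y) ≤ ∑ y ∈ s, √(p y * q y) :=
    Finset.sum_le_sum_of_subset_of_nonneg (Finset.range_mono (le_max_left _ _))
      fun _ _ _ => Real.sqrt_nonneg _
  have e1 : p x + ∑ y ∈ s.erase x, p y = ∑ y ∈ s, p y := Finset.add_sum_erase _ _ hxs
  have e2 : q x + ∑ y ∈ s.erase x, q y = ∑ y ∈ s, q y := Finset.add_sum_erase _ _ hxs
  have e3 : √(p x * q x) + ∑ y ∈ s.erase x, √(p y * q y) = ∑ y ∈ s, √(p y * q y) :=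
    Finset.add_sum_erase _ (fun y => √(p y * q y)) hxs
  -- Cauchy–Schwarz away from `x`, where the total masses are at most `1 - p x` and `1 - q x`.
  have h2 : ∑ y ∈ s.erase x, √(p y * q y) ≤ √(1 - p x) * √(1 - q x) := by
    simp_rw [Real.sqrt_mul (hp _)]
    refine (Real.sum_sqrt_mul_sqrt_le _ hp hq).trans ?_
    have := hp1 (max K (x + 1))
    have := hq1 (max K (x + 1))
    gcongr <;> linarith
  have hpn : 0 ≤ ∑ y ∈ s.erase x, p y := Finset.sum_nonneg fun y _ => hp y
  have hqn : 0 ≤ ∑ y ∈ s.erase x, q y := Finset.sum_nonneg fun y _ => hq y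
  have hpx : p x ≤ 1 := by have := hp1 (max K (x + 1)); linarith
  have hqx : q x ≤ 1 := by have := hq1 (max K (x + 1)); linarith
  rw [Real.sqrt_mul (hp x)] at e3
  have a1 := Real.sq_sqrt (hp x)
  have a2 := Real.sq_sqrt (hq x)
  have a3 := Real.sq_sqrt (sub_nonneg.2 hpx)
  have a4 := Real.sq_sqrt (sub_nonneg.2 hqx)
  have b1 : √(p x) ≤ 1 := Real.sqrt_le_one.2 hpx
  have b2 : √(q x) ≤ 1 := Real.sqrt_le_one.2 hqx
  have b3 := Real.sqrt_nonneg (p x)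
  have b4 := Real.sqrt_nonneg (q x)
  -- Since `p - q = (√p - √q)(√p + √q)` and the second factor is at most 2. Together with `√p√q +
  -- √(1-p)√(1-q) ≤ 1 - (√p - √q)²/2` this produces the constant 8.
  have h3 : ε ^ 2 ≤ 4 * (√(p x) - √(q x)) ^ 2 := by
    have : ε ^ 2 ≤ (p x - q x) ^ 2 := by
      rw [← sq_abs (p x - q x)]
      gcongr
    have h5 : (p x - q x) ^ 2 = (√(p x) - √(q x)) ^ 2 * (√(p x) + √(q x)) ^ 2 := by
      rw [← mul_pow]
      congr 1
      nlinarith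
    have h6 : (√(p x) + √(q x)) ^ 2 ≤ 4 := by nlinarith
    nlinarith [sq_nonneg (√(p x) - √(q x))]
  nlinarith [sq_nonneg (√(1 - p x) - √(1 - q x))]

/-- The integer-time data of the walks: a base kernel, with positive eigenfunctions whose Doob
transforms are stochastic and mutually separated. -/
structure BaseWalk {N : ℕ} (T : ℕ → ℕ → ℕ → ℝ) (h : Fin N → ℕ → ℝ) (c : Fin N → ℝ) : Prop where
  nonneg : ∀ x y, 0 ≤ T 1 x y
  pow : ∀ K k, trunc K (T k) = trunc K (T 1) ^ k
  h_pos : ∀ i x, 0 < h i x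
  c_pos : ∀ i, 0 < c i
  sum : ∀ i k x, Tendsto (fun K => ∑ y ∈ Finset.range K, doob (h i) (c i ^ k) (T k) x y) atTop
    (𝓝 1)
  separated : ∀ i j, i ≠ j → ∃ ε > 0, ∀ x, ε ≤ |doob (h i) (c i) (T 1) x x -
    doob (h j) (c j) (T 1) x x|

namespace BaseWalk

variable {N : ℕ} {T : ℕ → ℕ → ℕ → ℝ} {h : Fin N → ℕ → ℝ} {c : Fin N → ℝ}

theorem nonneg_all (H : BaseWalk T h c) (k x y : ℕ) : 0 ≤ T k x y := by
  have := matrix_pow_nonneg (M := trunc (x + y + 1) (T 1)) (fun _ _ => H.nonneg _ _) k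
    ⟨x, by omega⟩ ⟨y, by omega⟩
  rwa [← H.pow] at this

theorem doob_nonneg (H : BaseWalk T h c) (i : Fin N) (k x y : ℕ) :
    0 ≤ doob (h i) (c i ^ k) (T k) x y := by
  have := H.h_pos i y
  have := H.h_pos i x
  have := H.c_pos i
  have := H.nonneg_all k x y
  rw [doob]
  positivity

theorem sum_le_one (H : BaseWalk T h c) (i : Fin N) (k x K : ℕ) :
    ∑ y ∈ Finset.range K, doob (h i) (c i ^ k) (T k) x y ≤ 1 := by
  refine Monotone.ge_of_tendsto ?_ (H.sum i k x) K
  intro K K' hK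
  exact Finset.sum_le_sum_of_subset_of_nonneg (Finset.range_mono hK)
    fun _ _ _ => H.doob_nonneg _ _ _ _

/-- The geometric mean of two Doob transforms of one kernel has again the form of a Doob transform,
by `√(h_i h_j)`, so affinities over many steps are controlled by powers of a single matrix. -/
theorem doob_sqrt_eq (H : BaseWalk T h c) (i j : Fin N) (x y : ℕ) :
    doob (fun x => √(h i x * h j x)) √(c i * c j) (T 1) x y =
      √(doob (h i) (c i) (T 1) x y * doob (h j) (c j) (T 1) x y) := by
  have h1 := H.h_pos i x
  have h2 := H.h_pos i y
  have h3 := H.h_pos j x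
  have h4 := H.h_pos j y
  have h5 := H.c_pos i
  have h6 := H.c_pos j
  have h7 := H.nonneg x y
  have e : doob (h i) (c i) (T 1) x y * doob (h j) (c j) (T 1) x y =
      (h i y * h j y) / ((h i x * h j x) * (c i * c j)) * T 1 x y ^ 2 := by
    simp only [doob]
    field_simp
  rw [e, Real.sqrt_mul (x := h i y * h j y / (h i x * h j x * (c i * c j))) (by positivity),
    Real.sqrt_div (by positivity), Real.sqrt_mul (x := h i x * h j x) (by positivity),
    Real.sqrt_sq h7, doob]

/-- Exponential decay of the affinity between two different walks. -/
theorem exists_affinity (H : BaseWalk T h c) : ∃ ρ : Fin N → Fin N → ℝ, (∀ i j, 0 ≤ ρ i j) ∧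
    (∀ i j, ρ i j ≤ 1) ∧ (∀ i j, i ≠ j → ρ i j < 1) ∧ ∀ i j k K (x : Fin K),
      ∑ y : Fin K, doob (fun x => √(h i x * h j x)) (√(c i * c j) ^ k) (T k) x y ≤ ρ i j ^ k := by
  have key : ∀ i j, ∃ r : ℝ, 0 ≤ r ∧ r ≤ 1 ∧ (i ≠ j → r < 1) ∧ ∀ x K,
      ∑ y ∈ Finset.range K, doob (fun x => √(h i x * h j x)) √(c i * c j) (T 1) x y ≤ r := by
    intro i j
    have hd : ∀ i x y, 0 ≤ doob (h i) (c i) (T 1) x y := fun i x y => by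
      simpa using H.doob_nonneg i 1 x y
    have hs : ∀ i x K, ∑ y ∈ Finset.range K, doob (h i) (c i) (T 1) x y ≤ 1 := fun i x K => by
      simpa using H.sum_le_one i 1 x K
    simp_rw [H.doob_sqrt_eq]
    -- The diagonal pairs are kept, with `ε = 0` and hence `ρ = 1`, because a permutation may fix
    -- points.
    obtain ⟨ε, hε, hb⟩ : ∃ ε : ℝ, 0 ≤ ε ∧ (i ≠ j → 0 < ε) ∧
        ∀ x, ε ≤ |doob (h i) (c i) (T 1) x x - doob (h j) (c j) (T 1) x x| := by
      by_cases hij : i = j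
      · exact ⟨0, le_rfl, fun hne => (hne hij).elim, fun x => abs_nonneg _⟩
      · obtain ⟨ε, h1, h2⟩ := H.separated i j hij
        exact ⟨ε, h1.le, fun _ => h1, h2⟩
    have hmain : ∀ x K, ∑ y ∈ Finset.range K,
        √(doob (h i) (c i) (T 1) x y * doob (h j) (c j) (T 1) x y) ≤ 1 - ε ^ 2 / 8 :=
      fun x K => sum_sqrt_mul_le (hd i x) (hd j x) (hs i x) (hs j x) hε x (hb.2 x) K
    refine ⟨1 - ε ^ 2 / 8, ?_, by have := sq_nonneg ε; linarith, fun hij => ?_, hmain⟩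
    -- The empty sum shows that the bound itself is nonnegative.
    · simpa using hmain 0 0
    · have := hb.1 hij
      have : 0 < ε ^ 2 := by positivity
      linarith
  choose ρ h0 h1 h2 h3 using key
  refine ⟨ρ, h0, h1, h2, fun i j k K x => ?_⟩
  have hh : ∀ x, √(h i x * h j x) ≠ 0 := fun x =>
    (Real.sqrt_pos.2 (mul_pos (H.h_pos i x) (H.h_pos j x))).ne'
  have e := trunc_doob_pow H.pow hh √(c i * c j) K k
  have : ∀ y : Fin K, doob (fun x => √(h i x * h j x)) (√(c i * c j) ^ k) (T k) x y =
      (trunc K (doob (fun x => √(h i x * h j x)) √(c i * c j) (T 1)) ^ k) x y := by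
    intro y
    rw [← e]
    rfl
  rw [Finset.sum_congr rfl fun y _ => this y]
  refine matrix_pow_row_sum_le (h0 i j) (fun x y => ?_) (fun x => ?_) k x
  · rw [trunc, Matrix.of_apply, H.doob_sqrt_eq]
    exact Real.sqrt_nonneg _
  · have := h3 i j x K
    rwa [Finset.sum_range] at this

/-- Truncated harmonicity of `survival` for the killed kernel: the factors `h_i(y_i)` cancel, and
Cauchy–Binet sums `det T · det h`. -/
theorem sum_killed_mul_survival (H : BaseWalk T h c) (k K : ℕ) (s : Fin N → ℕ) :
    ∑ e : Cfg N (Fin K), killed h (fun i => c i ^ k) (T k) s e.toNat * survival h e.toNat =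
      (∏ i, (h i (s i) * c i ^ k)⁻¹) *
        (Matrix.of fun i j => ∑ y ∈ Finset.range K, T k (s i) y * h j y).det := by
  have e1 : (Matrix.of fun i j => ∑ y ∈ Finset.range K, T k (s i) y * h j y) =
      (Matrix.of fun (i : Fin N) (y : Fin K) => T k (s i) y) *
        (Matrix.of fun (y : Fin K) (j : Fin N) => h j y) := by
    ext i j
    rw [Matrix.mul_apply, Matrix.of_apply, Finset.sum_range]
    rfl
  rw [e1, det_mul_cauchyBinet, Finset.mul_sum]
  refine Finset.sum_congr rfl fun e _ => ?_
  have e2 : (Matrix.of fun i j => h i (e.toNat j)).det =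
      ((Matrix.of fun (y : Fin K) (j : Fin N) => h j y).submatrix e.1 id).det := by
    rw [← Matrix.det_transpose]
    rfl
  have hne : ∏ i, h i (e.toNat i) ≠ 0 := Finset.prod_ne_zero_iff.2 fun i _ => (H.h_pos i _).ne'
  rw [killed, survival, e2]
  simp only [div_eq_mul_inv]
  rw [Finset.prod_mul_distrib]
  have : (Matrix.of fun i j => T k (s i) (e.toNat j)) =
    (Matrix.of fun (i : Fin N) (y : Fin K) => T k (s i) y).submatrix id e.1 := rfl
  rw [this]
  field_simp

/-- Stochasticity of the Doob transforms says that `h_j` is an eigenfunction, so the entries tend to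
`c_j^k h_j(s_i)`. With `sum_killed_mul_survival` this is harmonicity in the limit. -/
theorem tendsto_det_sum (H : BaseWalk T h c) (k : ℕ) (s : Fin N → ℕ) :
    Tendsto (fun K => (∏ i, (h i (s i) * c i ^ k)⁻¹) *
        (Matrix.of fun i j => ∑ y ∈ Finset.range K, T k (s i) y * h j y).det) atTop
      (𝓝 (survival h s)) := by
  have h1 : Tendsto (fun K => (Matrix.of fun i j =>
      ∑ y ∈ Finset.range K, T k (s i) y * h j y).det) atTop
      (𝓝 (Matrix.of fun i j => h j (s i) * c j ^ k).det) := by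
    refine ((continuous_id.matrix_det (n := Fin N) (R := ℝ)).tendsto _).comp ?_
    refine tendsto_pi_nhds.2 fun i => tendsto_pi_nhds.2 fun j => ?_
    have h2 := (H.sum j k (s i)).const_mul (h j (s i) * c j ^ k)
    rw [mul_one] at h2
    refine h2.congr fun K => ?_
    rw [Finset.mul_sum]
    refine Finset.sum_congr rfl fun y _ => ?_
    have := (H.h_pos j (s i)).ne'
    have := (H.c_pos j).ne'
    rw [doob]
    field_simp
  have h3 := h1.const_mul (∏ i, (h i (s i) * c i ^ k)⁻¹)
  refine h3.congr' (EventuallyEq.refl _ _) |>.trans_eq ?_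
  congr 1
  have e1 : (Matrix.of fun i j => h j (s i) * c j ^ k).det =
      (∏ j, c j ^ k) * (Matrix.of fun i j => h i (s j)).det := by
    rw [← Matrix.det_transpose (Matrix.of fun i j => h i (s j)), ← Matrix.det_mul_row]
    congr 1
    ext i j
    exact mul_comm _ _
  have n1 : ∏ i, h i (s i) ≠ 0 := Finset.prod_ne_zero_iff.2 fun i _ => (H.h_pos i _).ne'
  have n2 : ∏ i, c i ^ k ≠ 0 := Finset.prod_ne_zero_iff.2 fun i _ => (pow_pos (H.c_pos i) k).ne'
  rw [e1, survival, Finset.prod_inv_distrib, Finset.prod_mul_distrib]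
  field_simp

end BaseWalk

end CondWalks

/-! ### Geometric decay of the error in the survival probability -/

namespace CondWalks

/-- In the Leibniz expansion the identity contributes exactly 1. The other ratios lie in `[0, 1]`,
hence are at most their square roots, and the mean of a square root is an affinity, which decays. -/
theorem abs_one_sub_survival_le {N : ℕ} {h : Fin N → ℕ → ℝ} (h_pos : ∀ i x, 0 < h i x)
    {y : Fin N → ℕ}
    (hperm : ∀ σ : Equiv.Perm (Fin N), ∏ i, h (σ i) (y i) ≤ ∏ i, h i (y i)) :
    |1 - survival h y| ≤ ∑ σ ∈ Finset.univ.erase (1 : Equiv.Perm (Fin N)),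
      ∏ i, √(h (σ i) (y i) / h i (y i)) := by
  have n1 : 0 < ∏ i, h i (y i) := Finset.prod_pos fun i _ => h_pos _ _
  have e1 : survival h y = ∑ σ : Equiv.Perm (Fin N),
      (Equiv.Perm.sign σ : ℤ) * ((∏ i, h (σ i) (y i)) / ∏ i, h i (y i)) := by
    rw [survival, Matrix.det_apply, Finset.sum_div]
    refine Finset.sum_congr rfl fun σ _ => ?_
    simp [Units.smul_def, mul_div_assoc]
  rw [e1, ← Finset.add_sum_erase _ _ (Finset.mem_univ (1 : Equiv.Perm (Fin N)))]
  simp only [Equiv.Perm.sign_one, Units.val_one, Int.cast_one, Equiv.Perm.one_apply,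
    div_self n1.ne', mul_one, sub_add_cancel_left, abs_neg]
  refine (Finset.abs_sum_le_sum_abs _ _).trans (Finset.sum_le_sum fun σ _ => ?_)
  have h0 : 0 ≤ (∏ i, h (σ i) (y i)) / ∏ i, h i (y i) :=
    div_nonneg (Finset.prod_nonneg fun i _ => (h_pos _ _).le) n1.le
  have h1 : (∏ i, h (σ i) (y i)) / ∏ i, h i (y i) ≤ 1 := (div_le_one n1).2 (hperm σ)
  have h2 : |((Equiv.Perm.sign σ : ℤ) : ℝ)| = 1 := by
    rcases Int.units_eq_one_or (Equiv.Perm.sign σ) with h | h <;> simp [h]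
  rw [abs_mul, h2, one_mul, abs_of_nonneg h0]
  have h3 : ∏ i, √(h (σ i) (y i) / h i (y i)) = √((∏ i, h (σ i) (y i)) / ∏ i, h i (y i)) := by
    rw [← Finset.prod_div_distrib, Real.sqrt_prod]
    exact fun i _ => (div_pos (h_pos _ _) (h_pos _ _)).le
  rw [h3]
  exact Real.le_sqrt_of_sq_le (by nlinarith)

/-- Weighting the walk of `h` by `√(h'/h)` gives the geometric-mean kernel of `h` and `h'`, up to a
factor depending on the starting point and the time only. -/
theorem doob_mul_sqrt {h h' : ℕ → ℝ} (h_pos : ∀ x, 0 < h x) (h_pos' : ∀ x, 0 < h' x) {c c' : ℝ}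
    (hc : 0 < c) (hc' : 0 < c') (A : ℕ → ℕ → ℝ) (k s y : ℕ) :
    doob h (c ^ k) A s y * √(h' y / h y) =
      √(h' s / h s) * √(c' / c) ^ k * doob (fun x => √(h x * h' x)) (√(c * c') ^ k) A s y := by
  -- Writing all positive quantities as squares removes the roots and leaves a rational identity.
  have e : ∀ {r : ℝ}, 0 < r → ∃ t, 0 < t ∧ r = t ^ 2 := fun {r} hr =>
    ⟨√r, Real.sqrt_pos.2 hr, (Real.sq_sqrt hr.le).symm⟩
  obtain ⟨a, ha, ea⟩ := e (h_pos s)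
  obtain ⟨b, hb, eb⟩ := e (h_pos y)
  obtain ⟨a', ha', ea'⟩ := e (h_pos' s)
  obtain ⟨b', hb', eb'⟩ := e (h_pos' y)
  obtain ⟨d, hd, ed⟩ := e hc
  obtain ⟨d', hd', ed'⟩ := e hc'
  simp only [doob, ea, eb, ea', eb', ed, ed']
  rw [← div_pow, ← div_pow, ← div_pow, ← mul_pow, ← mul_pow, ← mul_pow, Real.sqrt_sq, Real.sqrt_sq,
    Real.sqrt_sq, Real.sqrt_sq, Real.sqrt_sq, Real.sqrt_sq] <;> try positivity
  rw [div_pow, mul_pow, ← pow_mul, mul_comm 2 k, pow_mul]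
  field_simp

namespace BaseWalk

variable {N : ℕ} {T : ℕ → ℕ → ℕ → ℝ} {h : Fin N → ℕ → ℝ} {c : Fin N → ℝ}

/-- Dropping the ordering of the configuration lets the sum factorise into row sums of affinity
kernels. The factors `√(c_{σ i} / c_i)` multiply to 1 because `σ` is a bijection. -/
theorem sum_prod_doob_mul_sqrt_le (H : BaseWalk T h c) {ρ : Fin N → Fin N → ℝ}
    (hρ : ∀ i j k K (x : Fin K),
      ∑ y : Fin K, doob (fun x => √(h i x * h j x)) (√(c i * c j) ^ k) (T k) x y ≤ ρ i j ^ k)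
    (s : Fin N → ℕ) (k K : ℕ) (hK : ∀ i, s i < K) (σ : Equiv.Perm (Fin N)) :
    ∑ e : Cfg N (Fin K), ∏ i, (doob (h i) (c i ^ k) (T k) (s i) (e.toNat i) *
        √(h (σ i) (e.toNat i) / h i (e.toNat i))) ≤
      (∏ i, √(h (σ i) (s i) / h i (s i))) * (∏ i, ρ i (σ i)) ^ k := by
  set q : Fin N → Fin K → ℝ := fun i y =>
    doob (fun x => √(h i x * h (σ i) x)) (√(c i * c (σ i)) ^ k) (T k) (s i) y with hq
  have hq0 : ∀ i y, 0 ≤ q i y := fun i y =>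
    mul_nonneg (div_nonneg (Real.sqrt_nonneg _)
      (mul_nonneg (Real.sqrt_nonneg _) (pow_nonneg (Real.sqrt_nonneg _) _))) (H.nonneg_all _ _ _)
  have hc : ∏ i, √(c (σ i) / c i) ^ k = 1 := by
    rw [Finset.prod_pow, ← Real.sqrt_prod _ fun i _ => (div_pos (H.c_pos _) (H.c_pos _)).le,
      Finset.prod_div_distrib, Equiv.prod_comp σ c, div_self, Real.sqrt_one, one_pow]
    exact Finset.prod_ne_zero_iff.2 fun i _ => (H.c_pos i).ne'
  calc _ = ∑ e : Cfg N (Fin K), (∏ i, √(h (σ i) (s i) / h i (s i))) * ∏ i, q i (e.1 i) := by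
        refine Finset.sum_congr rfl fun e _ => ?_
        rw [Finset.prod_congr rfl fun i _ => doob_mul_sqrt (H.h_pos i) (H.h_pos (σ i)) (H.c_pos i)
          (H.c_pos (σ i)) (T k) k (s i) (e.toNat i), Finset.prod_mul_distrib,
          Finset.prod_mul_distrib, hc, mul_one]
        rfl
    _ = (∏ i, √(h (σ i) (s i) / h i (s i))) * ∑ e : Cfg N (Fin K), ∏ i, q i (e.1 i) := by
        rw [Finset.mul_sum]
    _ ≤ (∏ i, √(h (σ i) (s i) / h i (s i))) * ∑ f : Fin N → Fin K, ∏ i, q i (f i) := by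
        refine mul_le_mul_of_nonneg_left ?_ (Finset.prod_nonneg fun i _ => Real.sqrt_nonneg _)
        refine (Finset.sum_map Finset.univ (Function.Embedding.subtype _)
          (fun f : Fin N → Fin K => ∏ i, q i (f i))).symm.trans_le ?_
        exact Finset.sum_le_sum_of_subset_of_nonneg (Finset.subset_univ _)
          fun f _ _ => Finset.prod_nonneg fun i _ => hq0 _ _
    _ = (∏ i, √(h (σ i) (s i) / h i (s i))) * ∏ i, ∑ y, q i y := by
        rw [Finset.prod_univ_sum, Fintype.piFinset_univ]
    _ ≤ (∏ i, √(h (σ i) (s i) / h i (s i))) * (∏ i, ρ i (σ i)) ^ k := by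
        refine mul_le_mul_of_nonneg_left ?_ (Finset.prod_nonneg fun i _ => Real.sqrt_nonneg _)
        rw [← Finset.prod_pow]
        exact Finset.prod_le_prod (fun i _ => Finset.sum_nonneg fun y _ => hq0 i y)
          fun i _ => hρ i (σ i) k K ⟨s i, hK i⟩

/-- The survival probabilities up to time `k` converge to `survival h s`. -/
theorem tendsto_survival (H : BaseWalk T h c)
    (hperm : ∀ (σ : Equiv.Perm (Fin N)) (y : Fin N → ℕ), StrictMono y →
      ∏ i, h (σ i) (y i) ≤ ∏ i, h i (y i)) (s : Fin N → ℕ)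
    (hκ0 : ∀ k y, StrictMono y → 0 ≤ killed h (fun i => c i ^ k) (T k) s y)
    (hκ1 : ∀ k y, StrictMono y → killed h (fun i => c i ^ k) (T k) s y ≤
      ∏ i, doob (h i) (c i ^ k) (T k) (s i) (y i))
    {v : ℝ} (hv : 0 ≤ v) {m : ℕ → ℝ}
    (hm : ∀ k, Tendsto (fun K => v * ∑ e : Cfg N (Fin K),
      killed h (fun i => c i ^ k) (T k) s e.toNat) atTop (𝓝 (m k))) :
    Tendsto m atTop (𝓝 (v * survival h s)) := by
  obtain ⟨ρ, h0, h1, h2, h3⟩ := H.exists_affinity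
  set b : ℕ → ℝ := fun k => v * ∑ σ ∈ Finset.univ.erase (1 : Equiv.Perm (Fin N)),
    (∏ i, √(h (σ i) (s i) / h i (s i))) * (∏ i, ρ i (σ i)) ^ k with hb
  have hb0 : Tendsto b atTop (𝓝 0) := by
    have hz : v * ∑ σ ∈ Finset.univ.erase (1 : Equiv.Perm (Fin N)),
      (∏ i, √(h (σ i) (s i) / h i (s i))) * 0 = 0 := by simp
    rw [← hz]
    refine (tendsto_finsetSum _ fun σ hσ => Tendsto.const_mul _ ?_).const_mul v
    refine tendsto_pow_atTop_nhds_zero_of_lt_one (Finset.prod_nonneg fun i _ => h0 _ _) ?_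
    -- One moved index gives one factor `ρ i (σ i) < 1`; all other factors are at most 1.
    obtain ⟨i, hi⟩ : ∃ i, σ i ≠ i := by
      by_contra! hc
      exact (Finset.mem_erase.1 hσ).1 (Equiv.ext hc)
    rw [← Finset.mul_prod_erase _ _ (Finset.mem_univ i)]
    exact mul_lt_one_of_nonneg_of_lt_one_left (h0 _ _) (h2 _ _ hi.symm)
      (Finset.prod_le_one (fun i _ => h0 _ _) fun i _ => h1 _ _)
  have hbound : ∀ k, |m k - v * survival h s| ≤ b k := by
    intro k
    have t1 := ((hm k).sub ((H.tendsto_det_sum k s).const_mul v)).abs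
    refine le_of_tendsto t1 ?_
    obtain ⟨K0, hK0⟩ : ∃ K, ∀ i, s i < K := ⟨∑ i, s i + 1, fun i => Nat.lt_succ_of_le
      (Finset.single_le_sum (f := s) (fun _ _ => Nat.zero_le _) (Finset.mem_univ i))⟩
    filter_upwards [eventually_ge_atTop K0] with K hK
    -- Harmonicity turns the difference into a sum of `killed · (1 - survival)`, which is estimated
    -- term by term.
    rw [← H.sum_killed_mul_survival k K s, ← mul_sub, ← Finset.sum_sub_distrib, abs_mul,
      abs_of_nonneg hv, hb]
    refine mul_le_mul_of_nonneg_left ?_ hv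
    refine (Finset.abs_sum_le_sum_abs _ _).trans ?_
    have step : ∀ e : Cfg N (Fin K), |killed h (fun i => c i ^ k) (T k) s e.toNat -
        killed h (fun i => c i ^ k) (T k) s e.toNat * survival h e.toNat| ≤
        ∑ σ ∈ Finset.univ.erase (1 : Equiv.Perm (Fin N)),
          ∏ i, (doob (h i) (c i ^ k) (T k) (s i) (e.toNat i) *
            √(h (σ i) (e.toNat i) / h i (e.toNat i))) := by
      intro e
      have hk0 := hκ0 k _ e.toNat_strictMono
      rw [← mul_one_sub, abs_mul, abs_of_nonneg hk0]
      refine (mul_le_mul (hκ1 k _ e.toNat_strictMono) (abs_one_sub_survival_le H.h_pos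
        fun σ => hperm σ _ e.toNat_strictMono) (abs_nonneg _)
        (hk0.trans (hκ1 k _ e.toNat_strictMono))).trans_eq ?_
      rw [Finset.mul_sum]
      exact Finset.sum_congr rfl fun σ _ => Finset.prod_mul_distrib.symm
    refine (Finset.sum_le_sum fun e _ => step e).trans ?_
    rw [Finset.sum_comm]
    exact Finset.sum_le_sum fun σ _ => H.sum_prod_doob_mul_sqrt_le h3 s k K
      (fun i => (hK0 i).trans_le hK) σ
  have := squeeze_zero_norm (f := fun k => m k - v * survival h s) hbound hb0
  simpa using this.add_const (v * survival h s)

end BaseWalk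

end CondWalks

namespace CondWalks

/-! ### The contour integrals -/

section Toeplitz

variable {a : ℕ → ℝ}

/-- The real infimum of a set that is not bounded below is 0 by convention, so positivity already
contains boundedness. -/
theorem bddBelow_of_iInf_pos (ha : 0 < ⨅ k, a k) : BddBelow (Set.range a) := by
  by_contra h
  rw [Real.iInf_of_not_bddBelow h] at ha
  exact lt_irrefl _ ha

theorem iInf_le_apply (ha : 0 < ⨅ k, a k) (k : ℕ) : ⨅ k, a k ≤ a k :=
  ciInf_le (bddBelow_of_iInf_pos ha) k

theorem apply_pos (ha : 0 < ⨅ k, a k) (k : ℕ) : 0 < a k := ha.trans_le (iInf_le_apply ha k)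

/-- Radius of the contour. -/
noncomputable def contourRadius (a : ℕ → ℝ) : ℝ := (⨆ k, a k) - (⨅ k, a k) / 2

/-- Centre of the contour. -/
noncomputable def contourCenter (a : ℕ → ℝ) : ℂ := ((⨆ k, a k : ℝ) : ℂ)

theorem contourRadius_pos (ha : 0 < ⨅ k, a k) (hb : BddAbove (Set.range a)) :
    0 < contourRadius a := by
  have h1 := iInf_le_apply ha 0
  have h2 := le_ciSup hb 0
  rw [contourRadius]
  linarith

theorem apply_mem_ball (ha : 0 < ⨅ k, a k) (hb : BddAbove (Set.range a)) (k : ℕ) :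
    (a k : ℂ) ∈ Metric.ball (contourCenter a) (contourRadius a) := by
  have h1 := iInf_le_apply ha k
  have h2 := le_ciSup hb k
  rw [Metric.mem_ball, contourCenter, Complex.dist_of_im_eq (by simp), Real.dist_eq, abs_sub_comm,
    Complex.ofReal_re, Complex.ofReal_re, abs_of_nonneg (sub_nonneg.2 h2), contourRadius]
  linarith

theorem re_pos_of_mem_closedBall (ha : 0 < ⨅ k, a k) {w : ℂ}
    (hw : w ∈ Metric.closedBall (contourCenter a) (contourRadius a)) : 0 < w.re := by
  rw [Metric.mem_closedBall, dist_eq_norm] at hw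
  have h1 := (Complex.abs_re_le_norm (w - contourCenter a)).trans hw
  rw [Complex.sub_re, contourCenter, Complex.ofReal_re, contourRadius] at h1
  have := (abs_le.1 h1).1
  linarith

theorem one_sub_div_ne_zero (ha : 0 < ⨅ k, a k) (hb : BddAbove (Set.range a)) (k : ℕ) {w : ℂ}
    (hw : w ∉ Metric.ball (contourCenter a) (contourRadius a)) : 1 - w / (a k : ℂ) ≠ 0 := by
  intro h
  have hk : (a k : ℂ) ≠ 0 := Complex.ofReal_ne_zero.2 (apply_pos ha k).ne'
  have : w = a k := by
    rw [sub_eq_zero, eq_div_iff hk, one_mul] at h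
    exact h.symm
  exact hw (this ▸ apply_mem_ball ha hb k)

theorem sphere_notMem_ball {c w : ℂ} {R : ℝ} (hw : w ∈ Metric.sphere c R) :
    w ∉ Metric.ball c R := by
  rw [Metric.mem_ball, Metric.mem_sphere.1 hw]
  exact lt_irrefl _

theorem charPoly_ne_zero (ha : 0 < ⨅ k, a k) (hb : BddAbove (Set.range a)) (x : ℕ) {w : ℂ}
    (hw : w ∉ Metric.ball (contourCenter a) (contourRadius a)) : charPoly a x w ≠ 0 :=
  Finset.prod_ne_zero_iff.2 fun k _ => one_sub_div_ne_zero ha hb k hw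

theorem continuous_charPoly (x : ℕ) : Continuous (charPoly a x) := by
  unfold charPoly
  fun_prop

/-- The contour integral in the definition of `toeplitz`. -/
noncomputable def contourInt (a : ℕ → ℝ) (f : ℂ → ℂ) (x y : ℕ) : ℂ :=
  ∮ w in C(contourCenter a, contourRadius a), charPoly a x w / charPoly a (y + 1) w * f w

theorem toeplitz_eq (a : ℕ → ℝ) (f : ℂ → ℂ) (x y : ℕ) :
    toeplitz a f x y =
      -(1 / (2 * (Real.pi : ℂ) * Complex.I)) * (1 / (a y : ℂ)) * contourInt a f x y := rfl

theorem continuousOn_contour_integrand (ha : 0 < ⨅ k, a k) (hb : BddAbove (Set.range a))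
    {f : ℂ → ℂ} (hf : ContinuousOn f (Metric.sphere (contourCenter a) (contourRadius a)))
    (x y : ℕ) : ContinuousOn (fun w => charPoly a x w / charPoly a (y + 1) w * f w)
      (Metric.sphere (contourCenter a) (contourRadius a)) :=
  ((continuous_charPoly x).continuousOn.div (continuous_charPoly (y + 1)).continuousOn
    fun _ hw => charPoly_ne_zero ha hb _ (sphere_notMem_ball hw)).mul hf

/-- Since `w p_x(w) = a_x (p_x(w) - p_{x+1}(w))`, multiplying the symbol by `z` acts as a difference
operator in `x`. All recursions for the kernels come from this. -/
theorem contourInt_mul_id (ha : 0 < ⨅ k, a k) (hb : BddAbove (Set.range a)) {f : ℂ → ℂ}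
    (hf : ContinuousOn f (Metric.sphere (contourCenter a) (contourRadius a))) (x y : ℕ) :
    contourInt a (fun z => z * f z) x y =
      a x * (contourInt a f x y - contourInt a f (x + 1) y) := by
  have hr := (contourRadius_pos ha hb).le
  rw [contourInt, contourInt, contourInt, ← circleIntegral.integral_sub,
    ← circleIntegral.integral_const_mul]
  · refine circleIntegral.integral_congr hr fun w _ => ?_
    have hk : (a x : ℂ) ≠ 0 := Complex.ofReal_ne_zero.2 (apply_pos ha x).ne'
    have : charPoly a (x + 1) w = charPoly a x w * (1 - w / a x) := Finset.prod_range_succ _ _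
    simp only [this]
    field_simp
    ring
  · exact (continuousOn_contour_integrand ha hb hf x y).circleIntegrable hr
  · exact (continuousOn_contour_integrand ha hb hf (x + 1) y).circleIntegrable hr

/-- When `y < x` the polynomial `p_{y+1}` divides `p_x`, and no pole is left inside the contour. -/
theorem contourInt_eq_zero_of_lt (ha : 0 < ⨅ k, a k) (hb : BddAbove (Set.range a)) {f : ℂ → ℂ}
    (hf : ∀ z : ℂ, 0 < z.re → DifferentiableAt ℂ f z) {x y : ℕ} (h : y < x) :
    contourInt a f x y = 0 := by
  have hr := (contourRadius_pos ha hb).le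
  have e : contourInt a f x y = ∮ w in C(contourCenter a, contourRadius a),
      (∏ k ∈ Finset.Ico (y + 1) x, (1 - w / (a k : ℂ))) * f w := by
    refine circleIntegral.integral_congr hr fun w hw => ?_
    have h1 := charPoly_ne_zero ha hb (y + 1) (sphere_notMem_ball hw)
    have h2 : charPoly a x w = charPoly a (y + 1) w *
      ∏ k ∈ Finset.Ico (y + 1) x, (1 - w / (a k : ℂ)) :=
      (Finset.prod_range_mul_prod_Ico _ h).symm
    simp only [h2]
    field_simp
  rw [e]
  have hd : ∀ z ∈ Metric.closedBall (contourCenter a) (contourRadius a),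
      DifferentiableAt ℂ (fun w => (∏ k ∈ Finset.Ico (y + 1) x, (1 - w / (a k : ℂ))) * f w) z :=
    fun z hz => by
      have := hf z (re_pos_of_mem_closedBall ha hz)
      fun_prop
  exact Complex.circleIntegral_eq_zero_of_differentiable_on_off_countable hr Set.countable_empty
    (fun z hz => (hd z hz).continuousAt.continuousWithinAt)
    fun z hz => hd z (Metric.ball_subset_closedBall hz.1)

theorem contourInt_one_self (ha : 0 < ⨅ k, a k) (hb : BddAbove (Set.range a)) (x : ℕ) :
    contourInt a (fun _ => 1) x x = -(a x) * (2 * Real.pi * Complex.I) := by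
  rw [← circleIntegral.integral_sub_inv_of_mem_ball (apply_mem_ball ha hb x),
    ← circleIntegral.integral_const_mul]
  refine circleIntegral.integral_congr (contourRadius_pos ha hb).le fun w hw => ?_
  have h1 := charPoly_ne_zero ha hb x (sphere_notMem_ball hw)
  have h2 := one_sub_div_ne_zero ha hb x (sphere_notMem_ball hw)
  have h3 : charPoly a (x + 1) w = charPoly a x w * (1 - w / a x) := Finset.prod_range_succ _ _
  have hk : (a x : ℂ) ≠ 0 := Complex.ofReal_ne_zero.2 (apply_pos ha x).ne'
  have h4 : w - a x ≠ 0 := by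
    intro h
    apply h2
    rw [sub_eq_zero.1 h, div_self hk, sub_self]
  have h5 : (a x : ℂ) - w ≠ 0 := by rwa [← neg_sub, neg_ne_zero]
  simp only [h3]
  field_simp
  ring

/-- All poles lie inside the contour and the integrand is `O(|w|⁻²)`, so the circle can be blown up
to infinity. -/
theorem contourInt_one_eq_zero_of_lt (ha : 0 < ⨅ k, a k) (hb : BddAbove (Set.range a)) {x y : ℕ}
    (h : x < y) : contourInt a (fun _ => 1) x y = 0 := by
  have hr := contourRadius_pos ha hb
  set M := ⨆ k, a k with hM
  have hM0 : 0 < M := (apply_pos ha 0).trans_le (le_ciSup hb 0)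
  set g : ℂ → ℂ := fun w => ∏ k ∈ Finset.Ico x (y + 1), (1 - w / (a k : ℂ))⁻¹ with hg
  have e : contourInt a (fun _ => 1) x y = ∮ w in C(contourCenter a, contourRadius a), g w := by
    refine circleIntegral.integral_congr hr.le fun w hw => ?_
    have h1 := charPoly_ne_zero ha hb x (sphere_notMem_ball hw)
    have h2 : charPoly a (y + 1) w = charPoly a x w *
      ∏ k ∈ Finset.Ico x (y + 1), (1 - w / (a k : ℂ)) :=
      (Finset.prod_range_mul_prod_Ico _ (by omega)).symm
    have h3 : ∏ k ∈ Finset.Ico x (y + 1), (1 - w / (a k : ℂ)) ≠ 0 :=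
      Finset.prod_ne_zero_iff.2 fun k _ => one_sub_div_ne_zero ha hb k (sphere_notMem_ball hw)
    simp only [h2, hg, Finset.prod_inv_distrib]
    field_simp
  have hd : ∀ w ∉ Metric.ball (contourCenter a) (contourRadius a), DifferentiableAt ℂ g w := by
    intro w hw
    have : ∀ k ∈ Finset.Ico x (y + 1),
        DifferentiableAt ℂ (fun w : ℂ => (1 - w / (a k : ℂ))⁻¹) w := fun k _ =>
      DifferentiableAt.inv (by fun_prop) (one_sub_div_ne_zero ha hb k hw)
    exact DifferentiableAt.fun_finsetProd this
  -- On the circle of radius `R ≥ 4M` about `M`, `|1 - w/a_k| ≥ (R - M)/M - 1 ≥ R/(2M)`. There are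
  -- at least two such factors, and `2πR (2M/R)² = 8πM²/R`.
  have hbound : ∀ R : ℝ, 4 * M ≤ R → ‖contourInt a (fun _ => 1) x y‖ ≤ 8 * Real.pi * M ^ 2 / R := by
    intro R hR
    have hR0 : 0 < R := by linarith
    have hrR : contourRadius a ≤ R := by
      rw [contourRadius]
      linarith
    have e2 : ∮ w in C(contourCenter a, R), g w =
        ∮ w in C(contourCenter a, contourRadius a), g w :=
      Complex.circleIntegral_eq_of_differentiable_on_annulus_off_countable hr hrR
        Set.countable_empty (fun z hz => (hd z hz.2).continuousAt.continuousWithinAt)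
        fun z hz => hd z fun hz' => hz.1.2 (Metric.ball_subset_closedBall hz')
    rw [e, ← e2]
    refine (circleIntegral.norm_integral_le_of_norm_le_const hR0.le (C := (2 * M / R) ^ 2)
      fun w hw => ?_).trans_eq ?_
    · have hfac : ∀ k, ‖(1 - w / (a k : ℂ))⁻¹‖ ≤ 2 * M / R := by
        intro k
        have hk := apply_pos ha k
        have hkM : a k ≤ M := le_ciSup hb k
        have hw1 : R - M ≤ ‖w‖ := by
          have h1 := norm_sub_le w (contourCenter a)
          rw [← dist_eq_norm, Metric.mem_sphere.1 hw, contourCenter, Complex.norm_real,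
            Real.norm_of_nonneg hM0.le] at h1
          linarith
        have hw2 : R / (2 * M) ≤ ‖1 - w / (a k : ℂ)‖ := by
          have h1 := norm_sub_norm_le (w / (a k : ℂ)) 1
          rw [norm_sub_rev, norm_div, Complex.norm_real, Real.norm_of_nonneg hk.le, norm_one] at h1
          have h2 : (R - M) / M ≤ ‖w‖ / a k := by gcongr
          have h3 : R / (2 * M) + 1 ≤ (R - M) / M := by
            rw [← sub_nonneg]
            have : (R - M) / M - (R / (2 * M) + 1) = (R - 4 * M) / (2 * M) := by
              field_simp
              ring
            rw [this]
            exact div_nonneg (by linarith) (by linarith)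
          linarith
        rw [norm_inv, ← inv_div R]
        exact inv_anti₀ (by positivity) hw2
      rw [hg, norm_prod]
      have hle1 : 2 * M / R ≤ 1 := (div_le_one hR0).2 (by linarith)
      calc ∏ k ∈ Finset.Ico x (y + 1), ‖(1 - w / (a k : ℂ))⁻¹‖
          ≤ ∏ _k ∈ Finset.Ico x (y + 1), 2 * M / R :=
            Finset.prod_le_prod (fun k _ => norm_nonneg _) fun k _ => hfac k
        _ = (2 * M / R) ^ (y + 1 - x) := by rw [Finset.prod_const, Nat.card_Ico]
        _ ≤ (2 * M / R) ^ 2 := pow_le_pow_of_le_one (by positivity) hle1 (by omega)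
    · field_simp
      ring
  have h0 : Tendsto (fun R : ℝ => 8 * Real.pi * M ^ 2 / R) atTop (𝓝 0) :=
    tendsto_const_nhds.div_atTop tendsto_id
  exact norm_le_zero_iff.1 (ge_of_tendsto h0 ((eventually_ge_atTop (4 * M)).mono hbound))

theorem toeplitz_one (ha : 0 < ⨅ k, a k) (hb : BddAbove (Set.range a)) (x y : ℕ) :
    toeplitz a (fun _ => 1) x y = if x = y then 1 else 0 := by
  rw [toeplitz_eq]
  split_ifs with h
  · subst h
    have hk : (a x : ℂ) ≠ 0 := Complex.ofReal_ne_zero.2 (apply_pos ha x).ne'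
    have := Real.pi_ne_zero
    rw [contourInt_one_self ha hb]
    field_simp [Complex.I_ne_zero]
  · rcases lt_or_gt_of_ne h with h | h
    · rw [contourInt_one_eq_zero_of_lt ha hb h, mul_zero]
    · rw [contourInt_eq_zero_of_lt ha hb (fun _ _ => by fun_prop) h, mul_zero]

theorem toeplitz_eq_zero_of_lt (ha : 0 < ⨅ k, a k) (hb : BddAbove (Set.range a)) {f : ℂ → ℂ}
    (hf : ∀ z : ℂ, 0 < z.re → DifferentiableAt ℂ f z) {x y : ℕ} (h : y < x) :
    toeplitz a f x y = 0 := by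
  rw [toeplitz_eq, contourInt_eq_zero_of_lt ha hb hf h, mul_zero]

theorem continuousOn_sphere (ha : 0 < ⨅ k, a k) {f : ℂ → ℂ}
    (hf : ∀ z : ℂ, 0 < z.re → DifferentiableAt ℂ f z) :
    ContinuousOn f (Metric.sphere (contourCenter a) (contourRadius a)) := fun z hz =>
  (hf z (re_pos_of_mem_closedBall ha (Metric.sphere_subset_closedBall hz))).continuousAt
    |>.continuousWithinAt

theorem toeplitz_mul_id (ha : 0 < ⨅ k, a k) (hb : BddAbove (Set.range a)) {f : ℂ → ℂ}
    (hf : ContinuousOn f (Metric.sphere (contourCenter a) (contourRadius a))) (x y : ℕ) :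
    toeplitz a (fun z => z * f z) x y =
      a x * (toeplitz a f x y - toeplitz a f (x + 1) y) := by
  rw [toeplitz_eq, toeplitz_eq, toeplitz_eq, contourInt_mul_id ha hb hf]
  ring

theorem toeplitz_add (ha : 0 < ⨅ k, a k) (hb : BddAbove (Set.range a)) {f g : ℂ → ℂ}
    (hf : ContinuousOn f (Metric.sphere (contourCenter a) (contourRadius a)))
    (hg : ContinuousOn g (Metric.sphere (contourCenter a) (contourRadius a))) (x y : ℕ) :
    toeplitz a (fun z => f z + g z) x y = toeplitz a f x y + toeplitz a g x y := by
  have hr := (contourRadius_pos ha hb).le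
  rw [toeplitz_eq, toeplitz_eq, toeplitz_eq, ← mul_add, contourInt, contourInt, contourInt,
    ← circleIntegral.integral_add]
  · congr 1
    refine circleIntegral.integral_congr hr fun w _ => ?_
    simp only [mul_add]
  · exact (continuousOn_contour_integrand ha hb hf x y).circleIntegrable hr
  · exact (continuousOn_contour_integrand ha hb hg x y).circleIntegrable hr

theorem toeplitz_const_mul (ha : 0 < ⨅ k, a k) (hb : BddAbove (Set.range a)) (c : ℂ)
    (f : ℂ → ℂ) (x y : ℕ) :
    toeplitz a (fun z => c * f z) x y = c * toeplitz a f x y := by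
  have : contourInt a (fun z => c * f z) x y = c * contourInt a f x y := by
    rw [contourInt, contourInt, ← circleIntegral.integral_const_mul]
    refine circleIntegral.integral_congr (contourRadius_pos ha hb).le fun w _ => ?_
    ring
  rw [toeplitz_eq, toeplitz_eq, this]
  ring

theorem toeplitz_congr (ha : 0 < ⨅ k, a k) (hb : BddAbove (Set.range a)) {f g : ℂ → ℂ}
    (h : ∀ z ∈ Metric.sphere (contourCenter a) (contourRadius a), f z = g z) (x y : ℕ) :
    toeplitz a f x y = toeplitz a g x y := by
  rw [toeplitz_eq, toeplitz_eq]
  congr 1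
  exact circleIntegral.integral_congr (contourRadius_pos ha hb).le fun w hw => by
    simp only [h w hw]

end Toeplitz

end CondWalks

/-! ### The contour kernels are the base walks -/

namespace CondWalks

section ToeplitzWalks

variable {a : ℕ → ℝ}

/-- Dominated convergence on the circle; it serves to expand the symbol `exp (-t z)` in powers of
`z`. -/
theorem hasSum_toeplitz (ha : 0 < ⨅ k, a k) (hb : BddAbove (Set.range a)) {f : ℕ → ℂ → ℂ}
    {g : ℂ → ℂ} {u : ℕ → ℝ}
    (hf : ∀ n, ContinuousOn (f n) (Metric.sphere (contourCenter a) (contourRadius a)))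
    (hu : Summable u)
    (hbd : ∀ n, ∀ z ∈ Metric.sphere (contourCenter a) (contourRadius a), ‖f n z‖ ≤ u n)
    (hs : ∀ z ∈ Metric.sphere (contourCenter a) (contourRadius a), HasSum (fun n => f n z) (g z))
    (x y : ℕ) : HasSum (fun n => toeplitz a (f n) x y) (toeplitz a g x y) := by
  have hr := (contourRadius_pos ha hb).le
  have hone := continuousOn_contour_integrand ha hb (f := fun _ => 1) continuousOn_const x y
  obtain ⟨C, hC⟩ := (isCompact_sphere (contourCenter a)
    (contourRadius a)).exists_bound_of_continuousOn
    hone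
  have hmem : ∀ θ, circleMap (contourCenter a) (contourRadius a) θ ∈
      Metric.sphere (contourCenter a) (contourRadius a) := fun θ => circleMap_mem_sphere _ hr θ
  simp_rw [toeplitz_eq]
  refine HasSum.mul_left _ ?_
  simp only [contourInt, circleIntegral]
  refine intervalIntegral.hasSum_integral_of_dominated_convergence
    (fun n _ => contourRadius a * (C * u n)) (fun n => ?_) (fun n => ?_) ?_ ?_ ?_
  · refine (Continuous.aestronglyMeasurable ?_)
    refine Continuous.smul (f := fun θ => deriv (circleMap (contourCenter a) (contourRadius a)) θ)
      (by simp only [deriv_circleMap]; fun_prop) ?_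
    exact (continuousOn_contour_integrand ha hb (hf n) x y).comp_continuous
      (continuous_circleMap _ _) hmem
  · refine Eventually.of_forall fun θ _ => ?_
    rw [norm_smul, norm_mul, deriv_circleMap, norm_mul, Complex.norm_I, mul_one,
      norm_circleMap_zero,
      abs_of_nonneg hr]
    have h1 := hC _ (hmem θ)
    rw [mul_one] at h1
    have h2 := hbd n _ (hmem θ)
    gcongr
    exact (norm_nonneg _).trans h1
  · exact Eventually.of_forall fun θ _ => (hu.mul_left C).mul_left _
  · exact intervalIntegrable_const
  · refine Eventually.of_forall fun θ _ => ?_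
    exact ((hs _ (hmem θ)).mul_left _).const_smul _

/-! ### Bernoulli walks -/

theorem tsum_stepB (a : ℕ → ℝ) (γ : ℝ) (g : ℕ → ℝ) (x : ℕ) :
    ∑' z, stepB a γ x z * g z = (γ - γ * a x) * g x + (γ * a x + 1 - γ) * g (x + 1) := by
  rw [tsum_eq_sum (s := {x, x + 1})]
  · rw [Finset.sum_pair (by omega)]
    simp [stepB]
  · intro z hz
    simp only [Finset.mem_insert, Finset.mem_singleton, not_or] at hz
    simp [stepB, hz.1, hz.2]

/-- Multiplying the symbol by `1 - z` replaces a function `g` of `x` by `(1 - a_x) g(x) + a_x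
g(x+1)`, the first-step decomposition of the walk with `γ = 1`. -/
theorem toeplitz_bernoulli (ha : 0 < ⨅ k, a k) (hb : BddAbove (Set.range a)) (t x y : ℕ) :
    toeplitz a (fun z => (1 - z) ^ t) x y = (walkB a 1 t x y : ℂ) := by
  induction t generalizing x with
  | zero =>
    simp only [pow_zero, toeplitz_one ha hb, walkB, stepPow]
    split_ifs <;> simp
  | succ t ih =>
    have hc : ContinuousOn (fun z : ℂ => (1 - z) ^ t)
      (Metric.sphere (contourCenter a) (contourRadius a)) := by fun_prop
    have e : (fun z : ℂ => (1 - z) ^ (t + 1)) =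
        fun z => (1 - z) ^ t + (-1) * (z * (1 - z) ^ t) := by
      ext z
      ring
    rw [e, toeplitz_add ha hb hc (by fun_prop), toeplitz_const_mul ha hb,
      toeplitz_mul_id ha hb hc, ih, ih]
    simp only [walkB, stepPow, tsum_stepB]
    push_cast
    ring

/-! ### Geometric walks -/

theorem stepG_succ_left (a : ℕ → ℝ) (γ : ℝ) {x z : ℕ} (h : x < z) :
    stepG a γ x z = (γ * (1 + a x) - 1) / (γ * (1 + a x)) * stepG a γ (x + 1) z := by
  rw [stepG, stepG, if_pos h.le, if_pos (by omega), Finset.prod_eq_prod_Ico_succ_bot h]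
  ring

/-- A geometric step either stops at `x` or passes to `x + 1` and begins anew from there. -/
theorem tsum_stepG (a : ℕ → ℝ) (γ : ℝ) {g : ℕ → ℝ} {y : ℕ} (hg : ∀ z, y < z → g z = 0) (x : ℕ) :
    ∑' z, stepG a γ x z * g z = 1 / (γ * (1 + a x)) * g x +
      (γ * (1 + a x) - 1) / (γ * (1 + a x)) * ∑' z, stepG a γ (x + 1) z * g z := by
  have hfin : ∀ x, Summable fun z => stepG a γ x z * g z := fun x =>
    summable_of_ne_finset_zero (s := Finset.range (y + 1)) fun z hz => by
      rw [hg z (by simpa using hz), mul_zero]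
  rw [← tsum_mul_left, (hfin x).tsum_eq_add_tsum_ite x,
    ((hfin (x + 1)).mul_left _).tsum_eq_add_tsum_ite x]
  have e1 : stepG a γ x x = 1 / (γ * (1 + a x)) := by simp [stepG]
  have e2 : stepG a γ (x + 1) x = 0 := by simp [stepG]
  rw [e1, e2, zero_mul, mul_zero, zero_add]
  congr 1
  refine tsum_congr fun z => ?_
  split_ifs with hz
  · rfl
  · rcases lt_or_gt_of_ne hz with h | h
    · have h1 : stepG a γ x z = 0 := if_neg (by omega)
      have h2 : stepG a γ (x + 1) z = 0 := if_neg (by omega)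
      rw [h1, h2]
      simp
    · rw [stepG_succ_left a γ h, mul_assoc]

theorem stepPow_eq_zero {K : ℕ → ℕ → ℝ} (hK : ∀ x y, y < x → K x y = 0) (t : ℕ) {x y : ℕ}
    (h : y < x) : stepPow K t x y = 0 := by
  induction t generalizing x with
  | zero => simp [stepPow, (ne_of_gt h)]
  | succ t ih =>
    rw [stepPow]
    refine (tsum_congr fun z => ?_).trans tsum_zero
    by_cases hz : z < x
    · rw [hK _ _ hz, zero_mul]
    · rw [ih (by omega), mul_zero]

theorem stepG_eq_zero (a : ℕ → ℝ) (γ : ℝ) (x y : ℕ) (h : y < x) : stepG a γ x y = 0 :=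
  if_neg (by omega)

theorem stepB_eq_zero (a : ℕ → ℝ) (γ : ℝ) (x y : ℕ) (h : y < x) : stepB a γ x y = 0 := by
  rw [stepB, if_neg (by omega), if_neg (by omega)]

theorem differentiableAt_geometric (t : ℕ) (z : ℂ) (hz : 0 < z.re) :
    DifferentiableAt ℂ (fun z : ℂ => ((1 + z) ^ t)⁻¹) z := by
  refine DifferentiableAt.inv (by fun_prop) (pow_ne_zero _ fun h => ?_)
  have := congrArg Complex.re h
  simp at this
  linarith

/-- Multiplying the symbol by `1 + z` expresses the kernel at time `t` through the one at time `t +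
1`. Since kernels vanish for `x > y`, this relation is solved downwards from `x = y + 1`;
`tsum_stepG` gives the same recursion for the walk. -/
theorem toeplitz_geometric (ha : 0 < ⨅ k, a k) (hb : BddAbove (Set.range a)) (t x y : ℕ) :
    toeplitz a (fun z => ((1 + z) ^ t)⁻¹) x y = (walkG a 1 t x y : ℂ) := by
  induction t generalizing x with
  | zero =>
    simp only [pow_zero, inv_one, toeplitz_one ha hb, walkG, stepPow]
    split_ifs <;> simp
  | succ t ih =>
    have hd := differentiableAt_geometric (t + 1)
    have hc := continuousOn_sphere ha hd
    have hrec : ∀ x, toeplitz a (fun z => ((1 + z) ^ t)⁻¹) x y =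
        (1 + a x) * toeplitz a (fun z => ((1 + z) ^ (t + 1))⁻¹) x y -
          a x * toeplitz a (fun z => ((1 + z) ^ (t + 1))⁻¹) (x + 1) y := by
      intro x
      have h1 : toeplitz a (fun z => ((1 + z) ^ t)⁻¹) x y =
          toeplitz a (fun z => ((1 + z) ^ (t + 1))⁻¹ + z * ((1 + z) ^ (t + 1))⁻¹) x y := by
        refine toeplitz_congr ha hb (fun z hz => ?_) x y
        have hne : 1 + z ≠ 0 := by
          intro h
          have h2 := congrArg Complex.re h
          have h3 := re_pos_of_mem_closedBall ha (Metric.sphere_subset_closedBall hz)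
          simp at h2
          linarith
        rw [pow_succ]
        field_simp
      rw [h1, toeplitz_add ha hb hc (by fun_prop), toeplitz_mul_id ha hb hc]
      ring
    have hpos : ∀ x, (1 + a x : ℂ) ≠ 0 := fun x => by
      have := apply_pos ha x
      exact_mod_cast (by positivity : (1 + a x : ℝ) ≠ 0)
    have hz := @stepPow_eq_zero _ (stepG_eq_zero a 1)
    by_cases hxy : y < x
    · rw [toeplitz_eq_zero_of_lt ha hb hd hxy, walkG, hz _ hxy, Complex.ofReal_zero]
    -- The inner induction is on the distance from `x` to `y + 1`, where both kernels are zero.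
    · obtain ⟨n, hn⟩ : ∃ n, y + 1 = x + n := ⟨y + 1 - x, by omega⟩
      clear hxy
      induction n generalizing x with
      | zero =>
        rw [toeplitz_eq_zero_of_lt ha hb hd (by omega), walkG, hz _ (by omega),
          Complex.ofReal_zero]
      | succ n ihn =>
        have h1 := hrec x
        rw [ih, ihn (x + 1) (by omega)] at h1
        have h2 : walkG a 1 (t + 1) x y = 1 / (1 + a x) * walkG a 1 t x y +
            a x / (1 + a x) * walkG a 1 (t + 1) (x + 1) y := by
          have := tsum_stepG a 1 (g := fun z => stepPow (stepG a 1) t z y) (y := y)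
            (fun z hlt => hz t hlt) x
          simpa [walkG, stepPow] using this
        have h3 := hpos x
        rw [h2]
        push_cast
        field_simp
        rw [h1]
        ring_nf

/-! ### Pure-birth chains -/

theorem toeplitz_neg_pow (ha : 0 < ⨅ k, a k) (hb : BddAbove (Set.range a)) (n x y : ℕ) :
    toeplitz a (fun z => (-z) ^ n) x y =
      ((birthGenerator a)^[n] (Pi.single y 1) x : ℂ) := by
  induction n generalizing x with
  | zero =>
    simp only [pow_zero, toeplitz_one ha hb, Function.iterate_zero, id, Pi.single_apply]
    split_ifs <;> simp
  | succ n ih =>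
    have hc : ContinuousOn (fun z : ℂ => (-z) ^ n)
      (Metric.sphere (contourCenter a) (contourRadius a)) := by fun_prop
    have e : (fun z : ℂ => (-z) ^ (n + 1)) = fun z => (-1) * (z * (-z) ^ n) := by
      ext z
      ring
    rw [e, toeplitz_const_mul ha hb, toeplitz_mul_id ha hb hc, ih, ih,
      Function.iterate_succ_apply', birthGenerator]
    push_cast
    ring

theorem toeplitz_birth (ha : 0 < ⨅ k, a k) (hb : BddAbove (Set.range a)) (t : ℝ≥0) (x y : ℕ) :
    toeplitz a (fun z => Complex.exp (-((t : ℝ) * z))) x y = (walkPB a 0 t x y : ℂ) := by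
  obtain ⟨R, hR⟩ := (isCompact_sphere (contourCenter a)
    (contourRadius a)).exists_bound_of_continuousOn
    (f := fun z => z) continuousOn_id
  have h := hasSum_toeplitz ha hb
    (f := fun n z => ((t : ℝ) : ℂ) ^ n / (n.factorial : ℂ) * (-z) ^ n)
    (g := fun z => Complex.exp (-((t : ℝ) * z))) (u := fun n => (t * R) ^ n / n.factorial)
    (fun n => by fun_prop) (Real.summable_pow_div_factorial _) (fun n z hz => ?_)
    (fun z _ => ?_) x y
  · simp_rw [toeplitz_const_mul ha hb, toeplitz_neg_pow ha hb] at h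
    rw [walkPB, birthTransition, Complex.ofReal_tsum, ← h.tsum_eq]
    simp
  · have := hR z hz
    rw [norm_mul, norm_div, norm_pow, norm_pow, norm_neg, Complex.norm_real,
      Real.norm_of_nonneg t.coe_nonneg, Complex.norm_natCast, mul_pow, div_mul_eq_mul_div]
    gcongr
  · have := NormedSpace.expSeries_div_hasSum_exp (𝔸 := ℂ) (-((t : ℝ) * z))
    rw [← Complex.exp_eq_exp_ℂ] at this
    refine this.congr_fun fun n => ?_
    rw [← mul_neg, mul_pow]
    ring

end ToeplitzWalks

end CondWalks

namespace CondWalks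

/-! ### Powers of one-step kernels -/

section StepPow

variable {K : ℕ → ℕ → ℝ}

theorem tsum_mul_eq_sum {f g : ℕ → ℝ} {y Y : ℕ} (hy : y < Y) (hg : ∀ z, y < z → g z = 0) :
    ∑' z, f z * g z = ∑ z : Fin Y, f z * g z := by
  rw [tsum_eq_sum (s := Finset.range Y), Finset.sum_range]
  intro z hz
  rw [hg z (by simp at hz; omega), mul_zero]

/-- A path that never goes down and ends below `Y` stays below `Y`, so truncation is compatible with
products of kernels. -/
theorem trunc_stepPow (hK : ∀ x y, y < x → K x y = 0) (Y t : ℕ) :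
    trunc Y (stepPow K t) = trunc Y K ^ t := by
  induction t with
  | zero =>
    ext x y
    simp [trunc, stepPow, Matrix.one_apply, Fin.ext_iff]
  | succ t ih =>
    ext x y
    rw [pow_succ', ← ih, Matrix.mul_apply]
    exact tsum_mul_eq_sum y.2 fun z hz => stepPow_eq_zero hK t hz

theorem eq_of_trunc_eq {A B : ℕ → ℕ → ℝ} (h : ∀ Y, trunc Y A = trunc Y B) : A = B := by
  ext x y
  exact congrFun (congrFun (h (x + y + 1)) ⟨x, by omega⟩) ⟨y, by omega⟩

theorem stepPow_one (hK : ∀ x y, y < x → K x y = 0) : stepPow K 1 = K :=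
  eq_of_trunc_eq fun Y => by rw [trunc_stepPow hK, pow_one]

theorem trunc_stepPow_one (hK : ∀ x y, y < x → K x y = 0) (Y k : ℕ) :
    trunc Y (stepPow K k) = trunc Y (stepPow K 1) ^ k := by
  rw [stepPow_one hK, trunc_stepPow hK]

theorem stepPow_doob (hK : ∀ x y, y < x → K x y = 0) {h : ℕ → ℝ} (hh : ∀ x, h x ≠ 0) (c : ℝ)
    (t : ℕ) : stepPow (doob h c K) t = doob h (c ^ t) (stepPow K t) := by
  refine eq_of_trunc_eq fun Y => ?_
  rw [trunc_doob_pow (trunc_stepPow_one hK) hh, stepPow_one hK, trunc_stepPow]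
  intro x y hxy
  rw [doob, hK x y hxy, mul_zero]

theorem stepPow_nonneg (h0 : ∀ x y, 0 ≤ K x y) (t x y : ℕ) : 0 ≤ stepPow K t x y := by
  induction t generalizing x with
  | zero => rw [stepPow]; split_ifs <;> norm_num
  | succ t ih => exact tsum_nonneg fun z => mul_nonneg (h0 _ _) (ih _)

theorem hasSum_stepPow (h0 : ∀ x y, 0 ≤ K x y) (hs : ∀ x, HasSum (K x) 1) (t x : ℕ) :
    HasSum (stepPow K t x) 1 := by
  induction t generalizing x with
  | zero =>
    have : stepPow K 0 x = fun y => if y = x then (1 : ℝ) else 0 := by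
      ext y
      simp [stepPow, eq_comm]
    rw [this]
    exact hasSum_ite_eq x 1
  | succ t ih =>
    have hr : ∀ z, HasSum (fun y => K x z * stepPow K t z y) (K x z) := fun z => by
      simpa using (ih z).mul_left (K x z)
    have hsum : Summable fun p : ℕ × ℕ => K x p.1 * stepPow K t p.1 p.2 := by
      rw [summable_prod_of_nonneg fun p => mul_nonneg (h0 _ _) (stepPow_nonneg h0 _ _ _)]
      refine ⟨fun z => (hr z).summable, ?_⟩
      simp_rw [fun z => (hr z).tsum_eq]
      exact (hs x).summable
    have h1 : HasSum (fun p : ℕ × ℕ => K x p.1 * stepPow K t p.1 p.2) 1 := by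
      have e := (hsum.hasSum.prod_fiberwise hr).unique (hs x)
      exact e ▸ hsum.hasSum
    have h2 : HasSum (fun p : ℕ × ℕ => K x p.2 * stepPow K t p.2 p.1) 1 :=
      (Equiv.prodComm ℕ ℕ).hasSum_iff.2 h1
    exact h2.prod_fiberwise fun y => (h2.summable.prod_factor y).hasSum

end StepPow

/-! ### One-step determinants -/

/-- For the least point `i` that is moved, both its image and its preimage are larger than `i`. -/
theorem exists_crossing {N : ℕ} {σ : Equiv.Perm (Fin N)} (h : σ ≠ 1) :
    ∃ i k, i < k ∧ σ k = i ∧ i < σ i := by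
  have hne : (Finset.univ.filter fun i => σ i ≠ i).Nonempty := by
    by_contra hc
    rw [Finset.not_nonempty_iff_eq_empty, Finset.filter_eq_empty_iff] at hc
    exact h (Equiv.ext fun i => not_not.1 (hc (Finset.mem_univ i)))
  set i := (Finset.univ.filter fun i => σ i ≠ i).min' hne with hi
  have h1 : σ i ≠ i := (Finset.mem_filter.1 (Finset.min'_mem _ hne)).2
  have h2 : ∀ j < i, σ j = j := by
    intro j hj
    by_contra hc
    exact absurd (Finset.min'_le _ j (Finset.mem_filter.2 ⟨Finset.mem_univ _, hc⟩)) (not_le.2 hj)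
  refine ⟨i, σ.symm i, ?_, σ.apply_symm_apply i, ?_⟩
  · by_contra hc
    rcases (not_lt.1 hc).lt_or_eq with h3 | h3
    · have h4 := h2 _ h3
      rw [σ.apply_symm_apply] at h4
      exact absurd h4.symm h3.ne
    · exact h1 (by rw [← h3, σ.apply_symm_apply, h3])
  · by_contra hc
    rcases (not_lt.1 hc).lt_or_eq with h3 | h3
    · exact h1 (σ.injective (h2 _ h3))
    · exact h1 h3

theorem det_eq_prod_of_forall_perm {N : ℕ} {M : Matrix (Fin N) (Fin N) ℝ}
    (h : ∀ σ : Equiv.Perm (Fin N), σ ≠ 1 → ∃ i, M i (σ i) = 0) : M.det = ∏ i, M i i := by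
  rw [← Matrix.det_transpose, Matrix.det_apply', Finset.sum_eq_single 1]
  · simp
  · intro σ _ hσ
    obtain ⟨i, hi⟩ := h σ hσ
    rw [Finset.prod_eq_zero (Finset.mem_univ i) (by simpa using hi), mul_zero]
  · simp

/-- Pigeonhole: if `y i < z i`, then `σ` would inject `{k ≥ i}` into `{k > i}`. -/
theorem le_of_perm_le {N : ℕ} {z y : Fin N → ℕ} (hz : StrictMono z) (hy : StrictMono y)
    {σ : Equiv.Perm (Fin N)} (h : ∀ i, z i ≤ y (σ i)) (i : Fin N) : z i ≤ y i := by
  by_contra hc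
  have hmap : ∀ k ∈ Finset.Ici i, σ k ∈ Finset.Ioi i := by
    intro k hk
    rw [Finset.mem_Ioi]
    by_contra hle
    exact hc (((hz.monotone (Finset.mem_Ici.1 hk)).trans (h k)).trans
      (hy.monotone (not_lt.1 hle)))
  have h1 := Finset.card_le_card_of_injOn σ hmap σ.injective.injOn
  have h2 : Finset.Ioi i ⊂ Finset.Ici i := by
    refine Finset.ssubset_iff_subset_ne.2 ⟨Finset.Ioi_subset_Ici_self, fun he => ?_⟩
    have : i ∈ Finset.Ioi i := he ▸ Finset.mem_Ici.2 le_rfl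
    simp at this
  exact absurd h1 (not_le.2 (Finset.card_lt_card h2))

/-- Steps have size at most 1, so a crossing `i < k = σ⁻¹ i` would give `z_k ≤ y_i < y_{σ i} ≤ z_i +
1 ≤ z_k`. -/
theorem det_stepB (a : ℕ → ℝ) {N : ℕ} {z y : Fin N → ℕ} (hz : StrictMono z) (hy : StrictMono y) :
    (Matrix.of fun i j => stepB a 1 (z i) (y j)).det = ∏ i, stepB a 1 (z i) (y i) := by
  refine det_eq_prod_of_forall_perm fun σ hσ => ?_
  by_contra! hc
  have h1 : ∀ i, z i ≤ y (σ i) ∧ y (σ i) ≤ z i + 1 := by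
    intro i
    have := hc i
    simp only [Matrix.of_apply, stepB] at this
    split_ifs at this with h1 h2
    · omega
    · omega
    · exact absurd rfl this
  obtain ⟨i, k, hik, hk, hi⟩ := exists_crossing hσ
  have h2 := (h1 k).1
  rw [hk] at h2
  have h3 := (h1 i).2
  have h4 := hy hi
  have h5 := hz hik
  omega

theorem Interlace.strictMono {N : ℕ} {z y : Fin N → ℕ} (h : Interlace z y) : StrictMono y := by
  cases N with
  | zero => exact fun i => i.elim0
  | succ N =>
    refine Fin.strictMono_iff_lt_succ.2 fun i => ?_
    exact (h.2 i.castSucc i.succ (by simp)).trans_le (h.1 _)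

theorem lt_of_interlace {N : ℕ} {z y : Fin N → ℕ} (h : Interlace z y) (hz : StrictMono z)
    {i j : Fin N} (hij : i < j) : y i < z j := by
  have h1 : (i : ℕ) + 1 < N := lt_of_le_of_lt hij j.2
  exact (h.2 i ⟨i + 1, h1⟩ rfl).trans_le (hz.monotone (Fin.mk_le_of_le_val hij))

/-- On interlaced pairs every non-trivial permutation uses a downward step. If instead `z_{i+1} ≤
y_i` for some `i`, while `z ≤ y`, two neighbouring rows are proportional by the product form of the
kernel. If some `y_i < z_i`, all terms of the determinant vanish. -/
theorem det_stepG (a : ℕ → ℝ) {N : ℕ} {z y : Fin N → ℕ} (hz : StrictMono z) (hy : StrictMono y)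
    [Decidable (Interlace z y)] :
    (Matrix.of fun i j => stepG a 1 (z i) (y j)).det =
      if Interlace z y then ∏ i, stepG a 1 (z i) (y i) else 0 := by
  split_ifs with hI
  · refine det_eq_prod_of_forall_perm fun σ hσ => ?_
    obtain ⟨i, k, hik, hk, hi⟩ := exists_crossing hσ
    exact ⟨k, stepG_eq_zero _ _ _ _ (by rw [hk]; exact lt_of_interlace hI hz hik)⟩
  · by_cases hle : ∀ i, z i ≤ y i
    -- The first violation is taken so that the columns before `i` vanish in both rows; in the later
    -- columns the walk from `z i` has to pass through `z j`.
    · have hex : ∃ n : ℕ, ∃ i j : Fin N, (i : ℕ) = n ∧ (i : ℕ) + 1 = j ∧ z j ≤ y i := by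
        by_contra! hc
        exact hI ⟨hle, fun i j hij => hc i i j rfl hij⟩
      classical
      obtain ⟨i, j, hi, hij, hzy⟩ := Nat.find_spec hex
      have hlt : i < j := by rw [Fin.lt_def]; omega
      have hrow : ∀ k, stepG a 1 (z i) (y k) =
          (∏ l ∈ Finset.Ico (z i) (z j), (1 * (1 + a l) - 1) / (1 * (1 + a l))) *
            stepG a 1 (z j) (y k) := by
        intro k
        by_cases hk : k < i
        · have h1 : y k < z i := by
            have hk1 : (k : ℕ) + 1 ≤ i := hk
            have hmin := Nat.find_min hex (m := k) (by rw [← hi]; exact hk)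
            push Not at hmin
            exact (hmin k ⟨k + 1, lt_of_le_of_lt hk1 i.2⟩ rfl rfl).trans_le
              (hz.monotone (Fin.mk_le_of_le_val hk1))
          rw [stepG_eq_zero _ _ _ _ h1, stepG_eq_zero _ _ _ _ (h1.trans (hz hlt)), mul_zero]
        · have h1 : z j ≤ y k := hzy.trans (hy.monotone (not_lt.1 hk))
          rw [stepG, stepG, if_pos h1, if_pos ((hz hlt).le.trans h1),
            ← Finset.prod_Ico_consecutive _ (hz hlt).le h1]
          ring
      set r := ∏ l ∈ Finset.Ico (z i) (z j), (1 * (1 + a l) - 1) / (1 * (1 + a l)) with hr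
      rw [← Matrix.det_updateRow_add_smul_self _ hlt.ne (-r)]
      refine Matrix.det_eq_zero_of_row_eq_zero i fun k => ?_
      simp [hrow k]
    · push Not at hle
      obtain ⟨i, hi⟩ := hle
      rw [← Matrix.det_transpose, Matrix.det_apply']
      refine Finset.sum_eq_zero fun σ _ => ?_
      obtain ⟨k, hk⟩ : ∃ k, y (σ k) < z k := by
        by_contra! hc
        exact absurd (le_of_perm_le hz hy hc i) (not_le.2 hi)
      rw [Finset.prod_eq_zero (Finset.mem_univ k), mul_zero]
      exact stepG_eq_zero _ _ _ _ hk

/-! ### Powers of the killed kernels -/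

/-- The restriction of a kernel on configurations to `Cfg N (Fin K)`. -/
def cfgMatrix {N : ℕ} (K : ℕ) (S : (Fin N → ℕ) → (Fin N → ℕ) → ℝ) :
    Matrix (Cfg N (Fin K)) (Cfg N (Fin K)) ℝ := Matrix.of fun e e' => S e.toNat e'.toNat

/-- In this form, a Doob transform of a compound matrix by `∏ h_i`, powers can be taken: both
operations respect them. -/
theorem cfgMatrix_killed {N : ℕ} {h : Fin N → ℕ → ℝ} (c : Fin N → ℝ) (A : ℕ → ℕ → ℝ) (K : ℕ) :
    cfgMatrix K (killed h c A) = Matrix.of fun e e' : Cfg N (Fin K) =>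
      (∏ i, h i (e'.toNat i)) / ((∏ i, h i (e.toNat i)) * ∏ i, c i) *
        compound N (trunc K A) e e' := by
  ext e e'
  simp only [cfgMatrix, Matrix.of_apply, killed, Finset.prod_div_distrib, Finset.prod_mul_distrib]
  rfl

theorem cfgMatrix_killed_pow {N : ℕ} {h : Fin N → ℕ → ℝ} (hh : ∀ i x, h i x ≠ 0) (c : Fin N → ℝ)
    {A B : ℕ → ℕ → ℝ} {K m : ℕ} (hAB : trunc K A ^ m = trunc K B) :
    cfgMatrix K (killed h c A) ^ m = cfgMatrix K (killed h (fun i => c i ^ m) B) := by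
  ext e e'
  rw [cfgMatrix_killed, doob_pow _ (fun e : Cfg N (Fin K) => ∏ i, h i (e.toNat i))
    (fun e => Finset.prod_ne_zero_iff.2 fun i _ => hh i _), ← compound_pow, hAB,
    cfgMatrix_killed, Matrix.of_apply, Finset.prod_pow]

/-- Killing only loses mass: enlarging the sums over ordered intermediate configurations to all
configurations makes them factorise. -/
theorem pow_le_prod {N K : ℕ} {S : Matrix (Cfg N (Fin K)) (Cfg N (Fin K)) ℝ}
    {P : Fin N → Matrix (Fin K) (Fin K) ℝ} (hS : ∀ e e', 0 ≤ S e e')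
    (hP : ∀ i x y, 0 ≤ P i x y) (hSP : ∀ e e', S e e' ≤ ∏ i, P i (e.1 i) (e'.1 i)) (m : ℕ)
    (e e' : Cfg N (Fin K)) : (S ^ m) e e' ≤ ∏ i, (P i ^ m) (e.1 i) (e'.1 i) := by
  have hPm : ∀ i m x y, 0 ≤ (P i ^ m) x y := fun i m x y => matrix_pow_nonneg (hP i) m x y
  induction m generalizing e' with
  | zero =>
    by_cases h : e = e'
    · subst h
      simp
    · simp only [pow_zero, Matrix.one_apply_ne h]
      exact Finset.prod_nonneg fun i _ => hPm i 0 _ _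
  | succ m ih =>
    rw [pow_succ, Matrix.mul_apply]
    calc ∑ w, (S ^ m) e w * S w e'
        ≤ ∑ w : Cfg N (Fin K), ∏ i, ((P i ^ m) (e.1 i) (w.1 i) * P i (w.1 i) (e'.1 i)) := by
          refine Finset.sum_le_sum fun w _ => ?_
          rw [Finset.prod_mul_distrib]
          exact mul_le_mul (ih w) (hSP w e') (hS _ _)
            (Finset.prod_nonneg fun i _ => hPm i m _ _)
      _ ≤ ∑ f : Fin N → Fin K, ∏ i, ((P i ^ m) (e.1 i) (f i) * P i (f i) (e'.1 i)) := by
          refine (Finset.sum_map Finset.univ (Function.Embedding.subtype _)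
            (fun f : Fin N → Fin K => ∏ i, ((P i ^ m) (e.1 i) (f i) * P i (f i) (e'.1 i)))).symm.trans_le ?_
          exact Finset.sum_le_sum_of_subset_of_nonneg (Finset.subset_univ _) fun f _ _ =>
            Finset.prod_nonneg fun i _ => mul_nonneg (hPm i m _ _) (hP i _ _)
      _ = ∏ i, (P i ^ (m + 1)) (e.1 i) (e'.1 i) := by
          simp_rw [pow_succ, Matrix.mul_apply]
          rw [Finset.prod_univ_sum, Fintype.piFinset_univ]

end CondWalks

namespace CondWalks

/-! ### The past of a process and the Markov property -/

section Past

variable {Ω T S : Type*}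

/-- Finite-dimensional cylinders depending on times `≤ t`. -/
def pastCylinders [Preorder T] (X : T → Ω → S) (t : T) : Set (Set Ω) :=
  {F | ∃ (I : Finset T) (s : T → S), (∀ r ∈ I, r ≤ t) ∧ F = {ω | ∀ r ∈ I, X r ω = s r}}

/-- The σ-algebra generated by `X` up to time `t`. -/
abbrev past [Preorder T] (X : T → Ω → S) (t : T) : MeasurableSpace Ω :=
  MeasurableSpace.generateFrom (pastCylinders X t)

theorem isPiSystem_pastCylinders [LinearOrder T] (X : T → Ω → S) (t : T) :
    IsPiSystem (pastCylinders X t) := by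
  classical
  rintro _ ⟨I, s, hI, rfl⟩ _ ⟨J, s', hJ, rfl⟩ ⟨ω₀, h1, h2⟩
  refine ⟨I ∪ J, fun r => X r ω₀, fun r hr => ?_, ?_⟩
  · rcases Finset.mem_union.1 hr with h | h
    exacts [hI r h, hJ r h]
  · ext ω
    simp only [Set.mem_inter_iff, Set.mem_ofPred_eq, Finset.mem_union] at h1 h2 ⊢
    constructor
    · rintro ⟨h3, h4⟩ r (hr | hr)
      · rw [h3 r hr, h1 r hr]
      · rw [h4 r hr, h2 r hr]
    · intro h3
      exact ⟨fun r hr => by rw [h3 r (Or.inl hr), h1 r hr],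
        fun r hr => by rw [h3 r (Or.inr hr), h2 r hr]⟩

theorem past_mono [Preorder T] (X : T → Ω → S) {t t' : T} (h : t ≤ t') : past X t ≤ past X t' := by
  refine MeasurableSpace.generateFrom_mono ?_
  rintro _ ⟨I, s, hI, rfl⟩
  exact ⟨I, s, fun r hr => (hI r hr).trans h, rfl⟩

theorem measurableSet_past_eq [Preorder T] (X : T → Ω → S) {r t : T} (h : r ≤ t) (s : S) :
    MeasurableSet[past X t] {ω | X r ω = s} :=
  MeasurableSpace.measurableSet_generateFrom
    ⟨{r}, fun _ => s, by simpa using h, by simp⟩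

theorem measurableSet_past_rel [Preorder T] [Countable S] (X : T → Ω → S) {r r' t : T} (h : r ≤ t)
    (h' : r' ≤ t) (C : S → S → Prop) : MeasurableSet[past X t] {ω | C (X r ω) (X r' ω)} := by
  have : {ω | C (X r ω) (X r' ω)} =
      ⋃ p : {p : S × S // C p.1 p.2}, {ω | X r ω = p.1.1} ∩ {ω | X r' ω = p.1.2} := by
    ext ω
    simp only [Set.mem_ofPred_eq, Set.mem_iUnion, Set.mem_inter_iff]
    constructor
    · exact fun hC => ⟨⟨(_, _), hC⟩, rfl, rfl⟩
    · rintro ⟨⟨p, hp⟩, h1, h2⟩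
      rwa [h1, h2]
  rw [this]
  exact MeasurableSet.iUnion fun p => (measurableSet_past_eq X h _).inter
    (measurableSet_past_eq X h' _)

theorem past_le [Preorder T] [m : MeasurableSpace Ω] {X : T → Ω → S}
    (hX : ∀ r s, MeasurableSet {ω | X r ω = s}) (t : T) : past X t ≤ m := by
  refine MeasurableSpace.generateFrom_le ?_
  rintro _ ⟨I, s, -, rfl⟩
  have : {ω | ∀ r ∈ I, X r ω = s r} = ⋂ r ∈ I, {ω | X r ω = s r} := by
    ext
    simp
  rw [this]
  exact Finset.measurableSet_biInter _ fun r _ => hX r _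

variable [MeasurableSpace Ω] {μ : Measure Ω} [LinearOrder T] [Sub T]

/-- The definition of `IsMarkov` speaks of monotone sequences of times, so the finite set of times,
with `t` added, is listed increasingly and continued by `t'`. -/
theorem IsMarkov.cylinder {X : T → Ω → S} {Q : T → S → S → ℝ}
    (M : IsMarkov μ Set.univ (fun t z y => (Q t z y : ℂ)) X) {t t' : T} (htt : t ≤ t') {F : Set Ω}
    (hF : F ∈ pastCylinders X t) (z y : S) :
    μ.real (F ∩ {ω | X t ω = z} ∩ {ω | X t' ω = y}) =
      μ.real (F ∩ {ω | X t ω = z}) * Q (t' - t) z y := by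
  classical
  obtain ⟨I, s, hI, rfl⟩ := hF
  by_cases hts : t ∈ I ∧ s t ≠ z
  · have : {ω | ∀ r ∈ I, X r ω = s r} ∩ {ω | X t ω = z} = ∅ := by
      ext ω
      simp only [Set.mem_inter_iff, Set.mem_ofPred_eq, Set.mem_empty_iff_false, iff_false, not_and]
      exact fun h1 h2 => hts.2 ((h1 t hts.1).symm.trans h2)
    rw [this]
    simp
  · set J := insert t I with hJ
    set s' := Function.update s t z with hs'
    have hJt : ∀ r ∈ J, r ≤ t := by
      intro r hr
      rcases Finset.mem_insert.1 hr with h | h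
      exacts [h.le, hI r h]
    have e1 : {ω | ∀ r ∈ I, X r ω = s r} ∩ {ω | X t ω = z} = {ω | ∀ r ∈ J, X r ω = s' r} := by
      ext ω
      simp only [Set.mem_inter_iff, Set.mem_ofPred_eq, hJ, Finset.forall_mem_insert, hs',
        Function.update_self]
      rw [and_comm]
      refine and_congr_right fun hz => forall₂_congr fun r hr => ?_
      by_cases hrt : r = t
      · subst hrt
        rw [Function.update_self]
        have : s r = z := by
          by_contra hc
          exact hts ⟨hr, hc⟩
        rw [this]
      · rw [Function.update_of_ne hrt]
    obtain ⟨n, hn⟩ : ∃ n, J.card = n + 1 :=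
      ⟨J.card - 1, by have := Finset.card_pos.2 ⟨t, hJ ▸ Finset.mem_insert_self t I⟩; omega⟩
    set e := J.orderEmbOfFin hn with he
    have hmem : ∀ i, e i ∈ J := fun i => Finset.orderEmbOfFin_mem _ _ _
    have hsurj : ∀ r ∈ J, ∃ i, e i = r := fun r hr => by
      have : r ∈ Set.range e := by
        rw [he, Finset.range_orderEmbOfFin]
        exact hr
      exact this
    set τ : ℕ → T := fun j => if h : j < n + 1 then e ⟨j, h⟩ else t' with hτ
    have hτn : τ n = t := by
      obtain ⟨i, hi⟩ := hsurj t (Finset.mem_insert_self t I)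
      refine le_antisymm ?_ ?_
      · simp only [hτ, dif_pos (Nat.lt_succ_self n)]
        exact hJt _ (hmem _)
      · simp only [hτ, dif_pos (Nat.lt_succ_self n)]
        rw [← hi]
        exact e.monotone (Fin.le_last i)
    have hτn1 : τ (n + 1) = t' := by simp [hτ]
    have hmono : Monotone τ := by
      intro i j hij
      simp only [hτ]
      split_ifs with h1 h2 h2
      · exact e.monotone (by simpa using hij)
      · exact (hJt _ (hmem _)).trans htt
      · omega
      · exact le_rfl
    set σ : ℕ → S := fun j => if j < n + 1 then s' (τ j) else y with hσ
    have e2 : {ω | ∀ r ∈ J, X r ω = s' r} = {ω | ∀ i ≤ n, X (τ i) ω = σ i} := by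
      ext ω
      simp only [Set.mem_ofPred_eq]
      constructor
      · intro h i hi
        simp only [hσ, if_pos (Nat.lt_succ_of_le hi)]
        refine h _ ?_
        simp only [hτ, dif_pos (Nat.lt_succ_of_le hi)]
        exact hmem _
      · intro h r hr
        obtain ⟨i, hi⟩ := hsurj r hr
        have := h i (Nat.lt_succ_iff.1 i.2)
        have hτi : τ i = r := (dif_pos i.2).trans hi
        simpa only [hσ, if_pos i.2, hτi] using this
    have e3 : {ω | ∀ i ≤ n + 1, X (τ i) ω = σ i} =
        {ω | ∀ i ≤ n, X (τ i) ω = σ i} ∩ {ω | X t' ω = y} := by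
      ext ω
      simp only [Set.mem_inter_iff, Set.mem_ofPred_eq]
      have hσn1 : σ (n + 1) = y := by simp [hσ]
      constructor
      · intro h
        have := h (n + 1) le_rfl
        rw [hτn1, hσn1] at this
        exact ⟨fun i hi => h i (by omega), this⟩
      · rintro ⟨h1, h2⟩ i hi
        rcases Nat.lt_or_ge n i with h3 | h3
        · obtain rfl : i = n + 1 := by omega
          rw [hτn1, hσn1, h2]
        · exact h1 i h3
    have hσn : σ n = z := by simp [hσ, hτn, hs']
    have hσn1 : σ (n + 1) = y := by simp [hσ]
    have := M.markov n τ hmono σ fun _ => Set.mem_univ _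
    rw [hτn, hτn1, hσn, hσn1, e3, ← e2, ← e1] at this
    exact_mod_cast this

/-- Both sides are finite measures in `F` that agree on cylinders, a π-system generating the past.
-/
theorem IsMarkov.past_inter [IsFiniteMeasure μ] {X : T → Ω → S} {Q : T → S → S → ℝ}
    (M : IsMarkov μ Set.univ (fun t z y => (Q t z y : ℂ)) X)
    (hX : ∀ r s, MeasurableSet {ω | X r ω = s}) (hQ : ∀ t z y, 0 ≤ Q t z y) {t t' : T}
    (htt : t ≤ t') {F : Set Ω} (hF : MeasurableSet[past X t] F) (z y : S) :
    μ.real (F ∩ {ω | X t ω = z} ∩ {ω | X t' ω = y}) =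
      μ.real (F ∩ {ω | X t ω = z}) * Q (t' - t) z y := by
  set ν₁ := μ.restrict ({ω | X t ω = z} ∩ {ω | X t' ω = y}) with hν₁
  set ν₂ := (Q (t' - t) z y).toNNReal • μ.restrict {ω | X t ω = z} with hν₂
  have hle := past_le hX t
  have h1 : ∀ G, MeasurableSet[past X t] G →
      ν₁ G = μ (G ∩ {ω | X t ω = z} ∩ {ω | X t' ω = y}) := fun G hG => by
    rw [hν₁, Measure.restrict_apply (hle _ hG), Set.inter_assoc]
  have h2 : ∀ G, MeasurableSet[past X t] G →
      ν₂ G = (Q (t' - t) z y).toNNReal * μ (G ∩ {ω | X t ω = z}) := fun G hG => by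
    rw [hν₂, Measure.smul_apply, Measure.restrict_apply (hle _ hG)]
    rfl
  have heq : ∀ G, MeasurableSet[past X t] G → (ν₁ G = ν₂ G ↔
      μ.real (G ∩ {ω | X t ω = z} ∩ {ω | X t' ω = y}) =
      μ.real (G ∩ {ω | X t ω = z}) * Q (t' - t) z y) := fun G hG => by
    rw [h1 G hG, h2 G hG, ← ENNReal.toReal_eq_toReal_iff' (measure_ne_top _ _)
      (ENNReal.mul_ne_top ENNReal.coe_ne_top (measure_ne_top _ _)), ENNReal.toReal_mul,
      ENNReal.coe_toReal, Real.coe_toNNReal _ (hQ _ _ _), mul_comm (Q _ _ _)]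
    rfl
  have hgen : ∀ G ∈ pastCylinders X t, ν₁ G = ν₂ G := fun G hG =>
    (heq G (MeasurableSpace.measurableSet_generateFrom hG)).2 (M.cylinder htt hG z y)
  have huniv : (Set.univ : Set Ω) ∈ pastCylinders X t := by
    by_cases hne : Nonempty Ω
    · exact ⟨∅, fun r => X r hne.some, by simp, by simp⟩
    · exact ⟨∅, fun r => z, by simp, by simp⟩
  exact (heq F hF).1 (ext_on_measurableSpace_of_generate_finite _ _ hgen hle rfl
    (isPiSystem_pastCylinders X t) (hgen _ huniv) hF)

end Past

section Walks

variable {Ω T : Type*} [MeasurableSpace Ω] {μ : Measure Ω} {N : ℕ}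

theorem IndepWalks.measurableSet_eq [Preorder T] [Sub T] [Zero T] {K : Fin N → T → ℕ → ℕ → ℝ}
    {x : Fin N → ℕ} {X : T → Ω → Fin N → ℕ} (W : IndepWalks μ K x X) (r : T) (s : Fin N → ℕ) :
    MeasurableSet {ω | X r ω = s} := by
  have : {ω | X r ω = s} = ⋂ i, {ω | X r ω i = s i} := by
    ext
    simp [funext_iff]
  rw [this]
  exact MeasurableSet.iInter fun i => W.measurable r i (measurableSet_singleton _)

/-- The joint process of independent Markov processes is Markov with the product kernel. -/
theorem IndepWalks.isMarkov [Preorder T] [Sub T] [Zero T] {K : Fin N → T → ℕ → ℕ → ℝ}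
    {x : Fin N → ℕ} {X : T → Ω → Fin N → ℕ} (W : IndepWalks μ K x X) :
    IsMarkov μ Set.univ (fun t z y => ((∏ i, K i t (z i) (y i) : ℝ) : ℂ)) X := by
  refine ⟨fun t => Eventually.of_forall fun _ => Set.mem_univ _, fun n t ht s _ => ?_⟩
  have key : ∀ n, μ.real {ω | ∀ j ≤ n, X (t j) ω = s j} =
      ∏ i, μ.real {ω | ∀ j ≤ n, X (t j) ω i = s j i} := by
    intro n
    have h := W.indep.measure_inter_preimage_eq_mul Finset.univ
      (sets := fun i => {p : T → ℕ | ∀ j ≤ n, p (t j) = s j i}) fun i _ => by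
        have : {p : T → ℕ | ∀ j ≤ n, p (t j) = s j i} = ⋂ j, ⋂ (_ : j ≤ n),
            {p | p (t j) = s j i} := by
          ext
          simp
        rw [this]
        exact MeasurableSet.iInter fun j => MeasurableSet.iInter fun _ =>
          measurable_pi_apply (t j) (measurableSet_singleton _)
    have e : {ω | ∀ j ≤ n, X (t j) ω = s j} = ⋂ i ∈ Finset.univ,
        (fun (ω : Ω) (t : T) => X t ω i) ⁻¹' {p : T → ℕ | ∀ j ≤ n, p (t j) = s j i} := by
      ext ω
      simp only [Set.mem_ofPred_eq, Set.mem_iInter, Set.mem_preimage, Finset.mem_univ, true_imp_iff,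
        funext_iff]
      exact ⟨fun h i j hj => h j hj i, fun h j hj i => h i j hj⟩
    rw [measureReal_def, e, h, ENNReal.toReal_prod]
    rfl
  have hm : ∀ i, μ.real {ω | ∀ j ≤ n + 1, X (t j) ω i = s j i} =
      μ.real {ω | ∀ j ≤ n, X (t j) ω i = s j i} *
        K i (t (n + 1) - t n) (s n i) (s (n + 1) i) := fun i => by
    have := (W.markov i).markov n t ht (fun j => s j i) fun _ => Set.mem_univ _
    exact_mod_cast this
  rw [key, key, ← Complex.ofReal_mul, ← Finset.prod_mul_distrib]
  simp_rw [hm]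

end Walks

end CondWalks

/-! ### Conditioning a killed process on survival -/

namespace CondWalks

theorem Cfg.toNat_injective {N K : ℕ} : Function.Injective (Cfg.toNat (N := N) (K := K)) :=
  fun _ _ h => Subtype.ext (funext fun i => Fin.ext (congrFun h i))

theorem Cfg.exists_toNat_eq {N K : ℕ} {y : Fin N → ℕ} (hy : StrictMono y) (hK : ∀ i, y i < K) :
    ∃ e : Cfg N (Fin K), e.toNat = y :=
  ⟨⟨fun i => ⟨y i, hK i⟩, fun _ _ hij => hy hij⟩, rfl⟩

theorem Cfg.toNat_lt {N K : ℕ} (e : Cfg N (Fin K)) (i : Fin N) : e.toNat i < K := (e.1 i).2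

theorem exists_forall_lt {N : ℕ} (y : Fin N → ℕ) : ∃ K, ∀ i, y i < K :=
  ⟨∑ i, y i + 1, fun i => Nat.lt_succ_of_le
    (Finset.single_le_sum (f := y) (fun _ _ => Nat.zero_le _) (Finset.mem_univ i))⟩

section Conditioning

variable {Ω T : Type*} [MeasurableSpace Ω] {μ : Measure Ω} {N : ℕ}

/-- Decomposition of an event according to the value of a configuration. -/
theorem measureReal_eq_sum_cfg [IsFiniteMeasure μ] {Y : Ω → Fin N → ℕ}
    (hY : ∀ s, MeasurableSet {ω | Y ω = s}) {K : ℕ} {B : Set Ω} (hBm : MeasurableSet B)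
    (hB : ∀ᵐ ω ∂μ, ω ∈ B → StrictMono (Y ω) ∧ ∀ i, Y ω i < K) :
    μ.real B = ∑ e : Cfg N (Fin K), μ.real (B ∩ {ω | Y ω = e.toNat}) := by
  have h1 : B =ᵐ[μ] ⋃ e ∈ (Finset.univ : Finset (Cfg N (Fin K))), B ∩ {ω | Y ω = e.toNat} := by
    filter_upwards [hB] with ω hω
    refine propext ⟨fun h => ?_, fun h => ?_⟩
    · obtain ⟨e, he⟩ := Cfg.exists_toNat_eq (hω h).1 (hω h).2
      exact Set.mem_biUnion (Finset.mem_univ e) ⟨h, he.symm⟩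
    · obtain ⟨e, -, he⟩ := Set.mem_iUnion₂.1 h
      exact he.1
  rw [measureReal_congr h1, measureReal_biUnion_finset]
  · intro e _ e' _ hne
    exact Set.disjoint_left.2 fun ω h h' => hne (Cfg.toNat_injective (h.2.symm.trans h'.2))
  · exact fun e _ => hBm.inter (hY _)

variable [AddCommMonoid T] [LinearOrder T] [CanonicallyOrderedAdd T] {X : T → Ω → Fin N → ℕ}

open Classical in
/-- Probability of a chain of `m` steps of length `δ`, all of which are related by `C`. -/
theorem IsMarkov.measureReal_steps [IsProbabilityMeasure μ] [IsOrderedCancelAddMonoid T] [Sub T]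
    [OrderedSub T]
    {Q : T → (Fin N → ℕ) → (Fin N → ℕ) → ℝ}
    (M : IsMarkov μ Set.univ (fun t z y => (Q t z y : ℂ)) X)
    (hX : ∀ r s, MeasurableSet {ω | X r ω = s}) (hQ : ∀ t z y, 0 ≤ Q t z y)
    (hQz : ∀ t z y, (∃ i, y i < z i) → Q t z y = 0)
    {C : (Fin N → ℕ) → (Fin N → ℕ) → Prop} (hC : ∀ z y, C z y → StrictMono z) {K : ℕ} {t : T}
    {F : Set Ω} (hF : MeasurableSet[past X t] F) (z : Cfg N (Fin K)) (δ : T) (m : ℕ)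
    (y : Cfg N (Fin K)) :
    μ.real (F ∩ {ω | X t ω = z.toNat} ∩
      {ω | ∀ k < m, C (X (t + k • δ) ω) (X (t + (k + 1) • δ) ω)} ∩
      {ω | X (t + m • δ) ω = y.toNat}) =
      μ.real (F ∩ {ω | X t ω = z.toNat}) *
        (cfgMatrix K (fun w y => if C w y then Q δ w y else 0) ^ m) z y := by
  induction m generalizing y with
  | zero =>
    simp only [Nat.not_lt_zero, false_imp_iff, implies_true, zero_smul, add_zero, pow_zero]
    by_cases h : z = y
    · subst h
      rw [Matrix.one_apply_eq, mul_one]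
      congr 1
      ext ω
      simp only [Set.mem_inter_iff, Set.mem_ofPred_eq]
      tauto
    · rw [Matrix.one_apply_ne h, mul_zero]
      convert measureReal_empty (μ := μ)
      ext ω
      simp only [Set.mem_inter_iff, Set.mem_ofPred_eq, Set.mem_empty_iff_false, iff_false]
      rintro ⟨⟨⟨-, h1⟩, -⟩, h2⟩
      exact h (Cfg.toNat_injective (h1.symm.trans h2))
  | succ m ih =>
    set G := F ∩ {ω | X t ω = z.toNat} ∩
      {ω | ∀ k < m, C (X (t + k • δ) ω) (X (t + (k + 1) • δ) ω)} with hG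
    have hmono : ∀ k ≤ m, t + k • δ ≤ t + m • δ := fun k hk =>
      add_le_add_right (nsmul_le_nsmul_left zero_le hk) t
    have hGm : MeasurableSet[past X (t + m • δ)] G := by
      have h0 : t ≤ t + m • δ := le_self_add
      refine ((past_mono X h0 _ hF).inter (measurableSet_past_eq X h0 _)).inter ?_
      have : {ω | ∀ k < m, C (X (t + k • δ) ω) (X (t + (k + 1) • δ) ω)} =
          ⋂ k, ⋂ (_ : k < m), {ω | C (X (t + k • δ) ω) (X (t + (k + 1) • δ) ω)} := by
        ext
        simp
      rw [this]
      exact MeasurableSet.iInter fun k => MeasurableSet.iInter fun hk =>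
        measurableSet_past_rel X (hmono k hk.le) (hmono (k + 1) hk) C
    have hstep : t + m • δ ≤ t + (m + 1) • δ := by
      rw [succ_nsmul, ← add_assoc]
      exact le_self_add
    have hsub : t + (m + 1) • δ - (t + m • δ) = δ := by
      rw [succ_nsmul, ← add_assoc, add_tsub_cancel_left]
    have hP := fun {G : Set Ω} (hG : MeasurableSet[past X (t + m • δ)] G) w y =>
      M.past_inter hX hQ hstep hG w y
    simp only [hsub] at hP
    have hle := past_le hX (t + m • δ)
    set B := G ∩ {ω | C (X (t + m • δ) ω) (X (t + (m + 1) • δ) ω)} ∩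
      {ω | X (t + (m + 1) • δ) ω = y.toNat} with hB
    have e1 : F ∩ {ω | X t ω = z.toNat} ∩
        {ω | ∀ k < m + 1, C (X (t + k • δ) ω) (X (t + (k + 1) • δ) ω)} ∩
        {ω | X (t + (m + 1) • δ) ω = y.toNat} = B := by
      ext ω
      simp only [hB, hG, Set.mem_inter_iff, Set.mem_ofPred_eq, Nat.forall_lt_succ_right]
      tauto
    have hBm : MeasurableSet B :=
      ((hle _ hGm).inter (past_le hX _ _ (measurableSet_past_rel X hstep le_rfl C))).inter (hX _ _)
    -- Almost surely no coordinate goes down, so a configuration preceding `y` also lies below `K`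
    -- and the decomposition over `Cfg N (Fin K)` loses nothing.
    have hae : ∀ᵐ ω ∂μ, ∀ w : Fin N → ℕ, (∃ i, y.toNat i < w i) →
        ¬ (X (t + m • δ) ω = w ∧ X (t + (m + 1) • δ) ω = y.toNat) := by
      rw [ae_all_iff]
      intro w
      by_cases hw : ∃ i, y.toNat i < w i
      · have h0 : μ.real ({ω | X (t + m • δ) ω = w} ∩
            {ω | X (t + (m + 1) • δ) ω = y.toNat}) = 0 := by
          have := hP MeasurableSet.univ w y.toNat
          rwa [hQz _ _ _ hw, mul_zero, Set.univ_inter] at this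
        rw [measureReal_eq_zero_iff] at h0
        filter_upwards [measure_eq_zero_iff_ae_notMem.1 h0] with ω hω _ h
        exact hω h
      · exact Eventually.of_forall fun _ h => (hw h).elim
    rw [e1, measureReal_eq_sum_cfg (hX (t + m • δ)) (K := K) hBm, pow_succ, Matrix.mul_apply,
      Finset.mul_sum]
    · refine Finset.sum_congr rfl fun w _ => ?_
      rw [← mul_assoc, ← ih w, cfgMatrix, Matrix.of_apply]
      split_ifs with hc
      · rw [← hP hGm]
        congr 1
        ext ω
        simp only [hB, Set.mem_inter_iff, Set.mem_ofPred_eq]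
        constructor
        · rintro ⟨⟨⟨h1, -⟩, h2⟩, h3⟩
          exact ⟨⟨h1, h3⟩, h2⟩
        · rintro ⟨⟨h1, h3⟩, h2⟩
          exact ⟨⟨⟨h1, by rwa [h3, h2]⟩, h2⟩, h3⟩
      · rw [mul_zero]
        convert measureReal_empty (μ := μ)
        ext ω
        simp only [hB, Set.mem_inter_iff, Set.mem_ofPred_eq, Set.mem_empty_iff_false, iff_false]
        rintro ⟨⟨⟨-, h1⟩, h2⟩, h3⟩
        rw [h3, h2] at h1
        exact hc h1
    · filter_upwards [hae] with ω hω h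
      refine ⟨hC _ _ h.1.2, fun i => ?_⟩
      by_contra hlt
      exact hω _ ⟨i, (y.toNat_lt i).trans_le (not_lt.1 hlt)⟩ ⟨rfl, h.2⟩

/-- No collision in the time interval `(s, t]`. -/
def noCollision (Good : T → Set Ω) (s t : T) : Set Ω := {ω | ∀ r, s < r → r ≤ t → ω ∈ Good r}

/-- No collision after time `s`. -/
def noCollisionAfter (Good : T → Set Ω) (s : T) : Set Ω := {ω | ∀ r, s < r → ω ∈ Good r}

/-- What is needed to condition a process on the absence of collisions: the killed transition
kernel `κ` and the limit `u` of the survival probabilities. -/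
structure KilledWalk (μ : Measure Ω) (X : T → Ω → Fin N → ℕ) (Good : T → Set Ω) (τ : T)
    (κ : T → (Fin N → ℕ) → (Fin N → ℕ) → ℝ) (u : (Fin N → ℕ) → ℝ) : Prop where
  measurable : ∀ r s, MeasurableSet {ω | X r ω = s}
  cofinal : ∀ r, ∃ k : ℕ, r ≤ k • τ
  strictMono : ∀ r, ∀ ω ∈ Good r, StrictMono (X r ω)
  measurable_past : ∀ t d z, StrictMono z →
    MeasurableSet[past X (t + d)] ({ω | X t ω = z} ∩ noCollision Good t (t + d))
  killed : ∀ t d F z y, MeasurableSet[past X t] F → StrictMono z → StrictMono y →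
    μ.real (F ∩ {ω | X t ω = z} ∩ noCollision Good t (t + d) ∩ {ω | X (t + d) ω = y}) =
      μ.real (F ∩ {ω | X t ω = z}) * κ d z y
  tendsto : ∀ s, StrictMono s → ∀ v : ℝ, 0 ≤ v → ∀ m : ℕ → ℝ,
    (∀ k, Tendsto (fun K => v * ∑ e : Cfg N (Fin K), κ (k • τ) s e.toNat) atTop (𝓝 (m k))) →
      Tendsto m atTop (𝓝 (v * u s))
  pos : ∀ s, StrictMono s → 0 < u s

namespace KilledWalk

variable {Good : T → Set Ω} {τ : T} {κ : T → (Fin N → ℕ) → (Fin N → ℕ) → ℝ}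
  {u : (Fin N → ℕ) → ℝ}

theorem measurableSet_noCollision (H : KilledWalk μ X Good τ κ u) {t : T} {F : Set Ω}
    (hF : MeasurableSet[past X t] F) {s : Fin N → ℕ} (hs : StrictMono s) (d : T) :
    MeasurableSet[past X (t + d)] (F ∩ {ω | X t ω = s} ∩ noCollision Good t (t + d)) := by
  rw [Set.inter_assoc]
  exact (past_mono X le_self_add _ hF).inter (H.measurable_past t d s hs)

variable [IsOrderedCancelAddMonoid T]

/-- The events that all coordinates at time `t + d` are below `K` exhaust the space, and the measure
is continuous along increasing unions. -/
theorem tendsto_sum_killed [IsFiniteMeasure μ] (H : KilledWalk μ X Good τ κ u) {t : T}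
    {F : Set Ω} (hF : MeasurableSet[past X t] F) {s : Fin N → ℕ} (hs : StrictMono s) (d : T) :
    Tendsto (fun K => μ.real (F ∩ {ω | X t ω = s}) * ∑ e : Cfg N (Fin K), κ d s e.toNat) atTop
      (𝓝 (μ.real (F ∩ {ω | X t ω = s} ∩ noCollision Good t (t + d)))) := by
  set B := F ∩ {ω | X t ω = s} ∩ noCollision Good t (t + d) with hB
  have hBm : MeasurableSet B := past_le H.measurable _ _ (H.measurableSet_noCollision hF hs d)
  have hmono : ∀ ω ∈ B, StrictMono (X (t + d) ω) := by
    rintro ω ⟨⟨-, h1⟩, h2⟩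
    by_cases hd : d = 0
    · rw [hd, add_zero, h1]
      exact hs
    · exact H.strictMono _ _ (h2 _ (lt_add_of_pos_right t (pos_iff_ne_zero.2 hd)) le_rfl)
  set BK : ℕ → Set Ω := fun K => B ∩ {ω | ∀ i, X (t + d) ω i < K} with hBK
  have hBKm : ∀ K, MeasurableSet (BK K) := fun K =>
    hBm.inter (past_le H.measurable _ _ (measurableSet_past_rel X le_rfl le_rfl
      (fun y _ => ∀ i, y i < K)))
  have h1 : ∀ K, μ.real (BK K) =
      μ.real (F ∩ {ω | X t ω = s}) * ∑ e : Cfg N (Fin K), κ d s e.toNat := by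
    intro K
    rw [measureReal_eq_sum_cfg (H.measurable (t + d)) (hBKm K) (K := K)
      (Eventually.of_forall fun ω hω => ⟨hmono ω hω.1, hω.2⟩), Finset.mul_sum]
    refine Finset.sum_congr rfl fun e _ => ?_
    rw [← H.killed t d F s e.toNat hF hs e.toNat_strictMono]
    congr 1
    ext ω
    simp only [hBK, hB, Set.mem_inter_iff, Set.mem_ofPred_eq]
    constructor
    · rintro ⟨⟨h1, -⟩, h2⟩
      exact ⟨h1, h2⟩
    · rintro ⟨h1, h2⟩
      exact ⟨⟨h1, fun i => h2 ▸ e.toNat_lt i⟩, h2⟩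
  have h2 : ⋃ K, BK K = B := by
    ext ω
    simp only [hBK, Set.mem_iUnion, Set.mem_inter_iff, Set.mem_ofPred_eq]
    exact ⟨fun ⟨K, h⟩ => h.1, fun h => (exists_forall_lt (X (t + d) ω)).imp fun K hK => ⟨h, hK⟩⟩
  have h3 : Monotone BK := fun K K' hK ω hω => ⟨hω.1, fun i => (hω.2 i).trans_le hK⟩
  have h4 := tendsto_measure_iUnion_atTop (μ := μ) h3
  rw [h2] at h4
  simp_rw [← h1]
  exact (ENNReal.tendsto_toReal (measure_ne_top μ B)).comp h4

/-- The survival events decrease along the cofinal times `t + k • τ`, and their probabilities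
converge by assumption. Allowing an arbitrary past event `F` is what yields the Markov property
later. -/
theorem measureReal_noCollisionAfter [IsFiniteMeasure μ] (H : KilledWalk μ X Good τ κ u)
    {t : T} {F : Set Ω} (hF : MeasurableSet[past X t] F) {s : Fin N → ℕ} (hs : StrictMono s) :
    μ.real (F ∩ {ω | X t ω = s} ∩ noCollisionAfter Good t) =
      μ.real (F ∩ {ω | X t ω = s}) * u s := by
  set B : ℕ → Set Ω := fun k => F ∩ {ω | X t ω = s} ∩ noCollision Good t (t + k • τ) with hB
  have h1 : ⋂ k, B k = F ∩ {ω | X t ω = s} ∩ noCollisionAfter Good t := by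
    ext ω
    simp only [hB, Set.mem_iInter, Set.mem_inter_iff]
    constructor
    · refine fun h => ⟨(h 0).1, fun r hr => ?_⟩
      obtain ⟨k, hk⟩ := H.cofinal r
      exact (h k).2 r hr (hk.trans le_add_self)
    · exact fun h k => ⟨h.1, fun r hr _ => h.2 r hr⟩
  have h2 : Antitone B := by
    intro k k' hk ω hω
    refine ⟨hω.1, fun r hr hr' => hω.2 r hr (hr'.trans ?_)⟩
    exact add_le_add_right (nsmul_le_nsmul_left zero_le hk) t
  have h3 := tendsto_measure_iInter_atTop (μ := μ) (s := B)
    (fun k => (past_le H.measurable _ _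
      (H.measurableSet_noCollision hF hs (k • τ))).nullMeasurableSet) h2 ⟨0, measure_ne_top _ _⟩
  rw [h1] at h3
  have h4 := (ENNReal.tendsto_toReal (measure_ne_top μ _)).comp h3
  exact tendsto_nhds_unique h4 (H.tendsto s hs _ measureReal_nonneg _
    fun k => H.tendsto_sum_killed hF hs (k • τ))

/-- The process conditioned on the absence of collisions is Markov. -/
theorem conditionedOn [IsProbabilityMeasure μ] [Sub T] [OrderedSub T]
    (H : KilledWalk μ X Good τ κ u) {x : Fin N → ℕ} (hx : StrictMono x) (h0 : ∀ᵐ ω ∂μ, X 0 ω = x) {h : Fin N → ℕ → ℂ}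
    (hu : ∀ s, StrictMono s → (u s : ℂ) = detH h s / ∏ i, h i (s i))
    {P : T → (Fin N → ℕ) → (Fin N → ℕ) → ℂ}
    (hP : ∀ d z y, StrictMono z → StrictMono y → P d z y = ((κ d z y * u y / u z : ℝ) : ℂ)) :
    ConditionedOn μ X x (noCollisionAfter Good 0) h P := by
  set A := noCollisionAfter Good 0 with hA
  set A' := {ω | X 0 ω = x} ∩ A with hA'
  have hAA' : A' =ᵐ[μ] A := by
    filter_upwards [h0] with ω hω
    exact propext ⟨fun h => h.2, fun h => ⟨hω, h⟩⟩
  -- Measurability of survival is available only from a fixed ordered starting point, whence the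
  -- detour through `A'` and null-measurability of `A`.
  have hA'm : MeasurableSet A' := by
    have : A' = ⋂ k : ℕ, {ω | X 0 ω = x} ∩ noCollision Good 0 (0 + k • τ) := by
      ext ω
      simp only [hA', Set.mem_iInter, Set.mem_inter_iff]
      constructor
      · exact fun h k => ⟨h.1, fun r hr _ => h.2 r hr⟩
      · refine fun h => ⟨(h 0).1, fun r hr => ?_⟩
        obtain ⟨k, hk⟩ := H.cofinal r
        exact (h k).2 r hr (hk.trans le_add_self)
    rw [this]
    exact MeasurableSet.iInter fun k => past_le H.measurable _ _ (H.measurable_past 0 _ x hx)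
  have hAn : NullMeasurableSet A μ := hA'm.nullMeasurableSet.congr hAA'
  have hinit : μ.real {ω | X 0 ω = x} = 1 := by
    have : {ω | X 0 ω = x} =ᵐ[μ] Set.univ := by
      filter_upwards [h0] with ω hω
      exact propext ⟨fun _ => trivial, fun _ => hω⟩
    rw [measureReal_congr this, probReal_univ]
  have hprob : μ.real A = u x := by
    have := H.measureReal_noCollisionAfter (t := 0) MeasurableSet.univ hx
    rwa [Set.univ_inter, hinit, one_mul, measureReal_congr hAA'] at this
  have hpos : 0 < μ A := by
    have := H.pos x hx
    rw [← hprob] at this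
    exact (ENNReal.toReal_pos_iff.1 this).1
  refine ⟨hAn, hpos, by rw [hprob, hu x hx], fun t => ?_, fun n t ht s hs => ?_⟩
  · have h1 : ∀ᵐ ω ∂μ, ω ∈ A → X t ω ∈ Weyl N := by
      filter_upwards [h0] with ω hω hωA
      by_cases htz : t = 0
      · rw [htz, hω]
        exact hx
      · exact H.strictMono _ _ (hωA t (pos_iff_ne_zero.2 htz))
    exact Measure.ae_smul_measure ((ae_restrict_iff'₀ hAn).2 h1) _
  · have hEm : ∀ n, MeasurableSet[past X (t n)] {ω | ∀ i ≤ n, X (t i) ω = s i} := fun n => by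
      have : {ω | ∀ i ≤ n, X (t i) ω = s i} = ⋂ i, ⋂ (_ : i ≤ n), {ω | X (t i) ω = s i} := by
        ext
        simp
      rw [this]
      exact MeasurableSet.iInter fun i => MeasurableSet.iInter fun hi =>
        measurableSet_past_eq X (ht hi) _
    set F : ℕ → Set Ω := fun n =>
      {ω | X 0 ω = x} ∩ noCollision Good 0 (t n) ∩ {ω | ∀ i ≤ n, X (t i) ω = s i} with hFdef
    have hFm : ∀ n, MeasurableSet[past X (t n)] (F n) := fun n => by
      have := H.measurable_past 0 (t n) x hx
      rw [zero_add] at this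
      exact this.inter (hEm n)
    have hFs : ∀ n, F n ∩ {ω | X (t n) ω = s n} = F n := fun n =>
      Set.inter_eq_left.2 fun ω hω => hω.2 n le_rfl
    -- Survival is split at `t n`: up to then it belongs to the past event `F n`, afterwards it
    -- contributes `u (s n)`.
    have hAE : ∀ n, μ.real (A ∩ {ω | ∀ i ≤ n, X (t i) ω = s i}) = μ.real (F n) * u (s n) := by
      intro n
      have h1 := H.measureReal_noCollisionAfter (hFm n) (hs n)
      rw [hFs] at h1
      rw [← h1]
      refine measureReal_congr ?_
      filter_upwards [h0] with ω hω
      refine propext ⟨fun h => ⟨⟨⟨hω, fun r hr _ => h.1 r hr⟩, h.2⟩, fun r hr =>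
        h.1 r (zero_le.trans_lt hr)⟩, fun h => ⟨fun r hr => ?_, h.1.2⟩⟩
      rcases le_or_gt r (t n) with hrt | hrt
      · exact h.1.1.2 r hr hrt
      · exact h.2 r hrt
    have hFsucc : μ.real (F (n + 1)) =
        μ.real (F n) * κ (t (n + 1) - t n) (s n) (s (n + 1)) := by
      have h1 := H.killed (t n) (t (n + 1) - t n) (F n) (s n) (s (n + 1)) (hFm n) (hs n)
        (hs (n + 1))
      rw [hFs, add_tsub_cancel_of_le (ht n.le_succ)] at h1
      rw [← h1]
      congr 1
      ext ω
      simp only [hFdef, Set.mem_inter_iff, Set.mem_ofPred_eq]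
      constructor
      · rintro ⟨⟨h1, h2⟩, h3⟩
        exact ⟨⟨⟨⟨h1, fun r hr hr' => h2 r hr (hr'.trans (ht n.le_succ))⟩,
          fun i hi => h3 i (by omega)⟩, fun r hr hr' => h2 r (zero_le.trans_lt hr) hr'⟩,
          h3 _ le_rfl⟩
      · rintro ⟨⟨⟨⟨h1, h2⟩, h3⟩, h4⟩, h5⟩
        refine ⟨⟨h1, fun r hr hr' => ?_⟩, fun i hi => ?_⟩
        · rcases le_or_gt r (t n) with hrt | hrt
          · exact h2 r hr hrt
          · exact h4 r hrt hr'
        · rcases Nat.lt_or_ge n i with h6 | h6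
          · obtain rfl : i = n + 1 := by omega
            exact h5
          · exact h3 i h6
    have hcond : ∀ n, (ProbabilityTheory.cond μ A).real {ω | ∀ i ≤ n, X (t i) ω = s i} =
        (μ.real A)⁻¹ * (μ.real (F n) * u (s n)) := fun n => by
      rw [measureReal_def, cond_apply' (past_le H.measurable _ _ (hEm n)), ENNReal.toReal_mul,
        ENNReal.toReal_inv, ← hAE n]
      rfl
    have hun := (H.pos _ (hs n)).ne'
    rw [hcond, hcond, hFsucc, hP _ _ _ (hs n) (hs (n + 1)), ← Complex.ofReal_mul]
    congr 1
    field_simp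

end KilledWalk

end Conditioning

end CondWalks

namespace CondWalks

/-! ### Conditioning from a base kernel -/

theorem survival_pos {N : ℕ} {a : ℕ → ℝ} (ha : ∀ k, 0 < a k) {θ : Fin N → ℝ} (h0 : ∀ i, 0 ≤ θ i)
    (hθ : StrictMono θ) {s : Fin N → ℕ} (hs : StrictMono s) :
    0 < survival (fun i => harm a (θ i)) s :=
  div_pos (det_harm_pos a ha θ h0 hθ s hs) (Finset.prod_pos fun i _ => harm_pos ha (h0 i) _)

theorem detH_ofReal {N : ℕ} (h : Fin N → ℕ → ℝ) (s : Fin N → ℕ) :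
    detH (fun i x => (h i x : ℂ)) s = ((Matrix.of fun i j => h i (s j)).det : ℂ) := by
  rw [detH]
  exact (RingHom.map_det Complex.ofRealHom _).symm

theorem ofReal_survival {N : ℕ} (h : Fin N → ℕ → ℝ) (s : Fin N → ℕ) :
    (survival h s : ℂ) = detH (fun i x => (h i x : ℂ)) s / ∏ i, (h i (s i) : ℂ) := by
  rw [survival, detH_ofReal]
  push_cast
  rfl

/-- The products of the `h_i` in `killed` and in the two factors `survival` cancel, leaving the
ratio of determinants. -/
theorem transformedKernel_eq {N : ℕ} {h : Fin N → ℕ → ℝ} (hh : ∀ i x, h i x ≠ 0) (c : Fin N → ℝ)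
    (A : ℕ → ℕ → ℝ) (z y : Fin N → ℕ) :
    transformedKernel (fun j => (c j : ℂ)) (fun i x => (h i x : ℂ)) (fun x y => (A x y : ℂ)) z y =
      ((killed h c A z y * survival h y / survival h z : ℝ) : ℂ) := by
  have e : Matrix.det (Matrix.of fun i j : Fin N => (A (z i) (y j) : ℂ)) =
      ((Matrix.of fun i j => A (z i) (y j)).det : ℂ) := (RingHom.map_det Complex.ofRealHom _).symm
  have n1 : ∀ s : Fin N → ℕ, ∏ i, h i (s i) ≠ 0 := fun s =>
    Finset.prod_ne_zero_iff.2 fun i _ => hh i _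
  have h1 := n1 z
  have h2 := n1 y
  rw [transformedKernel, detH_ofReal, detH_ofReal, e]
  simp only [killed, survival, Finset.prod_div_distrib, Finset.prod_mul_distrib,
    Finset.prod_const_one]
  rw [← Complex.ofReal_prod, ← Complex.ofReal_div, ← Complex.ofReal_one, ← Complex.ofReal_div,
    ← Complex.ofReal_mul, ← Complex.ofReal_mul]
  congr 1
  generalize (∏ i, h i (z i)) = p at *
  generalize (∏ i, h i (y i)) = q at *
  generalize (Matrix.of fun i j => h i (z j)).det = d
  -- In the degenerate cases both sides are 0, because division by zero gives 0.
  by_cases hd : d = 0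
  · simp [hd]
  by_cases hc : ∏ i, c i = 0
  · simp [hc]
  field_simp

theorem prod_doob {N : ℕ} (h : Fin N → ℕ → ℝ) (c : Fin N → ℝ) (A : ℕ → ℕ → ℝ)
    (z y : Fin N → ℕ) : ∏ i, doob (h i) (c i) A (z i) (y i) =
      (∏ i, h i (y i) / (h i (z i) * c i)) * ∏ i, A (z i) (y i) := Finset.prod_mul_distrib

theorem prod_doob_eq_zero {N : ℕ} (h : Fin N → ℕ → ℝ) (c : Fin N → ℝ) {A : ℕ → ℕ → ℝ}
    (hA : ∀ x y, y < x → A x y = 0) {z y : Fin N → ℕ} (hzy : ∃ i, y i < z i) :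
    ∏ i, doob (h i) (c i) A (z i) (y i) = 0 := by
  obtain ⟨i, hi⟩ := hzy
  exact Finset.prod_eq_zero (Finset.mem_univ i) (by rw [doob, hA _ _ hi, mul_zero])

section Discrete

variable {Ω : Type*} [MeasurableSpace Ω] {μ : Measure Ω} [IsProbabilityMeasure μ] {N : ℕ}
  {T : ℕ → ℕ → ℕ → ℝ} {h : Fin N → ℕ → ℝ} {c : Fin N → ℝ}

theorem BaseWalk.killed_bounds (H : BaseWalk T h c)
    (h1 : ∀ z y, StrictMono z → StrictMono y → 0 ≤ killed h c (T 1) z y ∧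
      killed h c (T 1) z y ≤ ∏ i, doob (h i) (c i) (T 1) (z i) (y i))
    (k : ℕ) {z y : Fin N → ℕ} (hz : StrictMono z) (hy : StrictMono y) :
    0 ≤ killed h (fun i => c i ^ k) (T k) z y ∧
      killed h (fun i => c i ^ k) (T k) z y ≤ ∏ i, doob (h i) (c i ^ k) (T k) (z i) (y i) := by
  obtain ⟨K₁, hK₁⟩ := exists_forall_lt z
  obtain ⟨K₂, hK₂⟩ := exists_forall_lt y
  obtain ⟨e, rfl⟩ := Cfg.exists_toNat_eq (K := max K₁ K₂) hz
    fun i => (hK₁ i).trans_le (le_max_left _ _)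
  obtain ⟨e', rfl⟩ := Cfg.exists_toNat_eq (K := max K₁ K₂) hy
    fun i => (hK₂ i).trans_le (le_max_right _ _)
  have hh : ∀ i x, h i x ≠ 0 := fun i x => (H.h_pos i x).ne'
  have hpow := cfgMatrix_killed_pow hh c (H.pow (max K₁ K₂) k).symm
  have e0 : killed h (fun i => c i ^ k) (T k) e.toNat e'.toNat =
      (cfgMatrix (max K₁ K₂) (killed h c (T 1)) ^ k) e e' := by
    rw [hpow]
    rfl
  have hS0 : ∀ e e' : Cfg N (Fin (max K₁ K₂)), 0 ≤ cfgMatrix _ (killed h c (T 1)) e e' :=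
    fun e e' => (h1 _ _ e.toNat_strictMono e'.toNat_strictMono).1
  rw [e0]
  refine ⟨matrix_pow_nonneg hS0 k e e', ?_⟩
  refine (pow_le_prod (P := fun i => trunc _ (doob (h i) (c i) (T 1))) hS0 (fun i x y => ?_)
    (fun e e' => (h1 _ _ e.toNat_strictMono e'.toNat_strictMono).2) k e e').trans_eq ?_
  · have := H.doob_nonneg i 1 x y
    rw [pow_one] at this
    exact this
  · refine Finset.prod_congr rfl fun i _ => ?_
    rw [← trunc_doob_pow H.pow (hh i)]
    rfl

/-- Discrete Karlin–McGregor formula. The one-step killed kernel is a Doob transform of one-step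
minors by `hdet`, so `d` collision-free steps have as weight an entry of its `d`-th power, which is
the determinant of `T d` suitably weighted. -/
theorem BaseWalk.killedWalk (H : BaseWalk T h c) (htri : ∀ t x y, y < x → T t x y = 0)
    (hperm : ∀ (σ : Equiv.Perm (Fin N)) (y : Fin N → ℕ), StrictMono y →
      ∏ i, h (σ i) (y i) ≤ ∏ i, h i (y i)) (hpos : ∀ s, StrictMono s → 0 < survival h s)
    {x : Fin N → ℕ} {X : ℕ → Ω → Fin N → ℕ}
    (W : IndepWalks μ (fun i t => doob (h i) (c i ^ t) (T t)) x X)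
    {C : (Fin N → ℕ) → (Fin N → ℕ) → Prop} (hC : ∀ z y, C z y → StrictMono z)
    [∀ z y, Decidable (C z y)]
    (hdet : ∀ z y, StrictMono z → StrictMono y → (Matrix.of fun i j => T 1 (z i) (y j)).det =
      if C z y then ∏ i, T 1 (z i) (y i) else 0) {Good : ℕ → Set Ω}
    (hgood : ∀ r ω, StrictMono (X r ω) → (ω ∈ Good (r + 1) ↔ C (X r ω) (X (r + 1) ω)))
    (hmono : ∀ r, ∀ ω ∈ Good r, StrictMono (X r ω)) :
    KilledWalk μ X Good 1 (fun d => killed h (fun i => c i ^ d) (T d)) (survival h) := by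
  have hstep : ∀ z y, StrictMono z → StrictMono y → killed h c (T 1) z y =
      if C z y then ∏ i, doob (h i) (c i) (T 1) (z i) (y i) else 0 := by
    intro z y hz hy
    rw [killed, hdet z y hz hy]
    split_ifs
    · rw [prod_doob]
    · rw [mul_zero]
  have hQ : ∀ (t : ℕ) (z y : Fin N → ℕ), 0 ≤ ∏ i, doob (h i) (c i ^ t) (T t) (z i) (y i) :=
    fun t z y => Finset.prod_nonneg fun i _ => H.doob_nonneg i t _ _
  have hb := H.killed_bounds fun z y hz hy => by
    rw [hstep z y hz hy]
    have := hQ 1 z y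
    simp only [pow_one] at this
    split_ifs
    exacts [⟨this, le_rfl⟩, ⟨le_rfl, this⟩]
  -- The relation `C` includes the ordering of its first argument. That ordering comes from `z` for
  -- the first step and from the preceding good time for later ones.
  have hnc : ∀ t d z, StrictMono z → {ω | X t ω = z} ∩ noCollision Good t (t + d) =
      {ω | X t ω = z} ∩ {ω | ∀ k < d, C (X (t + k) ω) (X (t + (k + 1)) ω)} := by
    intro t d z hz
    ext ω
    simp only [Set.mem_inter_iff, Set.mem_ofPred_eq]
    refine and_congr_right fun h0 => ⟨fun hω k hk => ?_, fun hω r hr hr' => ?_⟩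
    · refine (hgood (t + k) ω ?_).1 (hω _ (by omega) (by omega))
      cases k with
      | zero => rw [add_zero, h0]; exact hz
      | succ k => exact hmono _ _ (hω _ (by omega) (by omega))
    · obtain ⟨k, rfl⟩ : ∃ k, r = t + (k + 1) := ⟨r - t - 1, by omega⟩
      have h1 := hω k (by omega)
      exact (hgood (t + k) ω (hC _ _ h1)).2 h1
  refine ⟨W.measurableSet_eq, fun r => ⟨r, by simp⟩, hmono, fun t d z hz => ?_,
    fun t d F z y hF hz hy => ?_, fun s hs v hv m hm => ?_, hpos⟩
  · rw [hnc t d z hz]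
    refine (measurableSet_past_eq X le_self_add z).inter ?_
    have : {ω | ∀ k < d, C (X (t + k) ω) (X (t + (k + 1)) ω)} =
        ⋂ k, ⋂ (_ : k < d), {ω | C (X (t + k) ω) (X (t + (k + 1)) ω)} := by
      ext
      simp
    rw [this]
    exact MeasurableSet.iInter fun k => MeasurableSet.iInter fun hk =>
      measurableSet_past_rel X (by omega) (by omega) C
  · obtain ⟨K₁, hK₁⟩ := exists_forall_lt z
    obtain ⟨K₂, hK₂⟩ := exists_forall_lt y
    obtain ⟨e, rfl⟩ := Cfg.exists_toNat_eq (K := max K₁ K₂) hz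
      fun i => (hK₁ i).trans_le (le_max_left _ _)
    obtain ⟨e', rfl⟩ := Cfg.exists_toNat_eq (K := max K₁ K₂) hy
      fun i => (hK₂ i).trans_le (le_max_right _ _)
    have h1 := W.isMarkov.measureReal_steps W.measurableSet_eq hQ
      (fun t z y hzy => prod_doob_eq_zero h _ (htri t) hzy) hC hF e 1 d e'
    simp only [smul_eq_mul, mul_one] at h1
    rw [Set.inter_assoc F, hnc t d _ hz, ← Set.inter_assoc F, h1]
    congr 1
    have h2 : cfgMatrix (max K₁ K₂) (fun w y : Fin N → ℕ =>
        @ite _ (C w y) (Classical.propDecidable _)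
          (∏ i, doob (h i) (c i ^ 1) (T 1) (w i) (y i)) 0) =
        cfgMatrix (max K₁ K₂) (killed h c (T 1)) := by
      ext w w'
      simp only [cfgMatrix, Matrix.of_apply,
        hstep _ _ w.toNat_strictMono w'.toNat_strictMono, pow_one]
    rw [h2, cfgMatrix_killed_pow (fun i x => (H.h_pos i x).ne') c (H.pow _ d).symm]
    rfl
  · simp only [smul_eq_mul, mul_one] at hm
    exact H.tendsto_survival hperm s (fun k y hy => (hb k hs hy).1) (fun k y hy => (hb k hs hy).2)
      hv hm

end Discrete

end CondWalks

/-! ### The Bernoulli and geometric cases -/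

namespace CondWalks

theorem strictMono_of_consecutive {N : ℕ} {f : Fin N → ℝ}
    (h : ∀ i j : Fin N, (i : ℕ) + 1 = j → f i < f j) : StrictMono f := by
  cases N with
  | zero => exact fun i => i.elim0
  | succ N => exact Fin.strictMono_iff_lt_succ.2 fun i => h _ _ (by simp)

theorem exists_consecutive {N : ℕ} {i j : Fin N} (h : i ≠ j) :
    ∃ k l : Fin N, (k : ℕ) + 1 = l := by
  have : 1 < N := by
    have h1 := i.2
    have h2 := j.2
    have h3 : (i : ℕ) ≠ j := fun h' => h (Fin.ext h')
    omega
  exact ⟨⟨0, by omega⟩, ⟨1, this⟩, rfl⟩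

section

variable {a : ℕ → ℝ}

/-! ### Bernoulli walks -/

/-- For `θ = 1/γ - 1` the up-probability `a_x` is multiplied by `γ (1 + θ/a_x)` and becomes `γ a_x +
1 - γ`; the holding probability `1 - a_x` is multiplied by `γ`. -/
theorem stepB_eq_doob (ha : ∀ k, 0 < a k) {γ : ℝ} (hγ : 0 < γ) (hγ1 : γ ≤ 1) :
    stepB a γ = doob (harm a (γ⁻¹ - 1)) γ⁻¹ (stepB a 1) := by
  ext x y
  have hθ : 0 ≤ γ⁻¹ - 1 := sub_nonneg.2 ((one_le_inv₀ hγ).2 hγ1)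
  have hx := (harm_pos ha hθ x).ne'
  have hax := (ha x).ne'
  simp only [doob, stepB]
  split_ifs with h1 h2
  · rw [h1, harm_succ]
    generalize harm a (γ⁻¹ - 1) x = H at *
    field_simp
    ring
  · rw [h2]
    generalize harm a (γ⁻¹ - 1) x = H at *
    field_simp
  · simp

theorem walkB_eq_doob (ha : ∀ k, 0 < a k) {γ : ℝ} (hγ : 0 < γ) (hγ1 : γ ≤ 1) (t : ℕ) :
    walkB a γ t = doob (harm a (γ⁻¹ - 1)) (γ⁻¹ ^ t) (walkB a 1 t) := by
  rw [walkB, stepB_eq_doob ha hγ hγ1, walkB, stepPow_doob (stepB_eq_zero a 1)]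
  exact fun x => (harm_pos ha (sub_nonneg.2 ((one_le_inv₀ hγ).2 hγ1)) x).ne'

theorem stepB_nonneg (ha : ∀ k, 0 < a k) (ha1 : ∀ k, a k ≤ 1) {γ : ℝ} (hγ : 0 < γ) (hγ1 : γ ≤ 1)
    (x y : ℕ) : 0 ≤ stepB a γ x y := by
  have h1 := ha x
  have h2 := ha1 x
  rw [stepB]
  split_ifs
  · have := mul_pos hγ h1
    linarith
  · nlinarith
  · exact le_rfl

theorem hasSum_stepB (a : ℕ → ℝ) (γ : ℝ) (x : ℕ) : HasSum (stepB a γ x) 1 := by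
  have h : HasSum (stepB a γ x) (∑ y ∈ {x, x + 1}, stepB a γ x y) := by
    refine hasSum_sum_of_ne_finset_zero fun y hy => ?_
    simp only [Finset.mem_insert, Finset.mem_singleton, not_or] at hy
    rw [stepB, if_neg hy.2, if_neg hy.1]
  convert h using 1
  rw [Finset.sum_pair (by omega)]
  simp [stepB]

theorem collisionTimeB_eq_top_iff {N : ℕ} (p : ℕ → Fin N → ℕ) :
    collisionTimeB p = ⊤ ↔ ∀ t, 0 < t → StrictMono (p t) := by
  rw [collisionTimeB, sInf_eq_top]
  constructor
  · intro h t ht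
    by_contra hc
    exact absurd (h _ ⟨t, ⟨ht, hc⟩, rfl⟩) (by simp)
  · rintro h _ ⟨t, ⟨ht, hc⟩, rfl⟩
    exact absurd (h t ht) hc

theorem hB_eq (a : ℕ → ℝ) (γ : ℝ) : hB a γ = fun x => (harm a (γ⁻¹ - 1) x : ℂ) := by
  ext x
  rw [← charPoly_neg_ofReal, hB]
  push_cast
  rw [neg_sub]

variable {Ω : Type*} [MeasurableSpace Ω] {μ : Measure Ω} [IsProbabilityMeasure μ] {N : ℕ}
  {γ : Fin N → ℝ} {x : Fin N → ℕ}

theorem conditionedOn_bernoulli (ha_inf : 0 < ⨅ k, a k) (ha_sup : BddAbove (Set.range a))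
    (hx : StrictMono x) (ha1 : ∀ k, a k ≤ 1) (hγ : ∀ i, 0 < γ i ∧ γ i ≤ 1)
    (hsep : ∀ i j : Fin N, (i : ℕ) + 1 = (j : ℕ) →
      γ j / γ i < (1 - ⨆ k, a k) / (1 - ⨅ k, a k))
    {X : ℕ → Ω → Fin N → ℕ} (W : IndepWalks μ (fun i => walkB a (γ i)) x X) :
    ConditionedOn μ X x {ω | collisionTimeB (fun t => X t ω) = ⊤} (fun i => hB a (γ i))
      (kernelB a γ) := by
  have ha := apply_pos ha_inf
  have hM1 : ⨆ k, a k ≤ 1 := ciSup_le ha1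
  have hmM : ⨅ k, a k ≤ ⨆ k, a k := (iInf_le_apply ha_inf 0).trans (le_ciSup ha_sup 0)
  set θ : Fin N → ℝ := fun i => (γ i)⁻¹ - 1 with hθdef
  have hθ0 : ∀ i, 0 ≤ θ i := fun i => sub_nonneg.2 ((one_le_inv₀ (hγ i).1).2 (hγ i).2)
  have hθ : StrictMono θ := by
    refine strictMono_of_consecutive fun i j hij => ?_
    -- The bound in the separation condition is at most 1, so `γ` decreases and `θ = 1/γ - 1`
    -- increases.
    have h1 : γ j / γ i < 1 := (hsep i j hij).trans_le
      (div_le_one_of_le₀ (by linarith) (by linarith))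
    have h2 : γ j < γ i := by rwa [div_lt_one (hγ i).1] at h1
    have := inv_strictAnti₀ (hγ j).1 h2
    simp only [hθdef]
    linarith
  set h : Fin N → ℕ → ℝ := fun i => harm a (θ i) with hh
  set c : Fin N → ℝ := fun i => (γ i)⁻¹ with hc
  have hwalk : ∀ i t, walkB a (γ i) t = doob (h i) (c i ^ t) (walkB a 1 t) := fun i t =>
    walkB_eq_doob ha (hγ i).1 (hγ i).2 t
  have hone : ∀ γ, walkB a γ 1 = stepB a γ := fun γ => stepPow_one (stepB_eq_zero a γ)
  have H : BaseWalk (walkB a 1) h c := by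
    refine ⟨fun x y => ?_, fun K k => trunc_stepPow_one (stepB_eq_zero a 1) K k,
      fun i x => harm_pos ha (hθ0 i) x, fun i => inv_pos.2 (hγ i).1, fun i k x => ?_,
      fun i j hij => ?_⟩
    · rw [hone]
      exact stepB_nonneg ha ha1 one_pos le_rfl x y
    · rw [← hwalk]
      exact (hasSum_stepPow (stepB_nonneg ha ha1 (hγ i).1 (hγ i).2) (hasSum_stepB a (γ i)) k
        x).tendsto_sum_nat
    · obtain ⟨k, l, hkl⟩ := exists_consecutive hij
      -- If there are two distinct walks, the separation condition for a consecutive pair forces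
      -- `sup a < 1`; the holding probabilities `γ_i (1 - a_x)` then differ uniformly in `x`.
      have hM : 0 < 1 - ⨆ k, a k := by
        have h1 := (div_pos (hγ l).1 (hγ k).1).trans (hsep k l hkl)
        by_contra hcon
        have h2 : 1 - ⨆ k, a k = 0 := by linarith
        rw [h2, zero_div] at h1
        exact lt_irrefl _ h1
      have hne : γ i - γ j ≠ 0 := fun h0 => hij (hθ.injective (by
        simp only [hθdef, sub_eq_zero.1 h0]))
      refine ⟨|γ i - γ j| * (1 - ⨆ k, a k), mul_pos (abs_pos.2 hne) hM, fun x => ?_⟩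
      have e : ∀ i, doob (h i) (c i) (walkB a 1 1) x x = γ i * (1 - a x) := fun i => by
        have := hwalk i 1
        rw [pow_one] at this
        rw [← this, hone]
        simp [stepB]
        ring
      have hax : a x ≤ ⨆ k, a k := le_ciSup ha_sup x
      rw [e, e, ← sub_mul, abs_mul, abs_of_nonneg (a := 1 - a x) (by linarith)]
      gcongr
  have hfun : (fun i => walkB a (γ i)) = fun i t => doob (h i) (c i ^ t) (walkB a 1 t) := by
    funext i t
    exact hwalk i t
  rw [hfun] at W
  classical
  have P := H.killedWalk (fun t x y hxy => stepPow_eq_zero (stepB_eq_zero a 1) t hxy)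
    (fun σ y hy => prod_harm_perm_le ha hθ0 hθ hy σ) (fun s hs => survival_pos ha hθ0 hθ hs) W
    (C := fun z y => StrictMono z ∧ StrictMono y) (fun z y h => h.1)
    (fun z y hz hy => by rw [if_pos ⟨hz, hy⟩, hone]; exact det_stepB a hz hy)
    (Good := fun r => {ω | StrictMono (X r ω)}) (fun r ω h => ⟨fun h' => ⟨h, h'⟩, fun h' => h'.2⟩)
    (fun r ω h => h)
  have hA : {ω | collisionTimeB (fun t => X t ω) = ⊤} =
      noCollisionAfter (fun r => {ω | StrictMono (X r ω)}) 0 := by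
    ext ω
    exact collisionTimeB_eq_top_iff _
  have hhB : (fun i => hB a (γ i)) = fun i x => (h i x : ℂ) := funext fun i => hB_eq a (γ i)
  rw [hA, hhB]
  refine P.conditionedOn hx W.initial (fun s _ => ofReal_survival h s) fun d z y hz hy => ?_
  rw [← transformedKernel_eq (fun i x => (H.h_pos i x).ne'), kernelB, hhB]
  congr 1
  · funext j
    simp [hc]
  · funext x y
    exact toeplitz_bernoulli ha_inf ha_sup d x y

/-! ### Geometric walks -/

/-- Factor by factor, with `θ = 1 - 1/γ`, one has `(γ(1+a) - 1)/(γ(1+a)) = (1 + θ/a) · a/(1+a)`. -/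
theorem stepG_eq_doob (ha : ∀ k, 0 < a k) {γ : ℝ} (hγ : 1 ≤ γ) :
    stepG a γ = doob (harm a (1 - γ⁻¹)) γ (stepG a 1) := by
  ext x y
  have hγ0 : 0 < γ := by linarith
  have hθ : 0 ≤ 1 - γ⁻¹ := sub_nonneg.2 (inv_le_one_of_one_le₀ hγ)
  have hx := (harm_pos ha hθ x).ne'
  simp only [doob, stepG]
  split_ifs with h
  · have e : harm a (1 - γ⁻¹) y =
        harm a (1 - γ⁻¹) x * ∏ k ∈ Finset.Ico x y, (1 + (1 - γ⁻¹) / a k) :=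
      (Finset.prod_range_mul_prod_Ico _ h).symm
    have e2 : ∏ k ∈ Finset.Ico x y, (γ * (1 + a k) - 1) / (γ * (1 + a k)) =
        (∏ k ∈ Finset.Ico x y, (1 + (1 - γ⁻¹) / a k)) *
          ∏ k ∈ Finset.Ico x y, (1 * (1 + a k) - 1) / (1 * (1 + a k)) := by
      rw [← Finset.prod_mul_distrib]
      refine Finset.prod_congr rfl fun k _ => ?_
      have h1 := (ha k).ne'
      have h2 : 1 + a k ≠ 0 := by have := ha k; positivity
      field_simp
      ring
    have h2 : 1 + a y ≠ 0 := by have := ha y; positivity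
    rw [e, e2]
    generalize harm a (1 - γ⁻¹) x = H at *
    generalize ∏ k ∈ Finset.Ico x y, (1 + (1 - γ⁻¹) / a k) = p
    generalize ∏ k ∈ Finset.Ico x y, (1 * (1 + a k) - 1) / (1 * (1 + a k)) = q
    field_simp
  · simp

theorem walkG_eq_doob (ha : ∀ k, 0 < a k) {γ : ℝ} (hγ : 1 ≤ γ) (t : ℕ) :
    walkG a γ t = doob (harm a (1 - γ⁻¹)) (γ ^ t) (walkG a 1 t) := by
  rw [walkG, stepG_eq_doob ha hγ, walkG, stepPow_doob (stepG_eq_zero a 1)]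
  exact fun x => (harm_pos ha (sub_nonneg.2 (inv_le_one_of_one_le₀ hγ)) x).ne'

theorem stepG_nonneg (ha : ∀ k, 0 < a k) {γ : ℝ} (hγ : 1 ≤ γ) (x y : ℕ) : 0 ≤ stepG a γ x y := by
  rw [stepG]
  split_ifs
  · have := ha y
    refine mul_nonneg (by positivity) (Finset.prod_nonneg fun k _ => ?_)
    have := ha k
    exact div_nonneg (by nlinarith) (by positivity)
  · exact le_rfl

theorem sum_stepG (ha : ∀ k, 0 < a k) {γ : ℝ} (hγ : 1 ≤ γ) (x n : ℕ) :
    ∑ y ∈ Finset.range (x + n), stepG a γ x y =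
      1 - ∏ k ∈ Finset.Ico x (x + n), (γ * (1 + a k) - 1) / (γ * (1 + a k)) := by
  induction n with
  | zero =>
    simp only [add_zero, Finset.Ico_self, Finset.prod_empty, sub_self]
    exact Finset.sum_eq_zero fun y hy => stepG_eq_zero a γ x y (Finset.mem_range.1 hy)
  | succ n ih =>
    have h1 : 1 + a (x + n) ≠ 0 := by have := ha (x + n); positivity
    have h2 : γ ≠ 0 := by positivity
    rw [← add_assoc, Finset.sum_range_succ, ih, Finset.prod_Ico_succ_top (by omega), stepG,
      if_pos (by omega)]
    generalize ∏ k ∈ Finset.Ico x (x + n), (γ * (1 + a k) - 1) / (γ * (1 + a k)) = p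
    field_simp
    ring

theorem hasSum_stepG (ha : ∀ k, 0 < a k) (ha_sup : BddAbove (Set.range a)) {γ : ℝ} (hγ : 1 ≤ γ)
    (x : ℕ) : HasSum (stepG a γ x) 1 := by
  rw [hasSum_iff_tendsto_nat_of_nonneg (stepG_nonneg ha hγ x)]
  have hM0 : 0 < ⨆ k, a k := (ha 0).trans_le (le_ciSup ha_sup 0)
  -- A uniform bound below 1 for the probability of passing a site; the tail left by `sum_stepG` is
  -- then at most `q ^ n`.
  set q : ℝ := 1 - 1 / (γ * (1 + ⨆ k, a k)) with hq
  have hγM : 1 ≤ γ * (1 + ⨆ k, a k) := by nlinarith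
  have hq0 : 0 ≤ q := sub_nonneg.2 ((div_le_one (by positivity)).2 hγM)
  have hq1 : q < 1 := by
    have : 0 < 1 / (γ * (1 + ⨆ k, a k)) := by positivity
    linarith
  have hfac : ∀ k, 0 ≤ (γ * (1 + a k) - 1) / (γ * (1 + a k)) ∧
      (γ * (1 + a k) - 1) / (γ * (1 + a k)) ≤ q := by
    intro k
    have hk := ha k
    have hkM : a k ≤ ⨆ k, a k := le_ciSup ha_sup k
    refine ⟨div_nonneg (by nlinarith) (by positivity), ?_⟩
    have h1 : γ * (1 + a k) ≠ 0 := by positivity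
    have h2 : 1 / (γ * (1 + ⨆ k, a k)) ≤ 1 / (γ * (1 + a k)) := by gcongr
    rw [sub_div, div_self h1]
    linarith
  have hlim : Tendsto (fun n => ∑ y ∈ Finset.range (n + x), stepG a γ x y) atTop (𝓝 1) := by
    have h0 : Tendsto (fun n => ∏ k ∈ Finset.Ico x (x + n), (γ * (1 + a k) - 1) / (γ * (1 + a k)))
        atTop (𝓝 0) := by
      refine squeeze_zero (fun n => Finset.prod_nonneg fun k _ => (hfac k).1) (fun n => ?_)
        (tendsto_pow_atTop_nhds_zero_of_lt_one hq0 hq1)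
      refine (Finset.prod_le_prod (fun k _ => (hfac k).1) fun k _ => (hfac k).2).trans_eq ?_
      simp
    have := h0.const_sub 1
    rw [sub_zero] at this
    refine this.congr fun n => ?_
    rw [add_comm n x, sum_stepG ha hγ]
  exact (tendsto_add_atTop_iff_nat x).1 hlim

theorem collisionTimeG_eq_top_iff {N : ℕ} (p : ℕ → Fin N → ℕ) :
    collisionTimeG p = ⊤ ↔ ∀ t, 0 < t → Interlace (p (t - 1)) (p t) := by
  rw [collisionTimeG, sInf_eq_top]
  constructor
  · intro h t ht
    by_contra hc
    exact absurd (h _ ⟨t, ⟨ht, hc⟩, rfl⟩) (by simp)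
  · rintro h _ ⟨t, ⟨ht, hc⟩, rfl⟩
    exact absurd (h t ht) hc

theorem hG_eq (a : ℕ → ℝ) (γ : ℝ) : hG a γ = fun x => (harm a (1 - γ⁻¹) x : ℂ) := by
  ext x
  rw [← charPoly_neg_ofReal, hG]
  push_cast
  rw [neg_sub]

theorem conditionedOn_geometric (ha_inf : 0 < ⨅ k, a k) (ha_sup : BddAbove (Set.range a))
    (hx : StrictMono x) (hγ : ∀ i, 1 ≤ γ i)
    (hsep : ∀ i j : Fin N, (i : ℕ) + 1 = (j : ℕ) →
      γ j / γ i > (1 + ⨆ k, a k) / (1 + ⨅ k, a k))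
    {X : ℕ → Ω → Fin N → ℕ} (W : IndepWalks μ (fun i => walkG a (γ i)) x X) :
    ConditionedOn μ X x {ω | collisionTimeG (fun t => X t ω) = ⊤} (fun i => hG a (γ i))
      (kernelG a γ) := by
  have ha := apply_pos ha_inf
  have hmM : ⨅ k, a k ≤ ⨆ k, a k := (iInf_le_apply ha_inf 0).trans (le_ciSup ha_sup 0)
  have hγ0 : ∀ i, 0 < γ i := fun i => one_pos.trans_le (hγ i)
  set θ : Fin N → ℝ := fun i => 1 - (γ i)⁻¹ with hθdef
  have hθ0 : ∀ i, 0 ≤ θ i := fun i => sub_nonneg.2 (inv_le_one_of_one_le₀ (hγ i))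
  have hθ : StrictMono θ := by
    refine strictMono_of_consecutive fun i j hij => ?_
    have h1 : 1 < γ j / γ i := lt_of_le_of_lt
      ((one_le_div (by linarith)).2 (by linarith)) (hsep i j hij)
    have h2 : γ i < γ j := by rwa [one_lt_div (hγ0 i)] at h1
    have := inv_strictAnti₀ (hγ0 i) h2
    simp only [hθdef]
    linarith
  set h : Fin N → ℕ → ℝ := fun i => harm a (θ i) with hh
  have hwalk : ∀ i t, walkG a (γ i) t = doob (h i) (γ i ^ t) (walkG a 1 t) := fun i t =>
    walkG_eq_doob ha (hγ i) t
  have hone : ∀ γ, walkG a γ 1 = stepG a γ := fun γ => stepPow_one (stepG_eq_zero a γ)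
  have H : BaseWalk (walkG a 1) h γ := by
    refine ⟨fun x y => ?_, fun K k => trunc_stepPow_one (stepG_eq_zero a 1) K k,
      fun i x => harm_pos ha (hθ0 i) x, hγ0, fun i k x => ?_, fun i j hij => ?_⟩
    · rw [hone]
      exact stepG_nonneg ha le_rfl x y
    · rw [← hwalk]
      exact (hasSum_stepPow (stepG_nonneg ha (hγ i)) (hasSum_stepG ha ha_sup (hγ i)) k
        x).tendsto_sum_nat
    · have hne : (γ i)⁻¹ - (γ j)⁻¹ ≠ 0 := fun h0 => hij (hθ.injective (by
        simp only [hθdef, sub_eq_zero.1 h0]))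
      have hM0 : 0 < 1 + ⨆ k, a k := by linarith
      -- The holding probability at `x` is `1 / (γ_i (1 + a_x))`, and `a_x ≤ sup a`.
      refine ⟨|(γ i)⁻¹ - (γ j)⁻¹| * (1 + ⨆ k, a k)⁻¹, mul_pos (abs_pos.2 hne) (inv_pos.2 hM0),
        fun x => ?_⟩
      have e : ∀ i, doob (h i) (γ i) (walkG a 1 1) x x = (γ i)⁻¹ * (1 + a x)⁻¹ := fun i => by
        have := hwalk i 1
        rw [pow_one] at this
        rw [← this, hone]
        simp [stepG, mul_comm]
      have hax : a x ≤ ⨆ k, a k := le_ciSup ha_sup x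
      have hax0 := ha x
      have h1 : 0 < (1 + a x)⁻¹ := by positivity
      rw [e, e, ← sub_mul, abs_mul, abs_of_pos h1]
      gcongr
  have hfun : (fun i => walkG a (γ i)) = fun i t => doob (h i) (γ i ^ t) (walkG a 1 t) := by
    funext i t
    exact hwalk i t
  rw [hfun] at W
  classical
  have P := H.killedWalk (fun t x y hxy => stepPow_eq_zero (stepG_eq_zero a 1) t hxy)
    (fun σ y hy => prod_harm_perm_le ha hθ0 hθ hy σ) (fun s hs => survival_pos ha hθ0 hθ hs) W
    (C := fun z y => StrictMono z ∧ Interlace z y) (fun z y h => h.1)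
    (fun z y hz hy => by rw [hone, det_stepG a hz hy]; simp only [hz, true_and])
    (Good := fun r => {ω | Interlace (X (r - 1) ω) (X r ω)})
    (fun r ω h => ⟨fun h' => ⟨h, h'⟩, fun h' => h'.2⟩) (fun r ω h => Interlace.strictMono h)
  have hA : {ω | collisionTimeG (fun t => X t ω) = ⊤} =
      noCollisionAfter (fun r => {ω | Interlace (X (r - 1) ω) (X r ω)}) 0 := by
    ext ω
    exact collisionTimeG_eq_top_iff _
  have hhG : (fun i => hG a (γ i)) = fun i x => (h i x : ℂ) := funext fun i => hG_eq a (γ i)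
  rw [hA, hhG]
  refine P.conditionedOn hx W.initial (fun s _ => ofReal_survival h s) fun d z y hz hy => ?_
  rw [← transformedKernel_eq (fun i x => (H.h_pos i x).ne'), kernelG, hhG]
  congr 1
  · funext j
    simp
  · funext x y
    exact toeplitz_geometric ha_inf ha_sup d x y

end

end CondWalks

namespace CondWalks

/-! ### Pure-birth semigroups -/

section MatrixExp

open scoped Matrix.Norms.Operator

variable {ι : Type*} [Fintype ι] [DecidableEq ι]

theorem hasSum_matrix_exp (A : Matrix ι ι ℝ) (t : ℝ) (i j : ι) :
    HasSum (fun n : ℕ => t ^ n / (n.factorial : ℝ) * (A ^ n) i j)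
      (NormedSpace.exp (t • A) i j) := by
  have h := NormedSpace.exp_series_hasSum_exp' (𝕂 := ℝ) (t • A)
  have h2 := h.map (Matrix.entryAddMonoidHom ℝ i j) (continuous_id.matrix_elem i j)
  refine h2.congr_fun fun n => ?_
  simp [smul_pow]
  ring

theorem matrix_exp_sub_smul_one (A : Matrix ι ι ℝ) (c t : ℝ) (i j : ι) :
    NormedSpace.exp (t • (A - c • (1 : Matrix ι ι ℝ))) i j =
      Real.exp (-(t * c)) * NormedSpace.exp (t • A) i j := by
  have e : t • (A - c • (1 : Matrix ι ι ℝ)) = Matrix.diagonal (fun _ => -(t * c)) + t • A := by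
    ext i j
    simp only [Matrix.smul_apply, Matrix.sub_apply, Matrix.add_apply, Matrix.diagonal_apply,
      Matrix.one_apply, smul_eq_mul]
    split_ifs <;> ring
  have hcomm : Commute (Matrix.diagonal (fun _ : ι => -(t * c))) (t • A) :=
    Matrix.scalar_commute (-(t * c)) (fun r => Commute.all _ r) (t • A)
  rw [e, Matrix.exp_add_of_commute _ _ hcomm, Matrix.exp_diagonal, Matrix.diagonal_mul,
    Pi.coe_exp, ← Real.exp_eq_exp_ℝ]

/-- Uniformisation: `exp (tA) = e^{-tR} exp (t(A + R))`, and the last series has nonnegative terms.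
-/
theorem matrix_exp_nonneg {A : Matrix ι ι ℝ} {R : ℝ} (hA : ∀ i j, 0 ≤ (A + R • 1) i j) {t : ℝ}
    (ht : 0 ≤ t) (i j : ι) : 0 ≤ NormedSpace.exp (t • A) i j := by
  have e : A = (A + R • 1) - R • 1 := by simp
  rw [e, matrix_exp_sub_smul_one]
  refine mul_nonneg (Real.exp_nonneg _) ((hasSum_matrix_exp _ t i j).nonneg fun n => ?_)
  have := matrix_pow_nonneg hA n i j
  positivity

end MatrixExp

section Birth

variable {r : ℕ → ℝ}

/-- Finite propagation: `n` applications of the generator at `x` see only the sites from `x` to `x +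
n`. -/
theorem birthGenerator_iterate_congr (r : ℕ → ℝ) (n : ℕ) {g g' : ℕ → ℝ} {x : ℕ}
    (h : ∀ z, x ≤ z → z ≤ x + n → g z = g' z) :
    (birthGenerator r)^[n] g x = (birthGenerator r)^[n] g' x := by
  induction n generalizing x with
  | zero => exact h x le_rfl le_rfl
  | succ n ih =>
    rw [Function.iterate_succ_apply', Function.iterate_succ_apply', birthGenerator, birthGenerator,
      ih fun z h1 h2 => h z h1 (by omega), ih fun z h1 h2 => h z (by omega) (by omega)]

theorem birthGenerator_iterate_const (r : ℕ → ℝ) (n : ℕ) (b : ℝ) (x : ℕ) :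
    (birthGenerator r)^[n] (fun _ => b) x = if n = 0 then b else 0 := by
  cases n with
  | zero => rfl
  | succ n =>
    have : birthGenerator r (fun _ => b) = fun _ => 0 := by
      ext
      simp [birthGenerator]
    rw [Function.iterate_succ_apply, this, if_neg (Nat.succ_ne_zero n)]
    clear this
    induction n generalizing x with
    | zero => rfl
    | succ n ih => rw [Function.iterate_succ_apply', birthGenerator, ih, ih, sub_self, mul_zero]

theorem birthGenerator_iterate_single_of_lt (r : ℕ → ℝ) (n : ℕ) {x y : ℕ}
    (h : y < x ∨ x + n < y) : (birthGenerator r)^[n] (Pi.single y 1) x = 0 := by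
  rw [birthGenerator_iterate_congr r n (g' := fun _ => 0), birthGenerator_iterate_const]
  · split_ifs <;> rfl
  · intro z h1 h2
    exact Pi.single_eq_of_ne (by omega) _

theorem birthGenerator_iterate_sum (r : ℕ → ℝ) (n : ℕ) (s : Finset ℕ) (g : ℕ → ℕ → ℝ) (x : ℕ) :
    (birthGenerator r)^[n] (fun x => ∑ y ∈ s, g y x) x =
      ∑ y ∈ s, (birthGenerator r)^[n] (g y) x := by
  induction n generalizing x with
  | zero => rfl
  | succ n ih =>
    simp only [Function.iterate_succ_apply', birthGenerator, ih, ← Finset.sum_sub_distrib,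
      Finset.mul_sum]

theorem abs_birthGenerator_iterate_le {R : ℝ} (hr0 : ∀ k, 0 ≤ r k) (hr : ∀ k, r k ≤ R) (n : ℕ)
    {g : ℕ → ℝ} (hg : ∀ z, |g z| ≤ 1) (x : ℕ) :
    |(birthGenerator r)^[n] g x| ≤ (2 * R) ^ n := by
  induction n generalizing x with
  | zero => simpa using hg x
  | succ n ih =>
    have hR : 0 ≤ R := (hr0 0).trans (hr 0)
    rw [Function.iterate_succ_apply', birthGenerator, abs_mul, abs_of_nonneg (hr0 x), pow_succ']
    have h1 := abs_sub ((birthGenerator r)^[n] g (x + 1)) ((birthGenerator r)^[n] g x)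
    have h2 := ih (x + 1)
    have h3 := ih x
    calc _ ≤ R * ((2 * R) ^ n + (2 * R) ^ n) := by
          refine mul_le_mul (hr x) (h1.trans (add_le_add h2 h3)) (abs_nonneg _) hR
      _ = _ := by ring

theorem abs_single_le_one (y z : ℕ) : |(Pi.single y 1 : ℕ → ℝ) z| ≤ 1 := by
  rw [Pi.single_apply]
  split_ifs <;> simp

theorem trunc_birthGenerator_pow (r : ℕ → ℝ) (K n : ℕ) :
    trunc K (fun x y => birthGenerator r (Pi.single y 1) x) ^ n =
      trunc K fun x y => (birthGenerator r)^[n] (Pi.single y 1) x := by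
  induction n with
  | zero =>
    ext x y
    simp [trunc, Matrix.one_apply, Pi.single_apply, Fin.ext_iff]
  | succ n ih =>
    ext x y
    rw [pow_succ', ih, Matrix.mul_apply]
    simp only [trunc, Matrix.of_apply]
    rw [Fin.sum_univ_eq_sum_range (fun z => birthGenerator r (Pi.single z 1) x *
      (birthGenerator r)^[n] (Pi.single (y : ℕ) 1) z) K, Function.iterate_succ_apply',
      birthGenerator]
    simp only [birthGenerator, Pi.single_apply, mul_sub, sub_mul, mul_ite, mul_one, mul_zero,
      ite_mul, zero_mul, Finset.sum_sub_distrib, Finset.sum_ite_eq, Finset.mem_range, x.2, if_true]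
    congr 1
    split_ifs with h
    · rfl
    -- At the edge of the block, `x + 1 = K` is cut off, but nothing leads from there back to `y <
    -- K`.
    · rw [birthGenerator_iterate_single_of_lt r n (Or.inl (by omega)), mul_zero]

theorem birthTransition_eq_exp (r : ℕ → ℝ) (t : ℝ≥0) {K : ℕ} (x y : Fin K) :
    birthTransition r t x y = NormedSpace.exp
      ((t : ℝ) • trunc K (fun x y => birthGenerator r (Pi.single y 1) x)) x y := by
  rw [← (hasSum_matrix_exp _ _ _ _).tsum_eq, birthTransition]
  simp_rw [trunc_birthGenerator_pow]
  rfl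

theorem trunc_birthTransition_nsmul (r : ℕ → ℝ) (t : ℝ≥0) (K m : ℕ) :
    trunc K (birthTransition r (m • t)) = trunc K (birthTransition r t) ^ m := by
  have h : ∀ t, trunc K (birthTransition r t) = NormedSpace.exp
      ((t : ℝ) • trunc K (fun x y => birthGenerator r (Pi.single y 1) x)) := fun t => by
    ext x y
    exact birthTransition_eq_exp r t x y
  rw [h, h, ← Matrix.exp_nsmul, NNReal.coe_nsmul, smul_assoc]

theorem birthTransition_eq_zero (r : ℕ → ℝ) (t : ℝ≥0) (x y : ℕ) (h : y < x) :
    birthTransition r t x y = 0 := by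
  rw [birthTransition]
  refine (tsum_congr fun n => ?_).trans tsum_zero
  rw [birthGenerator_iterate_single_of_lt r n (Or.inl h), mul_zero]

theorem birthTransition_nonneg {R : ℝ} (hr0 : ∀ k, 0 ≤ r k) (hr : ∀ k, r k ≤ R) (t : ℝ≥0)
    (x y : ℕ) : 0 ≤ birthTransition r t x y := by
  have := birthTransition_eq_exp r t (K := x + y + 1) ⟨x, by omega⟩ ⟨y, by omega⟩
  simp only at this
  rw [this]
  refine matrix_exp_nonneg (R := R) (fun i j => ?_) t.2 _ _
  have h1 := hr0 i
  have h2 := hr i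
  simp only [trunc, birthGenerator, Matrix.add_apply, Matrix.of_apply, Matrix.smul_apply,
    Matrix.one_apply, Fin.ext_iff, Pi.single_apply, smul_eq_mul]
  split_ifs <;> first | omega | linarith

/-- With `h = harm a γ` one has `a_x h(x+1)/h(x) = a_x + γ`, so the generator with rates `a + γ` is
`h⁻¹ (Q_a - γ) h`; on finite blocks this is exponentiated. -/
theorem birthTransition_doob {a : ℕ → ℝ} (ha : ∀ k, 0 < a k) {γ : ℝ} (hγ : 0 ≤ γ) (t : ℝ≥0) :
    birthTransition (fun k => a k + γ) t =
      doob (harm a γ) (Real.exp (t * γ)) (birthTransition a t) := by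
  refine eq_of_trunc_eq fun K => ?_
  ext x y
  have hh : ∀ x, harm a γ x ≠ 0 := fun x => (harm_pos ha hγ x).ne'
  set B := trunc K (fun x y => birthGenerator a (Pi.single y 1) x) with hB
  have e : trunc K (fun x y => birthGenerator (fun k => a k + γ) (Pi.single y 1) x) =
      Matrix.of fun x y : Fin K => harm a γ y / (harm a γ x * 1) * (B - γ • 1) x y := by
    ext x y
    have h1 := hh x
    have h2 := (ha x).ne'
    simp only [trunc, hB, birthGenerator, Matrix.sub_apply, Matrix.of_apply, Matrix.smul_apply,
      Matrix.one_apply, Fin.ext_iff, Pi.single_apply, smul_eq_mul]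
    split_ifs with h3 h4 h4
    · omega
    · rw [← h3, harm_succ]
      field_simp
      ring
    · rw [← h4]
      field_simp
      ring
    · ring
  have e2 : trunc K (birthTransition (fun k => a k + γ) t) x y =
      harm a γ y / harm a γ x * NormedSpace.exp ((t : ℝ) • (B - γ • 1)) x y := by
    have h1 := birthTransition_eq_exp (fun k => a k + γ) t x y
    rw [e, ← (hasSum_matrix_exp _ _ _ _).tsum_eq] at h1
    rw [trunc, Matrix.of_apply, h1, ← (hasSum_matrix_exp _ _ _ _).tsum_eq, ← tsum_mul_left]
    refine tsum_congr fun n => ?_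
    rw [doob_pow _ (fun x : Fin K => harm a γ x) (fun x => hh x), one_pow, mul_one]
    ring
  rw [e2, matrix_exp_sub_smul_one, hB, ← birthTransition_eq_exp, trunc, Matrix.of_apply, doob,
    Real.exp_neg]
  have h1 := hh x
  have h2 := (Real.exp_pos (t * γ)).ne'
  field_simp

theorem summable_birth {R : ℝ} (hr0 : ∀ k, 0 ≤ r k) (hr : ∀ k, r k ≤ R) (t : ℝ≥0) {g : ℕ → ℝ}
    (hg : ∀ z, |g z| ≤ 1) (x : ℕ) :
    Summable fun n : ℕ => (t : ℝ) ^ n / (n.factorial : ℝ) * (birthGenerator r)^[n] g x := by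
  refine Summable.of_norm_bounded (Real.summable_pow_div_factorial (t * (2 * R))) fun n => ?_
  rw [Real.norm_eq_abs, abs_mul, abs_of_nonneg (by positivity), mul_pow, mul_div_right_comm]
  gcongr
  exact abs_birthGenerator_iterate_le hr0 hr n hg x

/-- By finite propagation the `n`-th term of the exponential series applied to the indicator of `[0,
K)` agrees, once `K > x + n`, with that for the constant 1; dominated convergence concludes. -/
theorem tendsto_sum_birthTransition {R : ℝ} (hr0 : ∀ k, 0 ≤ r k) (hr : ∀ k, r k ≤ R) (t : ℝ≥0)
    (x : ℕ) : Tendsto (fun K => ∑ y ∈ Finset.range K, birthTransition r t x y) atTop (𝓝 1) := by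
  set f : ℕ → ℕ → ℝ := fun K z => ∑ y ∈ Finset.range K, (Pi.single y 1 : ℕ → ℝ) z with hf
  have hfz : ∀ K z, f K z = if z < K then 1 else 0 := fun K z => by
    simp [hf, Pi.single_apply]
  have hf1 : ∀ K z, |f K z| ≤ 1 := fun K z => by
    rw [hfz]
    split_ifs <;> simp
  have e1 : ∀ K, ∑ y ∈ Finset.range K, birthTransition r t x y =
      ∑' n : ℕ, (t : ℝ) ^ n / (n.factorial : ℝ) * (birthGenerator r)^[n] (f K) x := by
    intro K
    simp only [birthTransition]
    rw [← Summable.tsum_finsetSum fun y _ => summable_birth hr0 hr t (abs_single_le_one y) x]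
    refine tsum_congr fun n => ?_
    rw [hf, birthGenerator_iterate_sum, Finset.mul_sum]
  have e2 : (1 : ℝ) = ∑' n : ℕ, (if n = 0 then (1 : ℝ) else 0) :=
    (tsum_ite_eq 0 fun _ => (1 : ℝ)).symm
  simp_rw [e1]
  rw [e2]
  refine tendsto_tsum_of_dominated_convergence (Real.summable_pow_div_factorial (t * (2 * R)))
    (fun n => ?_) (Eventually.of_forall fun K n => ?_)
  · refine tendsto_const_nhds.congr' ?_
    filter_upwards [eventually_gt_atTop (x + n)] with K hK
    rw [birthGenerator_iterate_congr r n (g' := fun _ => 1), birthGenerator_iterate_const]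
    · split_ifs with h
      · simp [h]
      · rw [mul_zero]
    · intro z _ h2
      rw [hfz, if_pos (by omega)]
  · rw [Real.norm_eq_abs, abs_mul, abs_of_nonneg (by positivity), mul_pow, mul_div_right_comm]
    gcongr
    exact abs_birthGenerator_iterate_le hr0 hr n (hf1 K) x

theorem birthTransition_self (r : ℕ → ℝ) (t : ℝ≥0) (x : ℕ) :
    birthTransition r t x x = Real.exp (-(t * r x)) := by
  have h : ∀ n, (birthGenerator r)^[n] (Pi.single x 1) x = (-r x) ^ n := by
    intro n
    induction n with
    | zero => simp
    | succ n ih =>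
      rw [Function.iterate_succ_apply', birthGenerator, ih,
        birthGenerator_iterate_single_of_lt r n (Or.inl (Nat.lt_succ_self x))]
      ring
  rw [birthTransition, Real.exp_eq_exp_ℝ, NormedSpace.exp_eq_tsum_div]
  refine tsum_congr fun n => ?_
  rw [h, ← mul_neg, mul_pow]
  ring

/-- Jumps of size `d` in time `t` have probability of order `t ^ d`. -/
theorem birthTransition_le {R : ℝ} (hr0 : ∀ k, 0 ≤ r k) (hr : ∀ k, r k ≤ R) {t : ℝ≥0}
    (ht : t ≤ 1) (x y : ℕ) :
    |birthTransition r t x y| ≤ Real.exp (2 * R) * (t : ℝ) ^ (y - x) := by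
  have hR : 0 ≤ R := (hr0 0).trans (hr 0)
  have ht' : (t : ℝ) ≤ 1 := ht
  have hs : HasSum (fun n : ℕ => (2 * R) ^ n / (n.factorial : ℝ) * (t : ℝ) ^ (y - x))
      (Real.exp (2 * R) * (t : ℝ) ^ (y - x)) := by
    rw [Real.exp_eq_exp_ℝ]
    exact (NormedSpace.expSeries_div_hasSum_exp (2 * R)).mul_right _
  rw [← Real.norm_eq_abs, birthTransition]
  refine tsum_of_norm_bounded hs fun n => ?_
  rw [Real.norm_eq_abs, abs_mul, abs_of_nonneg (by positivity : (0 : ℝ) ≤ t ^ n / n.factorial)]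
  -- Terms with `n < y - x` vanish by finite propagation; the others have `t ^ n ≤ t ^ (y - x)`.
  by_cases hn : x + n < y
  · rw [birthGenerator_iterate_single_of_lt r n (Or.inr hn), abs_zero, mul_zero]
    positivity
  · have h1 : (t : ℝ) ^ n ≤ (t : ℝ) ^ (y - x) := pow_le_pow_of_le_one t.2 ht' (by omega)
    have h2 := abs_birthGenerator_iterate_le hr0 hr n (abs_single_le_one y) x
    calc (t : ℝ) ^ n / n.factorial * |(birthGenerator r)^[n] (Pi.single y 1) x|
        ≤ (t : ℝ) ^ (y - x) / n.factorial * (2 * R) ^ n := by gcongr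
      _ = _ := by ring

end Birth

end CondWalks

namespace CondWalks

/-! ### The Karlin–McGregor determinant as a limit of interlaced products -/

section Powers

/-- Telescoping. The hypotheses are asymmetric because `x` will be a substochastic matrix, while for
the compound matrix `y` only bounds on the powers are at hand. -/
theorem norm_pow_sub_pow_le {A : Type*} [SeminormedRing A] {x y : A} {B : ℝ} (hx : ‖x‖ ≤ 1)
    (hy : ∀ k, ‖y ^ k‖ ≤ B) (m : ℕ) : ‖x ^ m - y ^ m‖ ≤ m * (‖x - y‖ * B) := by
  induction m with
  | zero => simp
  | succ m ih =>
    have e : x ^ (m + 1) - y ^ (m + 1) = x * (x ^ m - y ^ m) + (x - y) * y ^ m := by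
      rw [pow_succ', pow_succ', mul_sub, sub_mul]
      abel
    rw [e]
    calc _ ≤ ‖x‖ * ‖x ^ m - y ^ m‖ + ‖x - y‖ * ‖y ^ m‖ :=
          (norm_add_le _ _).trans (add_le_add (norm_mul_le _ _) (norm_mul_le _ _))
      _ ≤ 1 * (m * (‖x - y‖ * B)) + ‖x - y‖ * B := by
          gcongr
          exact hy m
      _ = _ := by push_cast; ring

open scoped Matrix.Norms.Operator

theorem matrix_norm_le {ι : Type*} [Fintype ι] {A : Matrix ι ι ℝ} {r : ℝ} (hr : 0 ≤ r)
    (h : ∀ i, ∑ j, |A i j| ≤ r) : ‖A‖ ≤ r := by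
  rw [Matrix.linfty_opNorm_def]
  lift r to ℝ≥0 using hr
  rw [NNReal.coe_le_coe]
  refine Finset.sup_le fun i _ => ?_
  rw [← NNReal.coe_le_coe]
  push_cast
  exact h i

theorem abs_apply_le_matrix_norm {ι : Type*} [Fintype ι] (A : Matrix ι ι ℝ) (i j : ι) :
    |A i j| ≤ ‖A‖ := by
  rw [Matrix.linfty_opNorm_def]
  have h1 : ∑ j, ‖A i j‖₊ ≤ Finset.univ.sup fun i => ∑ j, ‖A i j‖₊ :=
    Finset.le_sup (f := fun i => ∑ j, ‖A i j‖₊) (Finset.mem_univ i)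
  have h2 : ‖A i j‖₊ ≤ ∑ j, ‖A i j‖₊ :=
    Finset.single_le_sum (f := fun j => ‖A i j‖₊) (fun _ _ => zero_le) (Finset.mem_univ j)
  exact_mod_cast h2.trans h1

/-- `m` steps with an error `O(m⁻²)` each accumulate to `O(m⁻¹)`. -/
theorem tendsto_matrix_pow {ι : Type*} [Fintype ι] [DecidableEq ι] {x y : ℕ → Matrix ι ι ℝ}
    {B C : ℝ} (hx : ∀ m i, ∑ j, |x m i j| ≤ 1) (hy : ∀ m k i j, |(y m ^ k) i j| ≤ B)
    (hxy : ∀ᶠ m : ℕ in atTop, ∀ i j, |x m i j - y m i j| ≤ C / (m : ℝ) ^ 2)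
    {z : ι → ι → ℝ} (hz : ∀ᶠ m : ℕ in atTop, ∀ i j, (y m ^ m) i j = z i j) (i j : ι) :
    Tendsto (fun m => (x m ^ m) i j) atTop (𝓝 (z i j)) := by
  have hB : 0 ≤ B := (abs_nonneg _).trans (hy 0 0 i j)
  set n : ℝ := ((Fintype.card ι : ℕ) : ℝ)
  have key : ∀ᶠ m : ℕ in atTop, |(x m ^ m) i j - z i j| ≤ n * C * (n * B) / m := by
    filter_upwards [hxy, hz, eventually_gt_atTop 0] with m h1 h2 hm
    have hm' : (0 : ℝ) < m := Nat.cast_pos.2 hm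
    have hC : 0 ≤ C / (m : ℝ) ^ 2 := (abs_nonneg _).trans (h1 i j)
    have h3 : ‖x m‖ ≤ 1 := matrix_norm_le zero_le_one (hx m)
    have h4 : ∀ k, ‖y m ^ k‖ ≤ n * B := fun k => by
      refine matrix_norm_le (by positivity) fun i => ?_
      refine (Finset.sum_le_card_nsmul _ _ B fun j _ => hy m k i j).trans_eq ?_
      rw [nsmul_eq_mul, Finset.card_univ]
    have h5 : ‖x m - y m‖ ≤ n * (C / (m : ℝ) ^ 2) := by
      refine matrix_norm_le (by positivity) fun i => ?_
      refine (Finset.sum_le_card_nsmul _ _ (C / (m : ℝ) ^ 2) fun j _ => h1 i j).trans_eq ?_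
      rw [nsmul_eq_mul, Finset.card_univ]
    have h6 := abs_apply_le_matrix_norm (x m ^ m - y m ^ m) i j
    rw [Matrix.sub_apply, h2] at h6
    calc _ ≤ _ := h6
      _ ≤ m * (‖x m - y m‖ * (n * B)) := norm_pow_sub_pow_le h3 h4 m
      _ ≤ m * (n * (C / (m : ℝ) ^ 2) * (n * B)) := by gcongr
      _ = _ := by field_simp
  rw [tendsto_iff_norm_sub_tendsto_zero]
  refine squeeze_zero' (Eventually.of_forall fun _ => norm_nonneg _) key ?_
  exact tendsto_const_div_atTop_nhds_zero_nat _

end Powers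

theorem sum_prod_le_one {N K : ℕ} {A : ℕ → ℕ → ℝ} (h0 : ∀ x y, 0 ≤ A x y)
    (h1 : ∀ x K, ∑ y ∈ Finset.range K, A x y ≤ 1) (z : Fin N → ℕ) :
    ∑ e : Cfg N (Fin K), ∏ i, A (z i) (e.toNat i) ≤ 1 := by
  calc ∑ e : Cfg N (Fin K), ∏ i, A (z i) (e.toNat i)
      ≤ ∑ f : Fin N → Fin K, ∏ i, A (z i) (f i) := by
        refine (Finset.sum_map Finset.univ (Function.Embedding.subtype _) (fun f : Fin N → Fin K =>
          ∏ i, A (z i) (f i))).symm.trans_le ?_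
        exact Finset.sum_le_sum_of_subset_of_nonneg (Finset.subset_univ _) fun f _ _ =>
          Finset.prod_nonneg fun i _ => h0 _ _
    _ = ∏ i, ∑ y : Fin K, A (z i) y := by
        rw [Finset.prod_univ_sum, Fintype.piFinset_univ]
    _ ≤ 1 := by
        refine Finset.prod_le_one (fun i _ => Finset.sum_nonneg fun _ _ => h0 _ _) fun i _ => ?_
        rw [Fin.sum_univ_eq_sum_range (fun y => A (z i) y)]
        exact h1 _ _

theorem abs_det_le {N : ℕ} {M : Matrix (Fin N) (Fin N) ℝ} {b : ℝ}
    (h : ∀ σ : Equiv.Perm (Fin N), |∏ i, M i (σ i)| ≤ b) : |M.det| ≤ (N.factorial : ℝ) * b := by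
  rw [← Matrix.det_transpose, Matrix.det_apply']
  refine (Finset.abs_sum_le_sum_abs _ _).trans ?_
  refine (Finset.sum_le_card_nsmul _ _ b fun σ _ => ?_).trans_eq ?_
  · rw [abs_mul, ← Int.cast_abs, Int.isUnit_iff_abs_eq.1 (Units.isUnit _), Int.cast_one, one_mul]
    exact h σ
  · rw [nsmul_eq_mul, Finset.card_univ, Fintype.card_perm, Fintype.card_fin]

theorem det_eq_prod_of_interlace {N : ℕ} {A : ℕ → ℕ → ℝ} (hA : ∀ x y, y < x → A x y = 0)
    {z w : Fin N → ℕ} (hz : StrictMono z) (h : Interlace z w) :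
    (Matrix.of fun i j => A (z i) (w j)).det = ∏ i, A (z i) (w i) := by
  refine det_eq_prod_of_forall_perm fun σ hσ => ?_
  obtain ⟨i, k, hik, hk, -⟩ := exists_crossing hσ
  exact ⟨k, hA _ _ (by rw [hk]; exact lt_of_interlace h hz hik)⟩

/-- The total displacement does not depend on `σ`. For `σ = 1`, a violation `z_{i+1} ≤ w_i` forces
both walkers `i` and `i + 1` to move. -/
theorem two_le_sum_of_not_interlace {N : ℕ} {z w : Fin N → ℕ} (hz : StrictMono z)
    (hw : StrictMono w) (h : ¬ Interlace z w) {σ : Equiv.Perm (Fin N)}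
    (hσ : ∀ i, z i ≤ w (σ i)) : 2 ≤ ∑ i, (w (σ i) - z i) := by
  have hle := le_of_perm_le hz hw hσ
  have h1 : ∑ i, (w (σ i) - z i) + ∑ i, z i = ∑ i, (w i - z i) + ∑ i, z i := by
    rw [← Finset.sum_add_distrib, ← Finset.sum_add_distrib]
    simp only [Nat.sub_add_cancel (hσ _), Nat.sub_add_cancel (hle _)]
    exact Equiv.sum_comp σ w
  rw [Nat.add_right_cancel h1]
  have h2 : ∃ i j : Fin N, (i : ℕ) + 1 = j ∧ z j ≤ w i := by
    by_contra! hc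
    exact h ⟨hle, hc⟩
  obtain ⟨i, j, hij, hzw⟩ := h2
  have hlt : i < j := by rw [Fin.lt_def]; omega
  have h3 := Finset.sum_le_sum_of_subset (f := fun i => w i - z i)
    (Finset.subset_univ ({i, j} : Finset (Fin N)))
  rw [Finset.sum_pair hlt.ne] at h3
  have h4 := hz hlt
  have h5 := hw hlt
  omega

section Birth

variable {a : ℕ → ℝ} {R : ℝ}

theorem sum_birthTransition_le_one (ha0 : ∀ k, 0 ≤ a k) (haR : ∀ k, a k ≤ R) (t : ℝ≥0)
    (x K : ℕ) : ∑ y ∈ Finset.range K, birthTransition a t x y ≤ 1 := by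
  refine Monotone.ge_of_tendsto ?_ (tendsto_sum_birthTransition ha0 haR t x) K
  intro K K' hK
  exact Finset.sum_le_sum_of_subset_of_nonneg (Finset.range_mono hK)
    fun _ _ _ => birthTransition_nonneg ha0 haR _ _ _

theorem abs_birthTransition_le_one (ha0 : ∀ k, 0 ≤ a k) (haR : ∀ k, a k ≤ R) (t : ℝ≥0)
    (x y : ℕ) : |birthTransition a t x y| ≤ 1 := by
  rw [abs_of_nonneg (birthTransition_nonneg ha0 haR _ _ _)]
  refine le_trans ?_ (sum_birthTransition_le_one ha0 haR t x (y + 1))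
  exact Finset.single_le_sum (fun y _ => birthTransition_nonneg ha0 haR t x y)
    (Finset.mem_range.2 (Nat.lt_succ_self y))

/-- Each unit of displacement costs a factor `t`, and a step that is not interlaced needs at least
two. -/
theorem abs_det_birthTransition_le (ha0 : ∀ k, 0 ≤ a k) (haR : ∀ k, a k ≤ R) {t : ℝ≥0}
    (ht : t ≤ 1) {N : ℕ} {z w : Fin N → ℕ} (hz : StrictMono z) (hw : StrictMono w)
    (h : ¬ Interlace z w) :
    |(Matrix.of fun i j => birthTransition a t (z i) (w j)).det| ≤
      (N.factorial : ℝ) * (Real.exp (2 * R) ^ N * (t : ℝ) ^ 2) := by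
  refine abs_det_le fun σ => ?_
  by_cases hσ : ∀ i, z i ≤ w (σ i)
  · rw [Finset.abs_prod]
    calc ∏ i, |(Matrix.of fun i j => birthTransition a t (z i) (w j)) i (σ i)|
        ≤ ∏ i, Real.exp (2 * R) * (t : ℝ) ^ (w (σ i) - z i) :=
          Finset.prod_le_prod (fun _ _ => abs_nonneg _) fun i _ => birthTransition_le ha0 haR ht _ _
      _ = Real.exp (2 * R) ^ N * (t : ℝ) ^ ∑ i, (w (σ i) - z i) := by
          rw [Finset.prod_mul_distrib, Finset.prod_pow_eq_pow_sum, Finset.prod_const,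
            Finset.card_univ, Fintype.card_fin]
      _ ≤ _ := by
          refine mul_le_mul_of_nonneg_left ?_ (by positivity)
          exact pow_le_pow_of_le_one t.2 ht (two_le_sum_of_not_interlace hz hw h hσ)
  · push Not at hσ
    obtain ⟨i, hi⟩ := hσ
    rw [Finset.prod_eq_zero (Finset.mem_univ i) (birthTransition_eq_zero a t _ _ hi), abs_zero]
    positivity

/-- The interlaced product kernel of step `d/m` is compared with the compound matrix of that step,
whose `m`-th power is exactly the determinant at time `d`. They agree on interlaced pairs and differ
by `O(m⁻²)` elsewhere. -/
theorem tendsto_interlaced_pow (ha0 : ∀ k, 0 ≤ a k) (haR : ∀ k, a k ≤ R) {N K : ℕ}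
    [∀ z w : Fin N → ℕ, Decidable (Interlace z w)] (d : ℝ≥0) (e e' : Cfg N (Fin K)) :
    Tendsto (fun m : ℕ => (cfgMatrix K (fun z w : Fin N → ℕ =>
      if Interlace z w then ∏ i, birthTransition a (d / m) (z i) (w i) else 0) ^ m) e e') atTop
      (𝓝 (Matrix.of fun i j => birthTransition a d (e.toNat i) (e'.toNat j)).det) := by
  have h0 := birthTransition_nonneg ha0 haR
  refine tendsto_matrix_pow
    (y := fun m => compound N (trunc K (birthTransition a (d / m))))
    (B := (N.factorial : ℝ) * 1)
    (C := (N.factorial : ℝ) * Real.exp (2 * R) ^ N * (d : ℝ) ^ 2)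
    (z := fun e e' => (Matrix.of fun i j => birthTransition a d (e.toNat i) (e'.toNat j)).det)
    (fun m e => ?_) (fun m k e e' => ?_) ?_ ?_ e e'
  · refine le_trans (Finset.sum_le_sum fun e' _ => ?_) (sum_prod_le_one (h0 (d / m))
      (sum_birthTransition_le_one ha0 haR _) e.toNat)
    have := Finset.prod_nonneg fun i (_ : i ∈ Finset.univ) =>
      h0 (d / m) (e.toNat i) (e'.toNat i)
    rw [cfgMatrix, Matrix.of_apply]
    split_ifs
    · exact (abs_of_nonneg this).le
    · rwa [abs_zero]
  · rw [← compound_pow, ← trunc_birthTransition_nsmul]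
    refine abs_det_le fun σ => ?_
    rw [Finset.abs_prod]
    exact Finset.prod_le_one (fun _ _ => abs_nonneg _) fun _ _ =>
      abs_birthTransition_le_one ha0 haR _ _ _
  · obtain ⟨m₀, hm₀⟩ := exists_nat_ge d
    filter_upwards [eventually_ge_atTop m₀, eventually_gt_atTop 0] with m hm hm0 e e'
    have ht : d / m ≤ 1 := by
      rw [div_le_one (by exact_mod_cast hm0)]
      exact hm₀.trans (by exact_mod_cast hm)
    have e1 : compound N (trunc K (birthTransition a (d / m))) e e' =
        (Matrix.of fun i j => birthTransition a (d / m) (e.toNat i) (e'.toNat j)).det := rfl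
    rw [e1, cfgMatrix, Matrix.of_apply]
    split_ifs with hI
    · rw [det_eq_prod_of_interlace (birthTransition_eq_zero a _) e.toNat_strictMono hI, sub_self,
        abs_zero]
      positivity
    · rw [zero_sub, abs_neg]
      refine (abs_det_birthTransition_le ha0 haR ht e.toNat_strictMono e'.toNat_strictMono
        hI).trans_eq ?_
      push_cast
      ring
  · filter_upwards [eventually_gt_atTop 0] with m hm e e'
    have hd : m • (d / m) = d := by
      rw [nsmul_eq_mul, mul_div_cancel₀]
      exact_mod_cast hm.ne'
    rw [← compound_pow, ← trunc_birthTransition_nsmul, hd]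
    rfl

end Birth

end CondWalks

namespace CondWalks

/-! ### Collisions of càdlàg paths -/

section Paths

variable {N : ℕ} {p : ℝ≥0 → Fin N → ℕ}

theorem interlace_self {z : Fin N → ℕ} (hz : StrictMono z) : Interlace z z :=
  ⟨fun _ => le_rfl, fun i j hij => hz (by rw [Fin.lt_def]; omega)⟩

/-- Near `r`, a càdlàg path takes only the values `p (r-)` and `p r`. -/
theorem IsCadlag.exists_ball (hp : IsCadlag p) (r : ℝ≥0) : ∃ ε > 0,
    (∀ u ∈ Metric.ball r ε, u < r → p u = Function.leftLim p r) ∧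
      ∀ u ∈ Metric.ball r ε, r ≤ u → p u = p r := by
  obtain ⟨h1, l, h2⟩ := hp r
  have e1 : ∀ᶠ u in 𝓝[<] r, p u = Function.leftLim p r := by
    by_cases hr : 𝓝[<] r = ⊥
    · rw [hr]
      exact eventually_bot
    · have : (𝓝[<] r).NeBot := ⟨hr⟩
      rw [leftLim_eq_of_tendsto h2]
      rw [nhds_discrete, tendsto_pure] at h2
      exact h2
  have e2 : ∀ᶠ u in 𝓝[≥] r, p u = p r := by
    have h3 : Tendsto p (𝓝[≥] r) (𝓝 (p r)) := h1
    rw [nhds_discrete, tendsto_pure] at h3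
    exact h3
  rw [eventually_nhdsWithin_iff] at e1 e2
  obtain ⟨ε, hε, h⟩ := Metric.eventually_nhds_iff_ball.1 (e1.and e2)
  exact ⟨ε, hε, fun u hu => (h u hu).1, fun u hu => (h u hu).2⟩

theorem eventually_div_lt (d : ℝ≥0) {ε : ℝ} (hε : 0 < ε) :
    ∀ᶠ m : ℕ in atTop, ((d / m : ℝ≥0) : ℝ) < ε := by
  have h := tendsto_const_div_atTop_nhds_zero_nat (d : ℝ)
  filter_upwards [h.eventually_lt_const hε] with m hm
  simpa using hm

/-- The path has no collision along the partition of `[s, s + d]` into `m` intervals. -/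
def NoCollisionOnGrid (p : ℝ≥0 → Fin N → ℕ) (s d : ℝ≥0) (m : ℕ) : Prop :=
  ∀ k < m, StrictMono (p (s + k • (d / m))) ∧
    Interlace (p (s + k • (d / m))) (p (s + (k + 1) • (d / m)))

theorem nsmul_div_self (d : ℝ≥0) {m : ℕ} (hm : 0 < m) : m • (d / m) = d := by
  rw [nsmul_eq_mul, mul_div_cancel₀]
  exact_mod_cast hm.ne'

theorem nsmul_div_le (d : ℝ≥0) {k m : ℕ} (hk : k ≤ m) : k • (d / m) ≤ d := by
  rcases Nat.eq_zero_or_pos m with hm | hm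
  · obtain rfl : k = 0 := by omega
    rw [zero_smul]
    exact zero_le
  · exact (nsmul_le_nsmul_left zero_le hk).trans_eq (nsmul_div_self d hm)

/-- Once the mesh is below a Lebesgue number of the cover by the balls of `exists_ball`, the values
at two neighbouring grid points are either equal or the pair `p (r-)`, `p r` for some `r`. -/
theorem IsCadlag.eventually_noCollisionOnGrid (hp : IsCadlag p) {s d : ℝ≥0}
    (hs : StrictMono (p s))
    (h : ∀ r, s < r → r ≤ s + d → Interlace (Function.leftLim p r) (p r)) :
    ∀ᶠ m in atTop, NoCollisionOnGrid p s d m := by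
  choose ε hε hl hr using hp.exists_ball
  obtain ⟨δ, hδ, hball⟩ := lebesgue_number_lemma_of_metric (isCompact_Icc (a := s) (b := s + d))
    (c := fun r => Metric.ball r (ε r)) (fun r => Metric.isOpen_ball)
    (fun r _ => Set.mem_iUnion.2 ⟨r, Metric.mem_ball_self (hε r)⟩)
  have hmono : ∀ r, s ≤ r → r ≤ s + d → StrictMono (p r) := fun r h1 h2 => by
    rcases h1.eq_or_lt with h3 | h3
    · rwa [← h3]
    · exact (h r h3 h2).strictMono
  filter_upwards [eventually_div_lt d hδ] with m hm k hk
  have hu : s ≤ s + k • (d / m) := le_self_add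
  have hv : s + (k + 1) • (d / m) ≤ s + d := add_le_add_right (nsmul_div_le d hk) s
  have huv : s + (k + 1) • (d / m) = s + k • (d / m) + d / m := by rw [succ_nsmul, add_assoc]
  have hle : s + k • (d / m) ≤ s + (k + 1) • (d / m) := huv ▸ le_self_add
  have hdist : s + (k + 1) • (d / m) ∈ Metric.ball (s + k • (d / m)) δ := by
    rw [Metric.mem_ball, huv, NNReal.dist_eq]
    push_cast
    rw [add_sub_cancel_left, abs_of_nonneg (by positivity)]
    simpa using hm
  set u := s + k • (d / m)
  set v := s + (k + 1) • (d / m)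
  obtain ⟨r, hr'⟩ := hball u ⟨hu, hle.trans hv⟩
  have h1 := hr' (Metric.mem_ball_self hδ)
  have h2 := hr' hdist
  refine ⟨hmono u hu (hle.trans hv), ?_⟩
  rcases lt_or_ge u r with hur | hur
  · rcases lt_or_ge v r with hvr | hvr
    · rw [hl r v h2 hvr, ← hl r u h1 hur]
      exact interlace_self (hmono u hu (hle.trans hv))
    · rw [hl r u h1 hur, hr r v h2 hvr]
      exact h r (hu.trans_lt hur) (hvr.trans hv)
  · rw [hr r v h2 (hur.trans hle), ← hr r u h1 hur]
    exact interlace_self (hmono u hu (hle.trans hv))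

/-- On a fine grid the last point before `r` and the first point from `r` on carry the values `p
(r-)` and `p r`, so the grid sees the collision. -/
theorem IsCadlag.eventually_not_noCollisionOnGrid (hp : IsCadlag p) {s d r : ℝ≥0} (hr : s < r)
    (hrd : r ≤ s + d) (h : ¬ Interlace (Function.leftLim p r) (p r)) :
    ∀ᶠ m in atTop, ¬ NoCollisionOnGrid p s d m := by
  obtain ⟨ε, hε, h1, h2⟩ := hp.exists_ball r
  filter_upwards [eventually_div_lt d hε, eventually_gt_atTop 0] with m hm hm0 hgrid
  have hex : ∃ j : ℕ, r ≤ s + j • (d / m) := ⟨m, by rwa [nsmul_div_self d hm0]⟩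
  classical
  obtain ⟨k, hk⟩ : ∃ k, Nat.find hex = k + 1 := by
    refine Nat.exists_eq_succ_of_ne_zero fun h0 => ?_
    have := Nat.find_spec hex
    rw [h0, zero_smul, add_zero] at this
    exact absurd this (not_le.2 hr)
  have hv : r ≤ s + (k + 1) • (d / m) := hk ▸ Nat.find_spec hex
  have hu : s + k • (d / m) < r := not_le.1 (Nat.find_min hex (by omega))
  have hkm : k < m := by
    have := Nat.find_le (h := hex) (n := m) (by rwa [nsmul_div_self d hm0])
    omega
  have huv : s + (k + 1) • (d / m) = s + k • (d / m) + d / m := by rw [succ_nsmul, add_assoc]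
  have h3 := (hgrid k hkm).2
  set u := s + k • (d / m)
  set v := s + (k + 1) • (d / m)
  have huv' : (v : ℝ) = u + (d / m : ℝ≥0) := by rw [huv, NNReal.coe_add]
  have hv' : (r : ℝ) ≤ v := hv
  have hu' : (u : ℝ) < r := hu
  rw [h1 u (by rw [Metric.mem_ball, NNReal.dist_eq, abs_lt]; constructor <;> linarith) hu,
    h2 v (by rw [Metric.mem_ball, NNReal.dist_eq, abs_lt]; constructor <;> linarith) hv] at h3
  exact h h3

end Paths

end CondWalks

namespace CondWalks

/-! ### Pure-birth chains -/

section Birth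

variable {a : ℕ → ℝ} {R : ℝ} {N : ℕ}

/-- The determinant is a limit of powers of nonnegative matrices which are dominated by products of
one-walk kernels. -/
theorem det_birthTransition_bounds (ha0 : ∀ k, 0 ≤ a k) (haR : ∀ k, a k ≤ R) (d : ℝ≥0)
    {z y : Fin N → ℕ} (hz : StrictMono z) (hy : StrictMono y) :
    0 ≤ (Matrix.of fun i j => birthTransition a d (z i) (y j)).det ∧
      (Matrix.of fun i j => birthTransition a d (z i) (y j)).det ≤
        ∏ i, birthTransition a d (z i) (y i) := by
  classical
  have h0 := birthTransition_nonneg ha0 haR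
  obtain ⟨K₁, hK₁⟩ := exists_forall_lt z
  obtain ⟨K₂, hK₂⟩ := exists_forall_lt y
  obtain ⟨e, rfl⟩ := Cfg.exists_toNat_eq (K := max K₁ K₂) hz
    fun i => (hK₁ i).trans_le (le_max_left _ _)
  obtain ⟨e', rfl⟩ := Cfg.exists_toNat_eq (K := max K₁ K₂) hy
    fun i => (hK₂ i).trans_le (le_max_right _ _)
  have hlim := tendsto_interlaced_pow ha0 haR d e e'
  have hP : ∀ (t : ℝ≥0) (z w : Fin N → ℕ), 0 ≤ ∏ i, birthTransition a t (z i) (w i) :=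
    fun t z w => Finset.prod_nonneg fun i _ => h0 t _ _
  have hI : ∀ (m : ℕ) (e e' : Cfg N (Fin (max K₁ K₂))),
      0 ≤ cfgMatrix _ (fun z w : Fin N → ℕ =>
        if Interlace z w then ∏ i, birthTransition a (d / m) (z i) (w i) else 0) e e' := by
    intro m e e'
    rw [cfgMatrix, Matrix.of_apply]
    split_ifs
    exacts [hP _ _ _, le_rfl]
  refine ⟨ge_of_tendsto' hlim fun m => matrix_pow_nonneg (hI m) m e e', le_of_tendsto hlim ?_⟩
  filter_upwards [eventually_gt_atTop 0] with m hm
  refine (pow_le_prod (P := fun _ => trunc _ (birthTransition a (d / m))) (hI m)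
    (fun _ x y => h0 _ _ _) (fun e e' => ?_) m e e').trans_eq ?_
  · rw [cfgMatrix, Matrix.of_apply]
    split_ifs
    exacts [le_rfl, hP _ _ _]
  · refine Finset.prod_congr rfl fun i _ => ?_
    rw [← trunc_birthTransition_nsmul, nsmul_div_self d hm]
    rfl

theorem tendsto_interlaced_doob_pow (ha0 : ∀ k, 0 ≤ a k) (haR : ∀ k, a k ≤ R) {K : ℕ}
    {h : Fin N → ℕ → ℝ} (hh : ∀ i x, h i x ≠ 0) (γ : Fin N → ℝ)
    [hd : ∀ z w : Fin N → ℕ, Decidable (StrictMono z ∧ Interlace z w)] (d : ℝ≥0)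
    (e e' : Cfg N (Fin K)) :
    Tendsto (fun m : ℕ => (cfgMatrix K (fun z w : Fin N → ℕ =>
      if StrictMono z ∧ Interlace z w then
        ∏ i, doob (h i) (Real.exp ((d / m : ℝ≥0) * γ i)) (birthTransition a (d / m)) (z i) (w i)
      else 0) ^ m) e e') atTop
      (𝓝 (killed h (fun i => Real.exp (d * γ i)) (birthTransition a d) e.toNat e'.toNat)) := by
  classical
  refine ((tendsto_interlaced_pow ha0 haR d e e').const_mul _).congr' ?_
  filter_upwards [eventually_gt_atTop 0] with m hm
  have e1 : cfgMatrix K (fun z w : Fin N → ℕ => if StrictMono z ∧ Interlace z w then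
        ∏ i, doob (h i) (Real.exp ((d / m : ℝ≥0) * γ i)) (birthTransition a (d / m)) (z i) (w i)
      else 0) = Matrix.of fun e e' : Cfg N (Fin K) =>
        (∏ i, h i (e'.toNat i)) / ((∏ i, h i (e.toNat i)) *
          ∏ i, Real.exp ((d / m : ℝ≥0) * γ i)) * cfgMatrix K (fun z w : Fin N → ℕ =>
            if Interlace z w then ∏ i, birthTransition a (d / m) (z i) (w i) else 0) e e' := by
    ext e e'
    simp only [cfgMatrix, Matrix.of_apply, e.toNat_strictMono, true_and]
    split_ifs
    · rw [prod_doob, Finset.prod_div_distrib, Finset.prod_mul_distrib]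
    · rw [mul_zero]
  have e2 : (∏ i, Real.exp ((d / m : ℝ≥0) * γ i)) ^ m = ∏ i, Real.exp (d * γ i) := by
    rw [← Finset.prod_pow]
    refine Finset.prod_congr rfl fun i _ => ?_
    have hm' : (m : ℝ) ≠ 0 := Nat.cast_ne_zero.2 hm.ne'
    rw [← Real.exp_nat_mul]
    congr 1
    push_cast
    field_simp
  rw [e1, doob_pow _ (fun e : Cfg N (Fin K) => ∏ i, h i (e.toNat i))
    (fun e => Finset.prod_ne_zero_iff.2 fun i _ => hh i _), e2, ← Finset.prod_mul_distrib,
    ← Finset.prod_div_distrib]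

theorem eventually_noCollisionOnGrid_iff {p : ℝ≥0 → Fin N → ℕ} (hp : IsCadlag p) {s : ℝ≥0}
    (hs : StrictMono (p s)) (d : ℝ≥0) :
    ∀ᶠ m in atTop, NoCollisionOnGrid p s d m ↔
      ∀ r, s < r → r ≤ s + d → Interlace (Function.leftLim p r) (p r) := by
  by_cases h : ∀ r, s < r → r ≤ s + d → Interlace (Function.leftLim p r) (p r)
  · filter_upwards [hp.eventually_noCollisionOnGrid hs h] with m hm
    exact iff_of_true hm h
  · have h' := h
    push Not at h'
    obtain ⟨r, h1, h2, h3⟩ := h'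
    filter_upwards [hp.eventually_not_noCollisionOnGrid h1 h2 h3] with m hm
    exact iff_of_false hm h

theorem measurableSet_noCollisionOnGrid {Ω : Type*} (X : ℝ≥0 → Ω → Fin N → ℕ) (t d : ℝ≥0) (m : ℕ) :
    MeasurableSet[past X (t + d)] {ω | NoCollisionOnGrid (fun t => X t ω) t d m} := by
  have : {ω | NoCollisionOnGrid (fun t => X t ω) t d m} = ⋂ k, ⋂ (_ : k < m),
      {ω | StrictMono (X (t + k • (d / m)) ω) ∧
        Interlace (X (t + k • (d / m)) ω) (X (t + (k + 1) • (d / m)) ω)} := by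
    ext
    simp [NoCollisionOnGrid]
  rw [this]
  exact MeasurableSet.iInter fun k => MeasurableSet.iInter fun hk =>
    measurableSet_past_rel X (add_le_add_right (nsmul_div_le d hk.le) t)
      (add_le_add_right (nsmul_div_le d hk) t) fun z y => StrictMono z ∧ Interlace z y

/-- Integer times suffice for the survival limit, since the survival events decrease in time.
Separation comes from the holding probabilities `exp (-(a_x + γ_i))`, with `a_x ≤ R`. -/
theorem baseWalk_birth (ha : ∀ k, 0 < a k) (haR : ∀ k, a k ≤ R) {γ : Fin N → ℝ}
    (hγ0 : ∀ i, 0 ≤ γ i) (hγ : StrictMono γ) :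
    BaseWalk (fun k => birthTransition a (k : ℝ≥0)) (fun i => harm a (γ i))
      (fun i => Real.exp (γ i)) := by
  have hdoob : ∀ i (k : ℕ), doob (harm a (γ i)) (Real.exp (γ i) ^ k)
      (birthTransition a (k : ℝ≥0)) = birthTransition (fun x => a x + γ i) k := fun i k => by
    rw [birthTransition_doob ha (hγ0 i), ← Real.exp_nat_mul, NNReal.coe_natCast]
  refine ⟨fun x y => birthTransition_nonneg (fun k => (ha k).le) haR _ x y, fun K k => ?_,
    fun i x => harm_pos ha (hγ0 i) x, fun i => Real.exp_pos _, fun i k x => ?_,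
    fun i j hij => ?_⟩
  · rw [← trunc_birthTransition_nsmul, Nat.cast_one, nsmul_one]
  · rw [hdoob]
    exact tendsto_sum_birthTransition (R := R + γ i)
      (fun k => add_nonneg (ha k).le (hγ0 i)) (fun k => by linarith [haR k]) _ _
  · have hne : Real.exp (-γ i) - Real.exp (-γ j) ≠ 0 := fun h0 => hij (hγ.injective
      (neg_injective (Real.exp_injective (sub_eq_zero.1 h0))))
    refine ⟨Real.exp (-R) * |Real.exp (-γ i) - Real.exp (-γ j)|,
      mul_pos (Real.exp_pos _) (abs_pos.2 hne), fun x => ?_⟩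
    have e : ∀ i, doob (harm a (γ i)) (Real.exp (γ i)) (birthTransition a ((1 : ℕ) : ℝ≥0)) x x =
        Real.exp (-a x) * Real.exp (-γ i) := fun i => by
      have := hdoob i 1
      rw [pow_one] at this
      rw [this, birthTransition_self, ← Real.exp_add]
      simp [add_comm]
    rw [e, e, ← mul_sub, abs_mul, abs_of_pos (Real.exp_pos _)]
    gcongr
    exact haR x

variable {Ω : Type*} [MeasurableSpace Ω] {μ : Measure Ω} [IsProbabilityMeasure μ]

/-- Karlin–McGregor formula in continuous time: the probability of having no collision on the grid
converges both to the probability of having no collision at all, by path regularity, and to the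
determinant, by the limit of matrix powers. -/
theorem killedWalk_birth (ha : ∀ k, 0 < a k) (haR : ∀ k, a k ≤ R) {γ : Fin N → ℝ}
    (hγ0 : ∀ i, 0 ≤ γ i) (hγ : StrictMono γ) {x : Fin N → ℕ} {X : ℝ≥0 → Ω → Fin N → ℕ}
    (W : IndepWalks μ (fun i => walkPB a (γ i)) x X)
    (hX : ∀ ω, IsCadlag fun t => X t ω) :
    KilledWalk μ X (fun r => {ω | Interlace (Function.leftLim (fun t => X t ω) r) (X r ω)}) 1
      (fun d => killed (fun i => harm a (γ i)) (fun i => Real.exp (d * γ i))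
        (birthTransition a d)) (survival fun i => harm a (γ i)) := by
  classical
  have ha0 : ∀ k, 0 ≤ a k := fun k => (ha k).le
  have H := baseWalk_birth ha haR hγ0 hγ
  have hh : ∀ i x, 0 < harm a (γ i) x := fun i x => harm_pos ha (hγ0 i) x
  have hmeas : ∀ t d z, StrictMono z → MeasurableSet[past X (t + d)] ({ω | X t ω = z} ∩
      noCollision (fun r => {ω | Interlace (Function.leftLim (fun t => X t ω) r) (X r ω)})
        t (t + d)) := by
    intro t d z hz
    -- The uncountable intersection over times is replaced by the lower limit of the grid events,
    -- which is measurable with respect to the past.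
    have e : {ω | X t ω = z} ∩ noCollision
        (fun r => {ω | Interlace (Function.leftLim (fun t => X t ω) r) (X r ω)}) t (t + d) =
        {ω | X t ω = z} ∩ ⋃ M, ⋂ m, ⋂ (_ : M ≤ m),
          {ω | NoCollisionOnGrid (fun t => X t ω) t d m} := by
      ext ω
      simp only [Set.mem_inter_iff, Set.mem_ofPred_eq, Set.mem_iUnion, Set.mem_iInter]
      refine and_congr_right fun h0 => ?_
      rw [← eventually_atTop]
      have := eventually_noCollisionOnGrid_iff (hX ω) (s := t) (by rw [h0]; exact hz) d
      rw [eventually_congr this, eventually_const]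
      rfl
    rw [e]
    refine (measurableSet_past_eq X le_self_add z).inter (MeasurableSet.iUnion fun M =>
      MeasurableSet.iInter fun m => MeasurableSet.iInter fun _ =>
        measurableSet_noCollisionOnGrid X t d m)
  refine ⟨W.measurableSet_eq, fun r => ?_, fun r ω h => Interlace.strictMono h, hmeas,
    fun t d F z y hF hz hy => ?_, fun s hs v hv m hm => ?_, fun s hs => survival_pos ha hγ0 hγ hs⟩
  · obtain ⟨k, hk⟩ := exists_nat_ge r
    exact ⟨k, by rwa [nsmul_one]⟩
  · obtain ⟨K₁, hK₁⟩ := exists_forall_lt z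
    obtain ⟨K₂, hK₂⟩ := exists_forall_lt y
    obtain ⟨e, rfl⟩ := Cfg.exists_toNat_eq (K := max K₁ K₂) hz
      fun i => (hK₁ i).trans_le (le_max_left _ _)
    obtain ⟨e', rfl⟩ := Cfg.exists_toNat_eq (K := max K₁ K₂) hy
      fun i => (hK₂ i).trans_le (le_max_right _ _)
    have hfun : (fun i => walkPB a (γ i)) = fun i (t : ℝ≥0) =>
        doob (harm a (γ i)) (Real.exp (t * γ i)) (birthTransition a t) := by
      funext i t
      exact birthTransition_doob ha (hγ0 i) t
    have hsteps := fun m : ℕ => (hfun ▸ W).isMarkov.measureReal_steps W.measurableSet_eq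
      (fun t z y => Finset.prod_nonneg fun i _ => mul_nonneg
        (div_nonneg (hh i _).le (mul_nonneg (hh i _).le (Real.exp_nonneg _)))
        (birthTransition_nonneg ha0 haR t _ _))
      (fun t z y hzy => prod_doob_eq_zero _ _ (birthTransition_eq_zero a t) hzy)
      (C := fun z y => StrictMono z ∧ Interlace z y) (fun z y h => h.1) hF e (d / m) m e'
    have hlim1 := (tendsto_interlaced_doob_pow (hd := fun _ _ => Classical.propDecidable _) ha0 haR
      (fun i x => (hh i x).ne') γ d e e').const_mul (μ.real (F ∩ {ω | X t ω = e.toNat}))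
    set A := F ∩ {ω | X t ω = e.toNat} ∩ noCollision
      (fun r => {ω | Interlace (Function.leftLim (fun t => X t ω) r) (X r ω)}) t (t + d) ∩
        {ω | X (t + d) ω = e'.toNat} with hA
    set B : ℕ → Set Ω := fun m => F ∩ {ω | X t ω = e.toNat} ∩
      {ω | NoCollisionOnGrid (fun t => X t ω) t d m} ∩ {ω | X (t + d) ω = e'.toNat} with hB
    -- For each path the grid events eventually agree with the true event, so the indicators
    -- converge pointwise.
    have hlim2 : Tendsto (fun m => μ.real (B m)) atTop (𝓝 (μ.real A)) := by
      refine (ENNReal.tendsto_toReal (measure_ne_top μ A)).comp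
        (tendsto_measure_of_tendsto_indicator_of_isFiniteMeasure atTop μ (fun m => ?_) fun ω => ?_)
      · have hle := past_le W.measurableSet_eq
        exact (((hle _ _ hF).inter (W.measurableSet_eq _ _)).inter
          (hle _ _ (measurableSet_noCollisionOnGrid X t d m))).inter (W.measurableSet_eq _ _)
      · by_cases h0 : X t ω = e.toNat
        · filter_upwards [eventually_noCollisionOnGrid_iff (hX ω) (s := t)
            (by rw [h0]; exact hz) d] with m hm
          simp only [hA, hB, Set.mem_inter_iff, Set.mem_ofPred_eq, hm]
          rfl
        · refine Eventually.of_forall fun m => iff_of_false (fun h => h0 h.1.1.2)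
            fun h => h0 h.1.1.2
    refine tendsto_nhds_unique hlim2 (hlim1.congr' ?_)
    filter_upwards [eventually_gt_atTop 0] with m hm
    have := hsteps m
    rw [nsmul_div_self d hm] at this
    exact this.symm
  · have hκ : ∀ k : ℕ, killed (fun i => harm a (γ i))
        (fun i => Real.exp (((k • (1 : ℝ≥0) : ℝ≥0) : ℝ) * γ i))
        (birthTransition a (k • (1 : ℝ≥0))) = killed (fun i => harm a (γ i))
        (fun i => Real.exp (γ i) ^ k) (birthTransition a (k : ℝ≥0)) := fun k => by
      simp only [nsmul_one, NNReal.coe_natCast, Real.exp_nat_mul]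
    simp only [hκ] at hm
    have hpos : ∀ (k : ℕ) (y : Fin N → ℕ),
        0 ≤ ∏ i, harm a (γ i) (y i) / (harm a (γ i) (s i) * Real.exp (γ i) ^ k) := fun k y =>
      Finset.prod_nonneg fun i _ => div_nonneg (hh i _).le
        (mul_nonneg (hh i _).le (pow_nonneg (Real.exp_nonneg _) _))
    refine H.tendsto_survival (fun σ y hy => prod_harm_perm_le ha hγ0 hγ hy σ) s
      (fun k y hy => ?_) (fun k y hy => ?_) hv hm
    · exact mul_nonneg (hpos k y) (det_birthTransition_bounds ha0 haR k hs hy).1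
    · rw [prod_doob]
      exact mul_le_mul_of_nonneg_left (det_birthTransition_bounds ha0 haR k hs hy).2 (hpos k y)

theorem collisionTimePB_eq_top_iff (p : ℝ≥0 → Fin N → ℕ) :
    collisionTimePB p = ⊤ ↔ ∀ t, 0 < t → Interlace (Function.leftLim p t) (p t) := by
  rw [collisionTimePB, sInf_eq_top]
  constructor
  · intro h t ht
    by_contra hc
    exact absurd (h _ ⟨t, ⟨ht, hc⟩, rfl⟩) (by simp)
  · rintro h _ ⟨t, ⟨ht, hc⟩, rfl⟩
    exact absurd (h t ht) hc

theorem conditionedOn_birth (ha_inf : 0 < ⨅ k, a k) (ha_sup : BddAbove (Set.range a))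
    {γ : Fin N → ℝ} {x : Fin N → ℕ} (hx : StrictMono x) (hγ0 : ∀ i, 0 ≤ γ i)
    (hsep : ∀ i j : Fin N, (i : ℕ) + 1 = (j : ℕ) → γ j - γ i > (⨆ k, a k) - ⨅ k, a k)
    {X : ℝ≥0 → Ω → Fin N → ℕ} (W : IndepWalks μ (fun i => walkPB a (γ i)) x X)
    (hX : ∀ ω, IsCadlag fun t => X t ω) :
    ConditionedOn μ X x {ω | collisionTimePB (fun t => X t ω) = ⊤} (fun i => hPB a (γ i))
      (kernelPB a γ) := by
  have ha := apply_pos ha_inf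
  have hmM : ⨅ k, a k ≤ ⨆ k, a k := (iInf_le_apply ha_inf 0).trans (le_ciSup ha_sup 0)
  have hγ : StrictMono γ := strictMono_of_consecutive fun i j hij => by
    have := hsep i j hij
    linarith
  have P := killedWalk_birth ha (fun k => le_ciSup ha_sup k) hγ0 hγ W hX
  have hA : {ω | collisionTimePB (fun t => X t ω) = ⊤} = noCollisionAfter
      (fun r => {ω | Interlace (Function.leftLim (fun t => X t ω) r) (X r ω)}) 0 := by
    ext ω
    exact collisionTimePB_eq_top_iff _
  have hh : (fun i => hPB a (γ i)) = fun i x => (harm a (γ i) x : ℂ) :=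
    funext fun i => funext fun x => charPoly_neg_ofReal a (γ i) x
  rw [hA, hh]
  refine P.conditionedOn hx W.initial (fun s _ => ofReal_survival _ s) fun d z y hz hy => ?_
  rw [← transformedKernel_eq (fun i x => (harm_pos ha (hγ0 i) x).ne'), kernelPB, hh]
  congr 1
  · funext j
    push_cast
    rfl
  · funext x y
    rw [toeplitz_birth ha_inf ha_sup, walkPB]
    simp only [add_zero]

end Birth

end CondWalks

/-! ### The three cases together -/

theorem mainTheorem5 {Ω : Type*} [MeasurableSpace Ω] (μ : Measure Ω) [IsProbabilityMeasure μ]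
    (a : ℕ → ℝ) (ha_inf : 0 < ⨅ k, a k) (ha_sup : BddAbove (Set.range a))
    (N : ℕ) (hN : 1 ≤ N) (γ : Fin N → ℝ) (x : Fin N → ℕ) (hx : x ∈ CondWalks.Weyl N) :
    -- pure-birth chains
    ((∀ i, 0 ≤ γ i) →
      (∀ i j : Fin N, (i : ℕ) + 1 = (j : ℕ) → γ j - γ i > (⨆ k, a k) - ⨅ k, a k) →
      ∀ X : ℝ≥0 → Ω → Fin N → ℕ,
        CondWalks.IndepWalks μ (fun i => CondWalks.walkPB a (γ i)) x X →
        (∀ ω, CondWalks.IsCadlag fun t => X t ω) →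
        CondWalks.ConditionedOn μ X x
          {ω | CondWalks.collisionTimePB (fun t => X t ω) = ⊤}
          (fun i => CondWalks.hPB a (γ i)) (CondWalks.kernelPB a γ)) ∧
    -- Bernoulli walks
    ((∀ k, a k ≤ 1) → (∀ i, 0 < γ i ∧ γ i ≤ 1) →
      (∀ i j : Fin N, (i : ℕ) + 1 = (j : ℕ) →
        γ j / γ i < (1 - ⨆ k, a k) / (1 - ⨅ k, a k)) →
      ∀ X : ℕ → Ω → Fin N → ℕ,
        CondWalks.IndepWalks μ (fun i => CondWalks.walkB a (γ i)) x X →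
        CondWalks.ConditionedOn μ X x
          {ω | CondWalks.collisionTimeB (fun t => X t ω) = ⊤}
          (fun i => CondWalks.hB a (γ i)) (CondWalks.kernelB a γ)) ∧
    -- geometric walks
    ((∀ i, 1 ≤ γ i) →
      (∀ i j : Fin N, (i : ℕ) + 1 = (j : ℕ) →
        γ j / γ i > (1 + ⨆ k, a k) / (1 + ⨅ k, a k)) →
      ∀ X : ℕ → Ω → Fin N → ℕ,
        CondWalks.IndepWalks μ (fun i => CondWalks.walkG a (γ i)) x X →
        CondWalks.ConditionedOn μ X x
          {ω | CondWalks.collisionTimeG (fun t => X t ω) = ⊤}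
          (fun i => CondWalks.hG a (γ i)) (CondWalks.kernelG a γ)) := by
  refine ⟨fun hγ hsep X W hX =>
      CondWalks.conditionedOn_birth ha_inf ha_sup hx hγ hsep W hX,
    fun ha1 hγ hsep X W => CondWalks.conditionedOn_bernoulli ha_inf ha_sup hx ha1 hγ hsep W,
    fun hγ hsep X W => CondWalks.conditionedOn_geometric ha_inf ha_sup hx hγ hsep W⟩
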